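/- Let $\mathcal C\subset\mathbb R^3$ be a bounded Lipschitz domain (the cavity) and let $\mathcal S\subset\mathbb R^3$ be a bounded open set with $\overline{\mathcal C}\subset\mathcal S$; the set $\mathcal B:=\mathcal S\setminus\mathcal C$ is the region occupied by a rigid body, with integrable mass density $\rho_{\mathcal B}\ge 0$, mass $m_{\mathcal B}=\int_{\mathcal B}\rho_{\mathcal B}>0$, center of mass at the origin ($\int_{\mathcal B}\rho_{\mathcal B}\,x=0$) and inertia tensor $I_C$ given by $I_C\cdot a=\int_{\mathcal B}\rho_{\mathcal B}\,(|x|^2a-(x\cdot a)x)$. Let $\mu>0$, $\lambda\ge 0$, $a>0$, $\gamma>1$, $p(r)=a\,r^\gamma$, and $$S(\nabla w)=\mu\big(\nabla w+(\nabla w)^\top\big)+\big(\lambda-\tfrac23\mu\big)(\operatorname{div}w)\,\mathbf 1 .$$ Let $\gamma^*=\frac{3\gamma}{3+\gamma}$ if $\gamma>6$, $\gamma^*=\frac{9\gamma}{5\gamma-3}$ if $\frac32<\gamma\le 6$, $\gamma^*$ some number larger than $3$ if $\gamma=\frac32$, and $\gamma^*=\frac{\gamma}{\gamma-1}$ if $\gamma<\frac32$.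 A quadruple $(\rho,u,\omega,\xi)$ with $\rho\in L^\gamma(\mathcal C)$, $\rho\ge0$ a.e., $u\in W^{1,\gamma^*}(\mathcal S;\mathbb R^3)$ and $\omega,\xi\in\mathbb R^3$ such that $u=\omega\times x+\xi$ a.e. on $\mathcal B$ is called a renormalized weak solution of the steady problem if, with $v:=u-\omega\times x-\xi$: (a) $m_{\mathcal B}\,\xi=-\int_{\mathcal C}\rho\,u$ and $\omega\times M=0$, where $M=I_C\cdot\omega+\int_{\mathcal C}\rho\,x\times u$; (b) $\int_{\mathcal C}\big[-(\rho\,v\otimes u):\nabla\varphi+\rho\,(\omega\times u)\cdot\varphi-p(\rho)\operatorname{div}\varphi\big]=-\int_{\mathcal C}S(\nabla u):\nabla\varphi$ for all $\varphi\in C_0^\infty(\mathcal C;\mathbb R^3)$, where $(v\otimes u):\nabla\varphi=\sum_{i,j}v_iu_j\,\partial_i\varphi_j$; (c) $\int_{\mathcal C}\rho\,v\cdot\nabla\psi=0$ for all $\psi\in C_0^\infty(\mathcal C)$; (d) with $\rho$ and $v$ extended by $0$ outside $\mathcal C$, the renormalized continuity equation $$\operatorname{div}(b(\rho)v)+\big(\rho\,b'(\rho)-b(\rho)\big)\operatorname{div}v=0$$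 holds in the sense of distributions in $\mathbb R^3$ for every $b\in C^1([0,\infty))$ with $b(0)=0$, $b'$ bounded from below on $[0,\infty)$, $|b'(t)|\le c\,t^{-\lambda_0}$ on $(0,1]$ and $|b'(t)|\le c\,t^{\lambda_1}$ on $[1,\infty)$ for some $c>0$, $\lambda_0<1$, $\lambda_1>-1$, for which $b(\rho)v$ and $(\rho\,b'(\rho)-b(\rho))\operatorname{div}v$ are integrable on $\mathcal C$. Then for every renormalized weak solution $(\rho,u,\omega,\xi)$ of the steady problem the relative velocity vanishes: $v=0$ a.e. in $\mathcal C$. -/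

import Mathlib

open MeasureTheory Set
open scoped ContDiff RealInnerProductSpace NNReal

noncomputable section

namespace BodyFluid

/-- Three-dimensional Euclidean space. -/
abbrev E3 : Type := EuclideanSpace ℝ (Fin 3)

/-! ### Vector and tensor algebra. A second-order tensor is a linear map of the space into itself;
the gradient `∇w` of a vector field is its derivative, `∇w e_j = ∂_j w`. -/

/-- The vector product `a × b`. -/
def cross (a b : E3) : E3 :=
  WithLp.toLp 2 (crossProduct (WithLp.ofLp a) (WithLp.ofLp b))

/-- The tensor `x ↦ a × x`. -/
def crossTensor (a : E3) : E3 →L[ℝ] E3 :=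
  LinearMap.toContinuousLinearMap
    (((WithLp.linearEquiv 2 ℝ (Fin 3 → ℝ)).symm.toLinearMap.comp
      (crossProduct (WithLp.ofLp a))).comp (WithLp.linearEquiv 2 ℝ (Fin 3 → ℝ)).toLinearMap)

theorem crossTensor_apply (a x : E3) : crossTensor a x = cross a x := rfl

/-- The canonical basis vector `e_i`. -/
def e (i : Fin 3) : E3 := EuclideanSpace.single i 1

/-- The trace of a tensor; the trace of `∇w` is `div w`. -/
def tr (A : E3 →L[ℝ] E3) : ℝ := ∑ i, A (e i) i

/-- The double contraction `A : B = ∑_{i,j} A_{ij} B_{ij}`. -/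
def contract (A B : E3 →L[ℝ] E3) : ℝ := ∑ j, ∑ i, A (e j) i * B (e j) i

/-- The viscous stress `S(A) = μ (A + Aᵀ) + (λ - 2μ/3) (tr A) 1`. -/
def stress (mu lam : ℝ) (A : E3 →L[ℝ] E3) : E3 →L[ℝ] E3 :=
  mu • (A + ContinuousLinearMap.adjoint A)
    + ((lam - 2 / 3 * mu) * tr A) • ContinuousLinearMap.id ℝ E3

/-! ### Lipschitz domains and Sobolev functions -/

/-- The open set `Ω` has Lipschitz boundary: near each boundary point, in suitable orthonormal
coordinates, `Ω` is the set of points above the graph of a Lipschitz function of two variables. -/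
def HasLipschitzBoundary (Ω : Set E3) : Prop :=
  ∀ x ∈ frontier Ω, ∃ r : ℝ, 0 < r ∧ ∃ (A : E3 ≃ₗᵢ[ℝ] E3)
    (g : EuclideanSpace ℝ (Fin 2) → ℝ) (K : ℝ≥0), LipschitzWith K g ∧
      ∀ y ∈ Metric.ball x r, (y ∈ Ω ↔ g (!₂[A y 0, A y 1]) < A y 2)

/-- Test functions: `φ ∈ C_0^∞(Ω)` with values in `F`. -/
def IsTest {F : Type*} [NormedAddCommGroup F] [NormedSpace ℝ F] (Ω : Set E3) (φ : E3 → F) : Prop :=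
  ContDiff ℝ ∞ φ ∧ HasCompactSupport φ ∧ tsupport φ ⊆ Ω

/-- `G` is the weak gradient in `Ω` of the vector field `w`. -/
def HasWeakGradient (Ω : Set E3) (w : E3 → E3) (G : E3 → E3 →L[ℝ] E3) : Prop :=
  LocallyIntegrableOn w Ω ∧ LocallyIntegrableOn G Ω ∧
    ∀ φ : E3 → ℝ, IsTest Ω φ → ∀ h : E3,
      ∫ x in Ω, (fderiv ℝ φ x h) • w x = - ∫ x in Ω, φ x • G x h

/-- `w ∈ W^{1,s}(Ω)`, with weak gradient `G`. -/
def MemW1 (Ω : Set E3) (s : ℝ) (w : E3 → E3) (G : E3 → E3 →L[ℝ] E3) : Prop :=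
  HasWeakGradient Ω w G ∧ MemLp w (ENNReal.ofReal s) (volume.restrict Ω) ∧
    MemLp G (ENNReal.ofReal s) (volume.restrict Ω)

/-! ### The body, the cavity and the coupled system -/

/-- A rigid body with an interior cavity, in a frame attached to the body, with origin in its
center of mass. `cavity` is the domain filled by the fluid, `system` the (open) region occupied by
body and fluid together, and `density` the mass density of the body. -/
structure CavityBody where
  cavity : Set E3
  system : Set E3
  density : E3 → ℝ
  isOpen_cavity : IsOpen cavity
  isConnected_cavity : IsConnected cavity
  isBounded_cavity : Bornology.IsBounded cavity
  lipschitz_cavity : HasLipschitzBoundary cavity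
  isOpen_system : IsOpen system
  isBounded_system : Bornology.IsBounded system
  closure_cavity_subset : closure cavity ⊆ system
  density_nonneg : ∀ x ∈ system \ cavity, 0 ≤ density x
  density_integrable : IntegrableOn density (system \ cavity)
  mass_pos : 0 < ∫ x in system \ cavity, density x
  center_of_mass : ∫ x in system \ cavity, density x • x = 0

namespace CavityBody

variable (P : CavityBody)

/-- The region occupied by the body. -/
def body : Set E3 := P.system \ P.cavity

/-- The mass of the body. -/
def mass : ℝ := ∫ x in P.body, P.density x

/-- `I_C · a`, where `I_C` is the inertia tensor of the body with respect to its center of mass. -/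
def inertia (a : E3) : E3 := ∫ x in P.body, P.density x • ((‖x‖ ^ 2) • a - ⟪x, a⟫ • x)

end CavityBody

/-! ### Renormalized weak solutions of the steady problem -/

/-- The admissible exponents for the velocity when the density lies in `L^γ`; for `γ = 3/2`
every exponent larger than `3` is admissible. -/
def IsVelocityExponent (γ s : ℝ) : Prop :=
  (6 < γ ∧ s = 3 * γ / (3 + γ)) ∨
  (3 / 2 < γ ∧ γ ≤ 6 ∧ s = 9 * γ / (5 * γ - 3)) ∨
  (γ = 3 / 2 ∧ 3 < s) ∨
  (γ < 3 / 2 ∧ s = γ / (γ - 1))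

/-- The derivative `b'` of a function `b` on `[0, ∞)` (one-sided at `0`). -/
def derivIci (b : ℝ → ℝ) (t : ℝ) : ℝ := derivWithin b (Ici 0) t

/-- The functions `b` for which the continuity equation is renormalized. -/
def IsRenormalizer (b : ℝ → ℝ) : Prop :=
  ContDiffOn ℝ 1 b (Ici 0) ∧ b 0 = 0 ∧
  (∃ Cb : ℝ, ∀ r : ℝ, 0 ≤ r → Cb ≤ derivIci b r) ∧
  ∃ c l0 l1 : ℝ, 0 < c ∧ l0 < 1 ∧ -1 < l1 ∧
    (∀ t : ℝ, 0 < t → t ≤ 1 → |derivIci b t| ≤ c * t ^ (-l0)) ∧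
    (∀ t : ℝ, 1 ≤ t → |derivIci b t| ≤ c * t ^ l1)

/-- The relative velocity `v = u - om × x - ξ`. -/
def relVel (u : E3 → E3) (om ξ : E3) (x : E3) : E3 := u x - cross om x - ξ

/-- The gradient of the relative velocity, where `G` is the gradient of `u`. -/
def relGrad (G : E3 → E3 →L[ℝ] E3) (om : E3) (x : E3) : E3 →L[ℝ] E3 := G x - crossTensor om

/-- The isentropic pressure law `p(r) = a r^γ`. -/
def pressure (a γ r : ℝ) : ℝ := a * r ^ γ

/-- The weak form of the momentum equation
`div (ρ v ⊗ u) + ρ om × u + ∇p(ρ) = div S(∇u)` in `C`. Here `(v ⊗ u) : ∇φ = u · (∇φ v)`. -/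
def WeakMomentum (C : Set E3) (mu lam a γ : ℝ) (ρ : E3 → ℝ) (u : E3 → E3)
    (G : E3 → E3 →L[ℝ] E3) (om ξ : E3) : Prop :=
  ∀ φ : E3 → E3, IsTest C φ →
    ∫ x in C, (-(ρ x * ⟪u x, fderiv ℝ φ x (relVel u om ξ x)⟫) + ρ x * ⟪cross om (u x), φ x⟫
        - pressure a γ (ρ x) * tr (fderiv ℝ φ x))
      = - ∫ x in C, contract (stress mu lam (G x)) (fderiv ℝ φ x)

/-- The weak form of the continuity equation `div (ρ v) = 0` in `C`. -/
def WeakContinuity (C : Set E3) (ρ : E3 → ℝ) (u : E3 → E3) (om ξ : E3) : Prop :=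
  ∀ ψ : E3 → ℝ, IsTest C ψ → ∫ x in C, ρ x * fderiv ℝ ψ x (relVel u om ξ x) = 0

/-- The renormalized continuity equation `div (b(ρ) v) + (ρ b'(ρ) - b(ρ)) div v = 0`, in the sense
of distributions in the whole space with `ρ` and `v` extended by zero outside `C` (so that all the
integrands vanish outside `C`), for every admissible `b` for which the two terms `b(ρ) v` and
`(ρ b'(ρ) - b(ρ)) div v` are integrable, hence define distributions. -/
def RenormalizedContinuity (C : Set E3) (ρ : E3 → ℝ) (u : E3 → E3)
    (G : E3 → E3 →L[ℝ] E3) (om ξ : E3) : Prop :=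
  ∀ b : ℝ → ℝ, IsRenormalizer b →
    IntegrableOn (fun x => b (ρ x) • relVel u om ξ x) C →
    IntegrableOn (fun x => (ρ x * derivIci b (ρ x) - b (ρ x)) * tr (relGrad G om x)) C →
    ∀ ψ : E3 → ℝ, IsTest univ ψ →
      - (∫ x in C, b (ρ x) * fderiv ℝ ψ x (relVel u om ξ x))
        + ∫ x in C, (ρ x * derivIci b (ρ x) - b (ρ x)) * tr (relGrad G om x) * ψ x = 0

/-- The total angular momentum `M = I_C · om + ∫_C ρ x × u`. -/
def angularMomentum (P : CavityBody) (ρ : E3 → ℝ) (u : E3 → E3) (om : E3) : E3 :=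
  P.inertia om + ∫ x in P.cavity, ρ x • cross x (u x)

/-- `(ρ, u, om, ξ)` is a renormalized weak solution of the steady problem. -/
def IsRenormalizedWeakSolution (P : CavityBody) (mu lam a γ : ℝ)
    (ρ : E3 → ℝ) (u : E3 → E3) (om ξ : E3) : Prop :=
  MemLp ρ (ENNReal.ofReal γ) (volume.restrict P.cavity) ∧
  (∀ᵐ x ∂(volume.restrict P.cavity), 0 ≤ ρ x) ∧
  (∀ᵐ x ∂(volume.restrict P.body), u x = cross om x + ξ) ∧
  P.mass • ξ = - ∫ x in P.cavity, ρ x • u x ∧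
  cross om (angularMomentum P ρ u om) = 0 ∧
  ∃ (s : ℝ) (G : E3 → E3 →L[ℝ] E3), IsVelocityExponent γ s ∧ MemW1 P.system s u G ∧
    WeakMomentum P.cavity mu lam a γ ρ u G om ξ ∧
    WeakContinuity P.cavity ρ u om ξ ∧
    RenormalizedContinuity P.cavity ρ u G om ξ

end BodyFluid

end

/-!
The relative velocity `v` vanishes because it dissipates no energy. Testing the momentum equation
with `v` itself, one finds that every other term does no work. The pressure term is
`a ∫ ρ ^ γ div v`, which is zero by the renormalized continuity equation for `b(t) = t ^ γ`. The
convective term is the continuity equation tested with `|v|² / 2 + U · v`, where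
`U = om × x + ξ`. The Coriolis term reduces to `∫ ρ (om × U) · v`, and `om × U` is a gradient, so that
it is zero by the continuity equation up to the boundary. What remains is `∫ S(∇v) : ∇v = 0`; the
integrand is a nonnegative combination of the squares of the deviatoric symmetric gradient and of the
divergence. Extended by zero, `v` belongs to `W^{1,s}` of the whole space, where a field of compact
support with vanishing deviatoric symmetric gradient is zero, by an integration by parts.

To test with `v`, every term has to be a bounded functional on `W^{1,s}`. The exponents are such that
this holds for the convective term, by Sobolev's inequality. For the pressure, which is only known
to be integrable, it has to be proved (`memLp_pressure`): the equation itself says that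
`φ ↦ ∫ p div φ` is bounded by the `L^s` norm of `∇φ`, and it remains to solve `div φ = g` near each
point of the closure of the cavity, with `φ` a test field of the cavity and `∇φ` bounded by `g` in
`L^s`. Near a boundary point the Lipschitz cavity contains translates of a fixed cone. There is a
smooth field `Θ` supported in this cone with `div Θ = 8 σ(2 x) - σ(x)`, where `σ` is a mollifier
(`exists_cone_kernel`); the sum of its rescalings `4ⁿ Θ(2ⁿ x)`, `n < N`, has divergence
`8ᴺ σ(2ᴺ x) - σ(x)`, and convolution with it is up to a smoothing operator an approximate right
inverse of the divergence (`HasConeAt.exists_approx_right_inverse`). Its gradient is a singular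
integral with a kernel which is a sum of dilations of a single test function of mean zero. Such
operators are bounded on `L²` by Plancherel's theorem, and on `L^s`, `s > 2`, by a good-`λ` inequality
for the maximal function of the square (`exists_singular_integral_bound`).

Mollification with `σ` also shows that `v` is a limit of test fields of the cavity
(`exists_isTest_tendsto`), and the rescalings of `Θ` give the Sobolev embedding into bounded functions
for `s > 3` (`exists_eLpNorm_top_le`).
-/

open scoped ENNReal

noncomputable section

namespace BodyFluid

open scoped Convolution FourierTransform
open ContinuousLinearMap (lsmul)

/-! ### The Hardy–Littlewood maximal function -/

theorem volume_ball_mul (x y : E3) {c r : ℝ} (hc : 0 ≤ c) :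
    volume (Metric.ball x (c * r)) = ENNReal.ofReal (c ^ 3) * volume (Metric.ball y r) := by
  have h := Measure.addHaar_ball_mul (volume : Measure E3) x hc r
  rw [finrank_euclideanSpace_fin] at h
  rw [h, Measure.addHaar_ball_center volume y r]

theorem volume_ball_ne_zero (x : E3) {r : ℝ} (hr : 0 < r) : volume (Metric.ball x r) ≠ 0 :=
  (Metric.measure_ball_pos volume x hr).ne'

theorem volume_ball_ne_top (x : E3) (r : ℝ) : volume (Metric.ball x r) ≠ ⊤ :=
  measure_ball_lt_top.ne

/-- The set where the Hardy–Littlewood maximal function of `U` exceeds `l`. The inequality between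
the averages is cleared of denominators. -/
def superLevel (U : E3 → ℝ≥0∞) (l : ℝ≥0∞) : Set E3 :=
  {x | ∃ r : ℝ, 0 < r ∧ l * volume (Metric.ball x r) < ∫⁻ y in Metric.ball x r, U y}

theorem superLevel_anti (U : E3 → ℝ≥0∞) {l l' : ℝ≥0∞} (h : l ≤ l') :
    superLevel U l' ⊆ superLevel U l := by
  rintro x ⟨r, hr, hx⟩
  exact ⟨r, hr, lt_of_le_of_lt (by gcongr) hx⟩

/-- If balls of radius `r` have small measure then `r` is bounded. -/
theorem exists_radius_bound {l I : ℝ≥0∞} (hl : l ≠ 0) (hI : I ≠ ⊤) :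
    ∃ R : ℝ, ∀ (x : E3) (r : ℝ), l * volume (Metric.ball x r) < I → r ≤ R := by
  set c := l * volume (Metric.ball (0 : E3) 1) with hc
  have hc0 : c ≠ 0 := mul_ne_zero hl (volume_ball_ne_zero 0 one_pos)
  refine ⟨max 1 (I / c).toReal, fun x r h => ?_⟩
  by_contra! hlt
  obtain ⟨h1, h2⟩ := max_lt_iff.1 hlt
  have hb := volume_ball_mul x 0 (c := r) (r := 1) (by linarith)
  rw [mul_one] at hb
  rw [hb, mul_left_comm, ← hc] at h
  have h3 : ENNReal.ofReal (r ^ 3) ≤ I / c :=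
    (ENNReal.le_div_iff_mul_le (Or.inl hc0) (Or.inr hI)).2 h.le
  have h4 : r ≤ r ^ 3 := le_self_pow₀ h1.le (by norm_num)
  have h5 : r ^ 3 ≤ (I / c).toReal :=
    (ENNReal.ofReal_le_iff_le_toReal (ENNReal.div_ne_top hI hc0)).1 h3
  linarith

/-- Vitali's covering lemma for a set `S` of centres. -/
theorem exists_vitali_cover (S : Set E3) (r : E3 → ℝ) {R : ℝ} (hr : ∀ x ∈ S, 0 < r x ∧ r x ≤ R) :
    ∃ u ⊆ S, u.Countable ∧ (u.PairwiseDisjoint fun a => Metric.ball a (r a)) ∧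
      S ⊆ ⋃ a ∈ u, Metric.ball a (5 * r a) := by
  obtain ⟨u, hu, hd, hc⟩ := Vitali.exists_disjoint_subfamily_covering_enlargement_ball
    S (fun x => x) r R (fun a ha => (hr a ha).2) 5 (by norm_num)
  refine ⟨u, hu, ?_, hd, ?_⟩
  · refine hd.countable_of_isOpen (fun _ _ => Metric.isOpen_ball) fun a ha => ?_
    exact ⟨a, Metric.mem_ball_self (hr a (hu ha)).1⟩
  · intro x hx
    obtain ⟨b, hb, hs⟩ := hc x hx
    exact mem_biUnion hb (hs (Metric.mem_ball_self (hr x hx).1))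

/-- The weak type `(1,1)` inequality for the maximal function. -/
theorem mul_volume_superLevel_le (U : E3 → ℝ≥0∞) (l : ℝ≥0∞) :
    l * volume (superLevel U l) ≤ 125 * ∫⁻ y, U y := by
  rcases eq_or_ne l 0 with rfl | hl
  · simp
  by_cases hI : ∫⁻ y, U y = ⊤
  · rw [hI]; simp
  obtain ⟨R, hR⟩ := exists_radius_bound hl hI
  have hx : ∀ x : E3, ∃ r : ℝ, x ∈ superLevel U l →
      0 < r ∧ l * volume (Metric.ball x r) < ∫⁻ y in Metric.ball x r, U y := by
    intro x
    by_cases h : x ∈ superLevel U l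
    · obtain ⟨r, hr⟩ := h
      exact ⟨r, fun _ => hr⟩
    · exact ⟨0, fun h' => absurd h' h⟩
  choose r hr using hx
  obtain ⟨u, hu, huc, hd, hcov⟩ := exists_vitali_cover (superLevel U l) r (R := R) fun x hx =>
    ⟨(hr x hx).1, hR x _ ((hr x hx).2.trans_le (setLIntegral_le_lintegral _ _))⟩
  calc l * volume (superLevel U l) ≤ l * ∑' a : u, volume (Metric.ball (a : E3) (5 * r a)) := by
        gcongr
        refine (measure_mono hcov).trans ?_
        exact measure_biUnion_le _ huc _
    _ = 125 * ∑' a : u, l * volume (Metric.ball (a : E3) (r a)) := by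
        rw [← ENNReal.tsum_mul_left, ← ENNReal.tsum_mul_left]
        congr 1
        ext a
        rw [volume_ball_mul _ (a : E3) (by norm_num : (0 : ℝ) ≤ 5)]
        norm_num
        ring
    _ ≤ 125 * ∑' a : u, ∫⁻ y in Metric.ball (a : E3) (r a), U y := by
        gcongr with a
        exact (hr a (hu a.2)).2.le
    _ = 125 * ∫⁻ y in ⋃ a ∈ u, Metric.ball a (r a), U y := by
        rw [lintegral_biUnion huc (fun _ _ => Metric.isOpen_ball.measurableSet) hd]
    _ ≤ 125 * ∫⁻ y, U y := by
        gcongr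
        exact Measure.restrict_le_self

/-- The distributional form of the strong type `(q,q)` inequality for the maximal function. -/
theorem exists_maximal_strong_type {q : ℝ} (hq : 1 < q) :
    ∃ C : ℝ≥0∞, C ≠ ⊤ ∧ ∀ G : E3 → ℝ, Measurable G → (∀ x, 0 ≤ G x) →
      ∫⁻ t in Ioi (0 : ℝ), volume (superLevel (fun x => ENNReal.ofReal (G x)) (ENNReal.ofReal t))
          * ENNReal.ofReal (t ^ (q - 1))
        ≤ C * ∫⁻ x, ENNReal.ofReal (G x ^ q) := by
  have hq1 : 0 < q - 1 := by linarith
  refine ⟨250 * (ENNReal.ofReal (q - 1))⁻¹ * ENNReal.ofReal (2 ^ (q - 1)), ?_, ?_⟩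
  · refine ENNReal.mul_ne_top (ENNReal.mul_ne_top (by norm_num) ?_) ENNReal.ofReal_ne_top
    simpa [ENNReal.inv_eq_top] using hq
  intro G hG hG0
  set V : E3 → ℝ≥0∞ := fun x => ENNReal.ofReal (G x) with hV
  have hVm : Measurable V := hG.ennreal_ofReal
  set ν := (volume : Measure E3).withDensity V with hν
  have hsets : ∀ t : ℝ, MeasurableSet {a : E3 | t < 2 * G a} := fun t =>
    measurableSet_lt measurable_const (hG.const_mul 2)
  -- at height `t` only the part of `G` above `t / 2` matters
  have key : ∀ t ∈ Ioi (0 : ℝ), volume (superLevel V (ENNReal.ofReal t)) * ENNReal.ofReal (t ^ (q - 1))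
      ≤ 250 * (ν {a | t < 2 * G a} * ENNReal.ofReal (t ^ ((q - 1) - 1))) := by
    intro t ht
    have ht : 0 < t := ht
    set V' : E3 → ℝ≥0∞ := indicator {a | t < 2 * G a} V with hV'
    have hle : ∀ x, V x ≤ V' x + ENNReal.ofReal (t / 2) := by
      intro x
      by_cases hx : t < 2 * G x
      · rw [hV', indicator_of_mem (by exact hx)]
        exact le_self_add
      · refine le_trans (ENNReal.ofReal_le_ofReal (by linarith)) le_add_self
    have hsub : superLevel V (ENNReal.ofReal t) ⊆ superLevel V' (ENNReal.ofReal (t / 2)) := by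
      rintro x ⟨r, hr, hx⟩
      refine ⟨r, hr, ?_⟩
      have h1 : ∫⁻ y in Metric.ball x r, V y
          ≤ (∫⁻ y in Metric.ball x r, V' y)
            + ENNReal.ofReal (t / 2) * volume (Metric.ball x r) := by
        refine (lintegral_mono hle).trans ?_
        rw [lintegral_add_right _ measurable_const]
        simp
      have h2 := hx.trans_le h1
      have ht2 : ENNReal.ofReal t = ENNReal.ofReal (t / 2) + ENNReal.ofReal (t / 2) := by
        rw [← ENNReal.ofReal_add (by positivity) (by positivity)]
        congr 1
        ring
      rw [ht2, add_mul] at h2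
      exact lt_of_add_lt_add_right h2
    have hw := mul_volume_superLevel_le V' (ENNReal.ofReal (t / 2))
    have hν' : ∫⁻ y, V' y = ν {a | t < 2 * G a} := by
      rw [hν, withDensity_apply _ (hsets t), hV', lintegral_indicator (hsets t)]
    have hpow : ENNReal.ofReal (t ^ (q - 1))
        = 2 * ENNReal.ofReal (t / 2) * ENNReal.ofReal (t ^ ((q - 1) - 1)) := by
      have h2 : (2 : ℝ≥0∞) = ENNReal.ofReal 2 := by simp
      rw [h2, ← ENNReal.ofReal_mul (by norm_num), ← ENNReal.ofReal_mul (by positivity)]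
      congr 1
      rw [Real.rpow_sub_one ht.ne' (q - 1)]
      field_simp
    calc volume (superLevel V (ENNReal.ofReal t)) * ENNReal.ofReal (t ^ (q - 1))
        ≤ volume (superLevel V' (ENNReal.ofReal (t / 2))) * ENNReal.ofReal (t ^ (q - 1)) := by
          gcongr
      _ = 2 * (ENNReal.ofReal (t / 2) * volume (superLevel V' (ENNReal.ofReal (t / 2))))
            * ENNReal.ofReal (t ^ ((q - 1) - 1)) := by
          rw [hpow]; ring
      _ ≤ 2 * (125 * ν {a | t < 2 * G a}) * ENNReal.ofReal (t ^ ((q - 1) - 1)) := by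
          rw [hν'] at hw
          gcongr
      _ = _ := by ring
  calc _ ≤ ∫⁻ t in Ioi (0 : ℝ), 250 * (ν {a | t < 2 * G a} * ENNReal.ofReal (t ^ ((q - 1) - 1))) :=
        setLIntegral_mono' measurableSet_Ioi key
    _ = 250 * ∫⁻ t in Ioi (0 : ℝ), ν {a | t < 2 * G a} * ENNReal.ofReal (t ^ ((q - 1) - 1)) :=
        lintegral_const_mul' _ _ (by norm_num)
    _ = 250 * ((ENNReal.ofReal (q - 1))⁻¹ * ∫⁻ x, ENNReal.ofReal ((2 * G x) ^ (q - 1)) ∂ν) := by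
        rw [lintegral_rpow_eq_lintegral_meas_lt_mul ν
          (Filter.Eventually.of_forall fun x => by have := hG0 x; positivity)
          (hG.const_mul 2).aemeasurable hq1, ← mul_assoc (_⁻¹), ENNReal.inv_mul_cancel,
          one_mul]
        · simpa using hq
        · simp
    _ = 250 * ((ENNReal.ofReal (q - 1))⁻¹ *
          ∫⁻ x, ENNReal.ofReal (2 ^ (q - 1)) * ENNReal.ofReal (G x ^ q)) := by
        rw [hν, lintegral_withDensity_eq_lintegral_mul _ hVm
          (by fun_prop)]
        congr 2
        refine lintegral_congr fun x => ?_
        simp only [Pi.mul_apply, hV]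
        rw [← ENNReal.ofReal_mul (hG0 x), ← ENNReal.ofReal_mul (by positivity)]
        congr 1
        rw [Real.mul_rpow (by norm_num) (hG0 x)]
        rcases (hG0 x).eq_or_lt with h0 | h0
        · rw [← h0, Real.zero_rpow (by linarith : q ≠ 0)]; simp
        · rw [Real.rpow_sub_one h0.ne' q]
          field_simp
    _ = _ := by
        rw [lintegral_const_mul' _ _ ENNReal.ofReal_ne_top]
        ring

/-! ### A good-`λ` inequality -/

/-- On every ball, `U` splits into a part `V` whose integral is controlled by the averages of `G`
around some point `z` of a comparable ball, and a part `W` that is nearly constant. For a singular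
integral operator `T`, this holds for `U = |T g|²` and `G = |g|²`. -/
def HasLocalSplitting (C : ℝ≥0∞) (U G : E3 → ℝ≥0∞) : Prop :=
  ∀ (x₀ z : E3) (ρ : ℝ) (m : ℝ≥0∞), 0 < ρ → z ∈ Metric.ball x₀ (5 * ρ) →
    (∀ r : ℝ, 0 < r → ∫⁻ y in Metric.ball z r, G y ≤ m * volume (Metric.ball z r)) →
    ∃ V W : E3 → ℝ≥0∞, Measurable V ∧
      (∀ y ∈ Metric.ball x₀ (6 * ρ), U y ≤ V y + W y) ∧
      ∫⁻ y, V y ≤ C * m * volume (Metric.ball x₀ ρ) ∧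
      ∀ y ∈ Metric.ball x₀ (6 * ρ), ∀ y' ∈ Metric.ball x₀ (6 * ρ), W y ≤ C * (U y' + V y' + m)

/-- Each point of a superlevel set of the maximal function has an almost largest admissible
radius. -/
theorem exists_stopping_radius {U : E3 → ℝ≥0∞} {l : ℝ≥0∞} (hl : l ≠ 0) (hU : ∫⁻ y, U y ≠ ⊤) :
    ∃ (R : ℝ) (r : E3 → ℝ), ∀ x ∈ superLevel U l, (0 < r x ∧ r x ≤ R) ∧
      l * volume (Metric.ball x (r x)) < ∫⁻ y in Metric.ball x (r x), U y ∧
      ∀ s, 2 * r x ≤ s → ∫⁻ y in Metric.ball x s, U y ≤ l * volume (Metric.ball x s) := by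
  obtain ⟨R, hR⟩ := exists_radius_bound hl hU
  have hx : ∀ x : E3, ∃ r : ℝ, x ∈ superLevel U l → (0 < r ∧ r ≤ R) ∧
      l * volume (Metric.ball x r) < ∫⁻ y in Metric.ball x r, U y ∧
      ∀ s, 2 * r ≤ s → ∫⁻ y in Metric.ball x s, U y ≤ l * volume (Metric.ball x s) := by
    intro x
    by_cases h : x ∈ superLevel U l
    swap
    · exact ⟨0, fun h' => absurd h' h⟩
    set S : Set ℝ := {r | 0 < r ∧ l * volume (Metric.ball x r) < ∫⁻ y in Metric.ball x r, U y}
      with hS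
    have hbd : ∀ r ∈ S, r ≤ R := fun r hr =>
      hR x r (hr.2.trans_le (setLIntegral_le_lintegral _ _))
    have hba : BddAbove S := ⟨R, fun r hr => hbd r hr⟩
    have hne : S.Nonempty := h
    obtain ⟨r₀, hr₀⟩ := id hne
    have hs0 : 0 < sSup S := hr₀.1.trans_le (le_csSup hba hr₀)
    obtain ⟨r, hr, hlt⟩ := exists_lt_of_lt_csSup hne (half_lt_self hs0)
    refine ⟨r, fun _ => ⟨⟨hr.1, hbd r hr⟩, hr.2, fun s hs => ?_⟩⟩
    by_contra! hcon
    have : s ≤ sSup S := le_csSup hba ⟨by linarith [hr.1], hcon⟩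
    linarith
  choose r hr using hx
  exact ⟨R, r, fun x hx => hr x hx⟩

/-- The good-`λ` inequality on one ball. If `U` has average at most `l` on all balls around `x₀` of
radius at least `2 ρ`, and the averages of `G` around one nearby point are at most `d l`, then the
maximal function of `U` exceeds a fixed multiple of `l` only on a small part of the ball. -/
theorem HasLocalSplitting.volume_superLevel_inter_ball_le {C : ℝ≥0∞} (hC : C ≠ ⊤)
    {U G : E3 → ℝ≥0∞} (hUm : Measurable U) (h : HasLocalSplitting C U G) {l d : ℝ≥0∞}
    (hl : l ≠ 0) (hl' : l ≠ ⊤) (hd : d ≤ 1) {x₀ z : E3} {ρ : ℝ} (hρ : 0 < ρ)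
    (hbig : ∀ s, 2 * ρ ≤ s → ∫⁻ y in Metric.ball x₀ s, U y ≤ l * volume (Metric.ball x₀ s))
    (hz : z ∈ Metric.ball x₀ (5 * ρ)) (hzG : z ∉ superLevel G (d * l)) :
    volume (Metric.ball x₀ (5 * ρ) ∩ superLevel U ((217 + C * (2 + C)) * l))
      ≤ d * (125 * C) * volume (Metric.ball x₀ ρ) := by
  have hzG' : ∀ r : ℝ, 0 < r →
      ∫⁻ y in Metric.ball z r, G y ≤ (d * l) * volume (Metric.ball z r) := by
    intro r hr
    by_contra! hcon
    exact hzG ⟨r, hr, hcon⟩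
  obtain ⟨V, W, hV, hUVW, hVint, hW⟩ := h x₀ z ρ (d * l) hρ hz hzG'
  set D := Metric.ball x₀ (6 * ρ) with hD
  have hDm : MeasurableSet D := Metric.isOpen_ball.measurableSet
  have hvD0 : volume D ≠ 0 := volume_ball_ne_zero _ (by linarith)
  have hdl : d * l ≤ l := mul_le_of_le_one_left zero_le hd
  have hballD : volume (Metric.ball x₀ ρ) ≤ volume D :=
    measure_mono (Metric.ball_subset_ball (by linarith))
  -- averaging the oscillation bound over `D`
  have hWb : ∀ y ∈ D, W y ≤ C * (2 + C) * l := by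
    intro y hy
    have h1 : W y * volume D ≤ ∫⁻ y' in D, C * (U y' + V y' + d * l) := by
      rw [← setLIntegral_const]
      exact setLIntegral_mono' hDm fun y' hy' => hW y hy y' hy'
    have h2 : ∫⁻ y' in D, C * (U y' + V y' + d * l) ≤ C * (2 + C) * l * volume D := by
      rw [lintegral_const_mul' _ _ hC,
        lintegral_add_left (f := fun y => U y + V y) (hUm.add hV), lintegral_add_left hUm,
        setLIntegral_const]
      have h3 : ∫⁻ y' in D, V y' ≤ C * l * volume D :=
        calc ∫⁻ y' in D, V y' ≤ ∫⁻ y', V y' := setLIntegral_le_lintegral _ _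
          _ ≤ C * (d * l) * volume (Metric.ball x₀ ρ) := hVint
          _ ≤ C * l * volume D := by gcongr
      calc C * ((∫⁻ y' in D, U y') + (∫⁻ y' in D, V y') + d * l * volume D)
          ≤ C * (l * volume D + C * l * volume D + l * volume D) := by
            gcongr
            exact hbig _ (by linarith)
        _ = C * (2 + C) * l * volume D := by ring
    exact (ENNReal.mul_le_mul_iff_left hvD0 (volume_ball_ne_top _ _)).1 (h1.trans h2)
  have hsub : Metric.ball x₀ (5 * ρ) ∩ superLevel U ((217 + C * (2 + C)) * l)
      ⊆ superLevel V l := by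
    rintro x ⟨hx, r, hr, hxr⟩
    rw [Metric.mem_ball] at hx
    refine ⟨r, hr, ?_⟩
    rcases le_or_gt ρ r with hρr | hρr
    -- a large ball is contained in a ball around `x₀` on which the average of `U` is at most `l`;
    -- this costs the factor `216 = 6 ^ 3`
    · exfalso
      have h1 : ∫⁻ y in Metric.ball x r, U y ≤ 216 * l * volume (Metric.ball x r) :=
        calc ∫⁻ y in Metric.ball x r, U y ≤ ∫⁻ y in Metric.ball x₀ (6 * r), U y :=
              lintegral_mono_set (Metric.ball_subset_ball' (by linarith))
          _ ≤ l * volume (Metric.ball x₀ (6 * r)) := hbig _ (by linarith)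
          _ = 216 * l * volume (Metric.ball x r) := by
              rw [volume_ball_mul x₀ x (by norm_num : (0 : ℝ) ≤ 6)]
              norm_num
              ring
      refine absurd (hxr.trans_le h1) (not_lt.2 ?_)
      gcongr
      calc (216 : ℝ≥0∞) ≤ 217 := by norm_num
        _ ≤ _ := le_self_add
    -- on a small ball, `W` is bounded, so that `V` has to have a large average
    · have hsubD : Metric.ball x r ⊆ D := Metric.ball_subset_ball' (by linarith)
      have h1 : ∫⁻ y in Metric.ball x r, U y
          ≤ (∫⁻ y in Metric.ball x r, V y) + C * (2 + C) * l * volume (Metric.ball x r) := by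
        rw [← setLIntegral_const, ← lintegral_add_left hV]
        refine setLIntegral_mono' Metric.isOpen_ball.measurableSet fun y hy => ?_
        exact (hUVW y (hsubD hy)).trans (by gcongr; exact hWb y (hsubD hy))
      have h2 := hxr.trans_le h1
      have h3 : (217 + C * (2 + C)) * l * volume (Metric.ball x r)
          = 217 * (l * volume (Metric.ball x r)) + C * (2 + C) * l * volume (Metric.ball x r) := by
        ring
      rw [h3] at h2
      refine lt_of_le_of_lt ?_ (lt_of_add_lt_add_right h2)
      exact le_mul_of_one_le_left zero_le (by norm_num)
  have hw := mul_volume_superLevel_le V l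
  refine (measure_mono hsub).trans ?_
  refine (ENNReal.mul_le_mul_iff_right hl hl').1 (hw.trans ?_)
  calc 125 * ∫⁻ y, V y ≤ 125 * (C * (d * l) * volume (Metric.ball x₀ ρ)) := by gcongr
    _ = _ := by ring

/-- The good-`λ` inequality: where the maximal function of `U` is large and that of `G` is small is
a small part of where the maximal function of `U` is moderately large. The set is covered by balls on
which the average of `U` exceeds `l`. -/
theorem HasLocalSplitting.good_lambda {C : ℝ≥0∞} (hC : C ≠ ⊤)
    {U G : E3 → ℝ≥0∞} (hUm : Measurable U) (hU : ∫⁻ y, U y ≠ ⊤) (h : HasLocalSplitting C U G)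
    {l d : ℝ≥0∞} (hl : l ≠ 0) (hl' : l ≠ ⊤) (hd : d ≤ 1) :
    volume (superLevel U ((217 + C * (2 + C)) * l))
      ≤ d * (125 * C) * volume (superLevel U (l / 8)) + volume (superLevel G (d * l)) := by
  obtain ⟨R, r, hr⟩ := exists_stopping_radius hl hU
  obtain ⟨u, hu, huc, hdis, hcov⟩ := exists_vitali_cover (superLevel U l) r fun x hx => (hr x hx).1
  set A := 217 + C * (2 + C) with hA
  set E := superLevel U (A * l) \ superLevel G (d * l) with hE
  have hEcov : E ⊆ ⋃ a ∈ u, Metric.ball a (5 * r a) ∩ E := by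
    intro x hx
    have h1 : (1 : ℝ≥0∞) ≤ A := by
      rw [hA]
      calc (1 : ℝ≥0∞) ≤ 217 := by norm_num
        _ ≤ _ := le_self_add
    have hx1 : x ∈ superLevel U l :=
      superLevel_anti U (le_mul_of_one_le_left zero_le h1) hx.1
    obtain ⟨a, ha, hxa⟩ := mem_iUnion₂.1 (hcov hx1)
    exact mem_iUnion₂.2 ⟨a, ha, hxa, hx⟩
  have hEle : volume E ≤ d * (125 * C) * volume (superLevel U (l / 8)) :=
    calc volume E ≤ ∑' a : u, volume (Metric.ball (a : E3) (5 * r a) ∩ E) :=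
          (measure_mono hEcov).trans (measure_biUnion_le _ huc _)
      _ ≤ ∑' a : u, d * (125 * C) * volume (Metric.ball (a : E3) (r a)) := by
          gcongr with a
          obtain ⟨⟨hr0, -⟩, -, hbig⟩ := hr a (hu a.2)
          rcases (Metric.ball (a : E3) (5 * r a) ∩ E).eq_empty_or_nonempty with he | ⟨z, hz⟩
          · rw [he]; simp
          · refine le_trans (measure_mono ?_)
              (h.volume_superLevel_inter_ball_le hC hUm hl hl' hd hr0 hbig hz.1 hz.2.2)
            exact inter_subset_inter_right _ sdiff_subset
      _ = d * (125 * C) * volume (⋃ a ∈ u, Metric.ball a (r a)) := by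
          rw [ENNReal.tsum_mul_left,
            measure_biUnion huc hdis fun _ _ => Metric.isOpen_ball.measurableSet]
      _ ≤ d * (125 * C) * volume (superLevel U (l / 8)) := by
          gcongr
          refine iUnion₂_subset fun a ha y hy => ?_
          obtain ⟨⟨hr0, -⟩, hlt, -⟩ := hr a (hu ha)
          refine ⟨2 * r a, by linarith, ?_⟩
          have h8 : l / 8 * volume (Metric.ball y (2 * r a)) = l * volume (Metric.ball a (r a)) := by
            rw [volume_ball_mul y a (by norm_num : (0 : ℝ) ≤ 2)]
            norm_num
            rw [← mul_assoc, ENNReal.div_mul_cancel (by norm_num) (by norm_num)]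
          rw [h8]
          refine hlt.trans_le (lintegral_mono_set (Metric.ball_subset_ball' ?_))
          rw [Metric.mem_ball, dist_comm] at hy
          linarith
  calc volume (superLevel U (A * l)) ≤ volume (E ∪ superLevel G (d * l)) :=
        measure_mono fun x hx => by
          by_cases hxG : x ∈ superLevel G (d * l)
          · exact Or.inr hxG
          · exact Or.inl ⟨hx, hxG⟩
    _ ≤ volume E + volume (superLevel G (d * l)) := measure_union_le _ _
    _ ≤ _ := by gcongr

theorem lintegral_Ioo_comp_mul {f : ℝ → ℝ≥0∞} (hf : Measurable f) {c q L : ℝ} (hc : 0 < c) :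
    ∫⁻ t in Ioo 0 (c * L), f t * ENNReal.ofReal (t ^ (q - 1))
      = ENNReal.ofReal (c ^ q) * ∫⁻ t in Ioo 0 L, f (c * t) * ENNReal.ofReal (t ^ (q - 1)) := by
  set F : ℝ → ℝ≥0∞ := (Ioo 0 (c * L)).indicator fun t => f t * ENNReal.ofReal (t ^ (q - 1)) with hF
  have hFm : Measurable F := by
    refine Measurable.indicator ?_ measurableSet_Ioo
    fun_prop
  have h1 : ∫⁻ t, F t = ENNReal.ofReal c * ∫⁻ t, F (c * t) := by
    conv_lhs => rw [← Real.smul_map_volume_mul_left hc.ne']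
    rw [lintegral_smul_measure, lintegral_map hFm (measurable_const_mul c), abs_of_pos hc]
    rfl
  rw [hF, lintegral_indicator measurableSet_Ioo] at h1
  rw [h1]
  have h2 : ∀ t, (Ioo 0 (c * L)).indicator (fun t => f t * ENNReal.ofReal (t ^ (q - 1))) (c * t)
      = ENNReal.ofReal (c ^ (q - 1)) *
        (Ioo 0 L).indicator (fun t => f (c * t) * ENNReal.ofReal (t ^ (q - 1))) t := by
    intro t
    have hmem : c * t ∈ Ioo 0 (c * L) ↔ t ∈ Ioo 0 L := by
      simp only [mem_Ioo, mul_pos_iff_of_pos_left hc, mul_lt_mul_iff_right₀ hc]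
    by_cases ht : t ∈ Ioo 0 L
    · rw [indicator_of_mem (hmem.2 ht), indicator_of_mem ht, Real.mul_rpow hc.le ht.1.le,
        ENNReal.ofReal_mul (by positivity)]
      ring
    · rw [indicator_of_notMem (mt hmem.1 ht), indicator_of_notMem ht, mul_zero]
  simp_rw [h2]
  rw [lintegral_const_mul' _ _ ENNReal.ofReal_ne_top, lintegral_indicator measurableSet_Ioo,
    ← mul_assoc, ← ENNReal.ofReal_mul hc.le]
  congr 2
  rw [Real.rpow_sub_one hc.ne']
  field_simp

/-- The good-`λ` inequality bounds `U` by `G` in `L^q`, for every `q > 1`. -/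
theorem exists_lintegral_rpow_le_of_splitting (C : ℝ≥0) {q : ℝ} (hq : 1 < q) :
    ∃ K : ℝ≥0∞, K ≠ ⊤ ∧ ∀ U G : E3 → ℝ, Continuous U → Continuous G → (∀ x, 0 ≤ U x) →
      (∀ x, 0 ≤ G x) → ∫⁻ x, ENNReal.ofReal (U x) ≠ ⊤ →
      HasLocalSplitting C (fun x => ENNReal.ofReal (U x)) (fun x => ENNReal.ofReal (G x)) →
      ∫⁻ x, ENNReal.ofReal (U x ^ q) ≤ K * ∫⁻ x, ENNReal.ofReal (G x ^ q) := by
  obtain ⟨M, hM, hmax⟩ := exists_maximal_strong_type hq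
  set a : ℝ := 217 + C * (2 + C) with ha
  have ha1 : 1 ≤ a := by
    have : (0 : ℝ) ≤ C * (2 + C) := by positivity
    linarith
  have ha0 : 0 < a := by linarith
  -- `d` is so small that the `U`-term on the right can be absorbed
  set w : ℝ := 2 * (a ^ q * 8 ^ q * (125 * C)) + 1 with hw
  have hw1 : 1 ≤ w := by
    have : (0 : ℝ) ≤ a ^ q * 8 ^ q * (125 * C) := by positivity
    linarith
  set d : ℝ := w⁻¹ with hd
  have hd0 : 0 < d := by positivity
  have hd1 : d ≤ 1 := inv_le_one_of_one_le₀ hw1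
  have hsmall : a ^ q * 8 ^ q * (d * (125 * C)) ≤ 1 / 2 := by
    rw [hd, ← div_eq_inv_mul, mul_div_assoc', div_le_iff₀ (by positivity), hw]
    linarith
  refine ⟨ENNReal.ofReal q * (2 * (ENNReal.ofReal (a ^ q) * (ENNReal.ofReal (d⁻¹ ^ q) * M))), ?_, ?_⟩
  · have := ENNReal.ofReal_ne_top (r := a ^ q)
    have := ENNReal.ofReal_ne_top (r := d⁻¹ ^ q)
    finiteness
  intro U G hUc hGc hU0 hG0 hUi hsplit
  set U' : E3 → ℝ≥0∞ := fun x => ENNReal.ofReal (U x) with hU'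
  set G' : E3 → ℝ≥0∞ := fun x => ENNReal.ofReal (G x) with hG'
  set e : ℝ → ℝ≥0∞ := fun t => volume (superLevel U' (ENNReal.ofReal t)) with he
  set k : ℝ → ℝ≥0∞ := fun t => volume (superLevel G' (ENNReal.ofReal t)) with hk
  have hem : Measurable e := Antitone.measurable fun s t hst =>
    measure_mono (superLevel_anti _ (ENNReal.ofReal_le_ofReal hst))
  have hkm : Measurable k := Antitone.measurable fun s t hst =>
    measure_mono (superLevel_anti _ (ENNReal.ofReal_le_ofReal hst))
  set Y := ∫⁻ t in Ioi (0 : ℝ), k t * ENNReal.ofReal (t ^ (q - 1)) with hY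
  set X : ℝ → ℝ≥0∞ := fun L => ∫⁻ t in Ioo 0 L, e t * ENNReal.ofReal (t ^ (q - 1)) with hX
  have hgl : ∀ t, 0 < t → e (a * t) ≤ ENNReal.ofReal (d * (125 * C)) * e (8⁻¹ * t) + k (d * t) := by
    intro t ht
    have h1 := hsplit.good_lambda ENNReal.coe_ne_top hUc.measurable.ennreal_ofReal hUi
      (l := ENNReal.ofReal t) (d := ENNReal.ofReal d) (by simpa using ht) ENNReal.ofReal_ne_top
      (by simpa using hd1)
    have hC : (C : ℝ≥0∞) = ENNReal.ofReal C := (ENNReal.ofReal_coe_nnreal).symm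
    have e1 : (217 + (C : ℝ≥0∞) * (2 + C)) * ENNReal.ofReal t = ENNReal.ofReal (a * t) := by
      rw [ENNReal.ofReal_mul ha0.le, ha, ENNReal.ofReal_add (by norm_num) (by positivity),
        ENNReal.ofReal_mul (by positivity), ENNReal.ofReal_add (by norm_num) (by positivity), ← hC]
      norm_num
    have e2 : ENNReal.ofReal d * (125 * (C : ℝ≥0∞)) = ENNReal.ofReal (d * (125 * C)) := by
      rw [ENNReal.ofReal_mul hd0.le, ENNReal.ofReal_mul (by norm_num), ← hC]
      norm_num
    have e3 : ENNReal.ofReal t / 8 = ENNReal.ofReal (8⁻¹ * t) := by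
      rw [ENNReal.ofReal_mul (by norm_num), ENNReal.ofReal_inv_of_pos (by norm_num)]
      norm_num [ENNReal.div_eq_inv_mul]
    rw [e1, e2, e3, ← ENNReal.ofReal_mul hd0.le] at h1
    exact h1
  -- absorbing needs a finite integral, hence the truncation at height `L`
  have hXfin : ∀ L, X L ≠ ⊤ := by
    intro L
    rcases le_or_gt L 0 with hL | hL
    · simp [hX, Ioo_eq_empty (not_lt.2 hL)]
    have hle : X L ≤ ∫⁻ t in Ioo 0 L, (125 * ∫⁻ y, U' y) * ENNReal.ofReal (t ^ (q - 2)) := by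
      refine setLIntegral_mono' measurableSet_Ioo fun t ht => ?_
      have h1 := mul_volume_superLevel_le U' (ENNReal.ofReal t)
      have h2 : ENNReal.ofReal (t ^ (q - 1))
          = ENNReal.ofReal t * ENNReal.ofReal (t ^ (q - 2)) := by
        rw [← ENNReal.ofReal_mul ht.1.le]
        congr 1
        rw [show q - 1 = 1 + (q - 2) by ring, Real.rpow_add ht.1, Real.rpow_one]
      calc e t * ENNReal.ofReal (t ^ (q - 1))
          = (ENNReal.ofReal t * e t) * ENNReal.ofReal (t ^ (q - 2)) := by rw [h2]; ring
        _ ≤ _ := by gcongr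
    refine ne_top_of_le_ne_top ?_ hle
    rw [lintegral_const_mul' _ _ (by finiteness)]
    refine ENNReal.mul_ne_top (by finiteness) ?_
    have hint : IntegrableOn (fun t : ℝ => t ^ (q - 2)) (Ioo 0 L) := by
      have := (intervalIntegral.intervalIntegrable_rpow' (a := 0) (b := L)
        (by linarith : -1 < q - 2))
      rw [intervalIntegrable_iff_integrableOn_Ioc_of_le hL.le] at this
      exact this.mono_set Ioo_subset_Ioc_self
    exact (Integrable.lintegral_lt_top hint).ne
  have hXmono : ∀ L L', L ≤ L' → X L ≤ X L' := fun L L' h =>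
    lintegral_mono_set (Ioo_subset_Ioo_right h)
  have hXle : ∀ L, 0 ≤ L → X L ≤ 2 * (ENNReal.ofReal (a ^ q) * (ENNReal.ofReal (d⁻¹ ^ q) * Y)) := by
    intro L hL
    -- the good-`λ` inequality, integrated against `t ^ (q - 1)` up to the height `L`
    have s1 : X (a * L) = ENNReal.ofReal (a ^ q)
        * ∫⁻ t in Ioo 0 L, e (a * t) * ENNReal.ofReal (t ^ (q - 1)) :=
      lintegral_Ioo_comp_mul hem ha0
    have s2 : X (8⁻¹ * L) = ENNReal.ofReal (8⁻¹ ^ q)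
        * ∫⁻ t in Ioo 0 L, e (8⁻¹ * t) * ENNReal.ofReal (t ^ (q - 1)) :=
      lintegral_Ioo_comp_mul hem (by norm_num)
    have s3 : ∫⁻ t in Ioo 0 (d * L), k t * ENNReal.ofReal (t ^ (q - 1)) = ENNReal.ofReal (d ^ q)
        * ∫⁻ t in Ioo 0 L, k (d * t) * ENNReal.ofReal (t ^ (q - 1)) :=
      lintegral_Ioo_comp_mul hkm hd0
    have s2' : ∫⁻ t in Ioo 0 L, e (8⁻¹ * t) * ENNReal.ofReal (t ^ (q - 1))
        ≤ ENNReal.ofReal (8 ^ q) * X L := by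
      have h1 : ENNReal.ofReal (8 ^ q) * ENNReal.ofReal (8⁻¹ ^ q) = 1 := by
        rw [← ENNReal.ofReal_mul (by positivity), ← Real.mul_rpow (by norm_num) (by norm_num)]
        norm_num
      calc _ = ENNReal.ofReal (8 ^ q) * X (8⁻¹ * L) := by rw [s2, ← mul_assoc, h1, one_mul]
        _ ≤ _ := by gcongr; exact hXmono _ _ (by linarith)
    have s3' : ∫⁻ t in Ioo 0 L, k (d * t) * ENNReal.ofReal (t ^ (q - 1))
        ≤ ENNReal.ofReal (d⁻¹ ^ q) * Y := by
      have h1 : ENNReal.ofReal (d⁻¹ ^ q) * ENNReal.ofReal (d ^ q) = 1 := by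
        rw [← ENNReal.ofReal_mul (by positivity), ← Real.mul_rpow (by positivity) hd0.le,
          inv_mul_cancel₀ hd0.ne']
        simp
      calc _ = ENNReal.ofReal (d⁻¹ ^ q)
            * ∫⁻ t in Ioo 0 (d * L), k t * ENNReal.ofReal (t ^ (q - 1)) := by
              rw [s3, ← mul_assoc, h1, one_mul]
        _ ≤ _ := by gcongr; exact lintegral_mono_set Ioo_subset_Ioi_self
    have s4 : ∫⁻ t in Ioo 0 L, e (a * t) * ENNReal.ofReal (t ^ (q - 1))
        ≤ ENNReal.ofReal (d * (125 * C)) * (ENNReal.ofReal (8 ^ q) * X L)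
          + ENNReal.ofReal (d⁻¹ ^ q) * Y := by
      calc _ ≤ ∫⁻ t in Ioo 0 L, (ENNReal.ofReal (d * (125 * C))
              * (e (8⁻¹ * t) * ENNReal.ofReal (t ^ (q - 1)))
              + k (d * t) * ENNReal.ofReal (t ^ (q - 1))) := by
            refine setLIntegral_mono' measurableSet_Ioo fun t ht => ?_
            rw [← mul_assoc, ← add_mul]
            gcongr
            exact hgl t ht.1
        _ = ENNReal.ofReal (d * (125 * C))
              * (∫⁻ t in Ioo 0 L, (e (8⁻¹ * t) * ENNReal.ofReal (t ^ (q - 1))))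
              + ∫⁻ t in Ioo 0 L, k (d * t) * ENNReal.ofReal (t ^ (q - 1)) := by
            rw [lintegral_add_left (by fun_prop), lintegral_const_mul' _ _ ENNReal.ofReal_ne_top]
        _ ≤ _ := by gcongr
    have hhalf : ENNReal.ofReal (a ^ q) * (ENNReal.ofReal (d * (125 * C)) *
        (ENNReal.ofReal (8 ^ q) * X L)) ≤ 2⁻¹ * X L := by
      calc _ = ENNReal.ofReal (a ^ q * 8 ^ q * (d * (125 * C))) * X L := by
            rw [ENNReal.ofReal_mul (p := a ^ q * 8 ^ q) (by positivity),
              ENNReal.ofReal_mul (p := a ^ q) (by positivity)]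
            ring
        _ ≤ ENNReal.ofReal (1 / 2) * X L := by gcongr
        _ = 2⁻¹ * X L := by
            rw [one_div, ENNReal.ofReal_inv_of_pos (by norm_num)]
            norm_num
    set Z := ENNReal.ofReal (a ^ q) * (ENNReal.ofReal (d⁻¹ ^ q) * Y) with hZ
    have hfinal : X L ≤ 2⁻¹ * X L + Z :=
      calc X L ≤ X (a * L) := hXmono _ _ (le_mul_of_one_le_left hL ha1)
        _ ≤ ENNReal.ofReal (a ^ q) * (ENNReal.ofReal (d * (125 * C)) * (ENNReal.ofReal (8 ^ q) * X L)
          + ENNReal.ofReal (d⁻¹ ^ q) * Y) := by rw [s1]; gcongr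
        _ ≤ _ := by rw [mul_add]; gcongr
    have hsum : X L = 2⁻¹ * X L + 2⁻¹ * X L := by
      rw [← add_mul, ENNReal.inv_two_add_inv_two, one_mul]
    have hcancel : 2⁻¹ * X L ≤ Z := by
      have hne : 2⁻¹ * X L ≠ ⊤ := ENNReal.mul_ne_top (by norm_num) (hXfin L)
      refine (ENNReal.add_le_add_iff_left hne).1 ?_
      rw [← hsum]
      exact hfinal
    rw [hsum, two_mul]
    gcongr
  have hXlim : ∫⁻ t in Ioi (0 : ℝ), e t * ENNReal.ofReal (t ^ (q - 1))
      ≤ 2 * (ENNReal.ofReal (a ^ q) * (ENNReal.ofReal (d⁻¹ ^ q) * Y)) := by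
    set ν := (volume : Measure ℝ).withDensity fun t => e t * ENNReal.ofReal (t ^ (q - 1)) with hν
    have hun : Ioi (0 : ℝ) = ⋃ n : ℕ, Ioo (0 : ℝ) n := by
      ext t
      simp only [mem_Ioi, mem_iUnion, mem_Ioo]
      exact ⟨fun h => (exists_nat_gt t).imp fun n hn => ⟨h, hn⟩, fun ⟨n, h, _⟩ => h⟩
    rw [← withDensity_apply _ measurableSet_Ioi, ← hν, hun, Monotone.measure_iUnion]
    · refine iSup_le fun n => ?_
      rw [hν, withDensity_apply _ measurableSet_Ioo]
      exact hXle n (by positivity)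
    · exact fun m n hmn => Ioo_subset_Ioo_right (by exact_mod_cast hmn)
  have hsubset : ∀ t ∈ Ioi (0 : ℝ), volume {x | t < U x} * ENNReal.ofReal (t ^ (q - 1))
      ≤ e t * ENNReal.ofReal (t ^ (q - 1)) := by
    intro t ht
    gcongr
    refine measure_mono fun x hx => ?_
    have hx : t < U x := hx
    obtain ⟨c, hc1, hc2⟩ := exists_between hx
    obtain ⟨r, hr, hball⟩ := Metric.isOpen_iff.1 (isOpen_lt continuous_const hUc) x
      (show c < U x from hc2)
    refine ⟨r, hr, ?_⟩
    calc ENNReal.ofReal t * volume (Metric.ball x r)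
        < ENNReal.ofReal c * volume (Metric.ball x r) := by
          refine (ENNReal.mul_lt_mul_iff_left (volume_ball_ne_zero x hr)
            (volume_ball_ne_top x r)).2 ?_
          exact (ENNReal.ofReal_lt_ofReal_iff (lt_trans ht hc1)).2 hc1
      _ ≤ _ := by
          rw [← setLIntegral_const]
          refine setLIntegral_mono' Metric.isOpen_ball.measurableSet fun y hy => ?_
          exact ENNReal.ofReal_le_ofReal (le_of_lt (hball hy))
  calc ∫⁻ x, ENNReal.ofReal (U x ^ q)
      = ENNReal.ofReal q * ∫⁻ t in Ioi (0 : ℝ), volume {x | t < U x} * ENNReal.ofReal (t ^ (q - 1)) :=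
        lintegral_rpow_eq_lintegral_meas_lt_mul _ (Filter.Eventually.of_forall hU0)
          hUc.aemeasurable (by linarith)
    _ ≤ ENNReal.ofReal q * ∫⁻ t in Ioi (0 : ℝ), e t * ENNReal.ofReal (t ^ (q - 1)) := by
        gcongr ENNReal.ofReal q * ?_
        exact setLIntegral_mono' measurableSet_Ioi hsubset
    _ ≤ ENNReal.ofReal q * (2 * (ENNReal.ofReal (a ^ q) * (ENNReal.ofReal (d⁻¹ ^ q)
          * (M * ∫⁻ x, ENNReal.ofReal (G x ^ q))))) := by
        gcongr ENNReal.ofReal q * ?_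
        refine hXlim.trans ?_
        gcongr
        exact hmax G hGc.measurable hG0
    _ = _ := by ring

/-! ### Singular integrals with dyadically self-similar kernels -/

/-- The `L¹`-normalized dilation of `ψ` to the scale `2⁻ⁿ`. -/
def dil {F : Type*} [AddCommMonoid F] [Module ℝ F] (n : ℕ) (ψ : E3 → F) (x : E3) : F :=
  (8 : ℝ) ^ n • ψ ((2 : ℝ) ^ n • x)

/-- The sum of the dilations of `ψ` to the scales `1, 1/2, …, 2^{1-N}`. -/
def dilSum {F : Type*} [AddCommMonoid F] [Module ℝ F] (N : ℕ) (ψ : E3 → F) (x : E3) : F :=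
  ∑ n ∈ Finset.range N, dil n ψ x

section Regularity

variable {F : Type*} [NormedAddCommGroup F] [NormedSpace ℝ F] {ψ : E3 → F}

theorem contDiff_dil (hψ : ContDiff ℝ ∞ ψ) (n : ℕ) : ContDiff ℝ ∞ (dil n ψ) := by
  unfold dil
  exact contDiff_const.smul (hψ.comp (contDiff_id.const_smul ((2 : ℝ) ^ n)))

theorem hasCompactSupport_dil (hψ : HasCompactSupport ψ) (n : ℕ) : HasCompactSupport (dil n ψ) := by
  unfold dil
  exact HasCompactSupport.smul_left (hψ.comp_smul (by positivity))

theorem contDiff_dilSum (hψ : ContDiff ℝ ∞ ψ) (N : ℕ) : ContDiff ℝ ∞ (dilSum N ψ) := by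
  unfold dilSum
  exact ContDiff.sum fun n _ => contDiff_dil hψ n

theorem hasCompactSupport_dilSum (hψ : HasCompactSupport ψ) (N : ℕ) :
    HasCompactSupport (dilSum N ψ) := by
  induction N with
  | zero =>
    have : dilSum 0 ψ = 0 := by ext x; simp [dilSum]
    rw [this]
    exact HasCompactSupport.zero
  | succ N ih =>
    have : dilSum (N + 1) ψ = dilSum N ψ + dil N ψ := by
      ext x; simp [dilSum, Finset.sum_range_succ]
    rw [this]
    exact ih.add (hasCompactSupport_dil hψ N)

end Regularity

/-- A smooth compactly supported real function, as a complex Schwartz function. -/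
def toComplexSchwartz (k : E3 → ℝ) (hk : ContDiff ℝ ∞ k) (hk' : HasCompactSupport k) :
    SchwartzMap E3 ℂ :=
  HasCompactSupport.toSchwartzMap (f := fun x => (k x : ℂ))
    (hk'.comp_left (g := fun t : ℝ => (t : ℂ)) Complex.ofReal_zero)
    (Complex.ofRealCLM.contDiff.comp hk)

theorem toComplexSchwartz_apply (k : E3 → ℝ) (hk : ContDiff ℝ ∞ k) (hk' : HasCompactSupport k)
    (x : E3) : toComplexSchwartz k hk hk' x = (k x : ℂ) := rfl

/-- Plancherel: convolution with `k` is bounded on `L²` by the supremum of the Fourier transform. -/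
theorem integral_sq_convolution_le {k g : E3 → ℝ} (hk : ContDiff ℝ ∞ k) (hk' : HasCompactSupport k)
    (hg : ContDiff ℝ ∞ g) (hg' : HasCompactSupport g) {B : ℝ}
    (hB : ∀ ξ, ‖𝓕 (toComplexSchwartz k hk hk') ξ‖ ≤ B) :
    ∫ x, (k ⋆[lsmul ℝ ℝ, volume] g) x ^ 2 ≤ B ^ 2 * ∫ x, g x ^ 2 := by
  set kC := toComplexSchwartz k hk hk'
  set gC := toComplexSchwartz g hg hg'
  set S := SchwartzMap.convolution (ContinuousLinearMap.mul ℂ ℂ) kC gC with hS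
  have hSx : ∀ x, S x = (((k ⋆[lsmul ℝ ℝ, volume] g) x : ℝ) : ℂ) := by
    intro x
    rw [hS, SchwartzMap.convolution_apply, convolution_def, convolution_def, ← integral_complex_ofReal]
    refine integral_congr_ae (Filter.Eventually.of_forall fun t => ?_)
    simp [kC, gC, toComplexSchwartz_apply]
  have h1 : ∫ x, (k ⋆[lsmul ℝ ℝ, volume] g) x ^ 2 = ∫ x, ‖S x‖ ^ 2 := by
    refine integral_congr_ae (Filter.Eventually.of_forall fun x => ?_)
    simp only [hSx, Complex.norm_real, Real.norm_eq_abs, sq_abs]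
  have h2 : ∫ x, g x ^ 2 = ∫ x, ‖gC x‖ ^ 2 := by
    refine integral_congr_ae (Filter.Eventually.of_forall fun x => ?_)
    simp only [gC, toComplexSchwartz_apply, Complex.norm_real, Real.norm_eq_abs, sq_abs]
  have hi : ∀ f : SchwartzMap E3 ℂ, Integrable fun x => ‖f x‖ ^ 2 := fun f =>
    (memLp_two_iff_integrable_sq_norm f.continuous.aestronglyMeasurable).1 (f.memLp 2)
  rw [h1, h2, ← SchwartzMap.integral_norm_sq_fourier, ← SchwartzMap.integral_norm_sq_fourier gC,
    ← integral_const_mul]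
  refine integral_mono (hi _) ((hi _).const_mul _) fun ξ => ?_
  rw [hS, SchwartzMap.fourier_convolution]
  simp only [SchwartzMap.pairing_apply_apply, ContinuousLinearMap.mul_apply', norm_mul, mul_pow]
  gcongr
  exact hB ξ

/-- A two-sided geometric series, bounded uniformly in the number of its terms. The bound depends on
`t` so that it goes through by induction. -/
theorem sum_min_pow_le (N : ℕ) (t : ℝ) (ht : 0 < t) :
    ∑ n ∈ Finset.range N, min ((2 ^ n)⁻¹ * t) ((2 ^ n)⁻¹ * t)⁻¹ ≤ if t ≤ 1 then 2 * t else 4 - 2 / t := by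
  induction N generalizing t with
  | zero =>
    simp only [Finset.range_zero, Finset.sum_empty]
    split_ifs with h
    · linarith
    · rw [not_le] at h
      have : 2 / t ≤ 2 := by rw [div_le_iff₀ ht]; linarith
      linarith
  | succ N ih =>
    rw [Finset.sum_range_succ']
    have h := ih (t / 2) (by positivity)
    have hs : ∑ n ∈ Finset.range N, min ((2 ^ (n + 1))⁻¹ * t) ((2 ^ (n + 1))⁻¹ * t)⁻¹
        = ∑ n ∈ Finset.range N, min ((2 ^ n)⁻¹ * (t / 2)) ((2 ^ n)⁻¹ * (t / 2))⁻¹ := by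
      refine Finset.sum_congr rfl fun n _ => ?_
      have : ((2 : ℝ) ^ (n + 1))⁻¹ * t = (2 ^ n)⁻¹ * (t / 2) := by
        rw [pow_succ]; field_simp
      rw [this]
    rw [hs]
    simp only [pow_zero, inv_one, one_mul]
    have h5 : 2 / t = 2 * t⁻¹ := div_eq_mul_inv 2 t
    have h4 : 0 < t⁻¹ := by positivity
    by_cases h1 : t ≤ 1
    · rw [if_pos h1]
      rw [if_pos (by linarith)] at h
      have := min_le_left t t⁻¹
      linarith
    · rw [if_neg h1]
      rw [not_le] at h1
      have := min_le_right t t⁻¹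
      by_cases h2 : t / 2 ≤ 1
      · rw [if_pos h2] at h
        have h3 : t + 3 * t⁻¹ ≤ 4 := by
          have : t + 3 * t⁻¹ = (t * t + 3) / t := by field_simp
          rw [this, div_le_iff₀ ht]
          nlinarith
        linarith
      · rw [if_neg h2] at h
        have h3 : 2 / (t / 2) = 4 * t⁻¹ := by field_simp; norm_num
        linarith

/-- The Fourier transform of a test function of mean zero vanishes at `0` and at infinity. -/
theorem exists_fourier_bound {ψ : E3 → ℝ} (hψ : ContDiff ℝ ∞ ψ) (hψ' : HasCompactSupport ψ)
    (h0 : ∫ x, ψ x = 0) :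
    ∃ D : ℝ, 0 ≤ D ∧ ∀ ξ : E3, ξ ≠ 0 →
      ‖𝓕 (toComplexSchwartz ψ hψ hψ') ξ‖ ≤ D * min ‖ξ‖ ‖ξ‖⁻¹ := by
  set f := 𝓕 (toComplexSchwartz ψ hψ hψ') with hf
  obtain ⟨C1, hC1, h1⟩ := f.decay 1 0
  obtain ⟨C2, hC2, h2⟩ := f.decay 0 1
  refine ⟨max C1 C2, by positivity, fun ξ hξ => ?_⟩
  have hf0 : f 0 = 0 := by
    rw [hf, SchwartzMap.fourier_coe, Real.fourier_eq]
    simp only [inner_zero_right, neg_zero, AddChar.map_zero_eq_one, one_smul,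
      toComplexSchwartz_apply]
    rw [integral_complex_ofReal, h0]
    simp
  have hξ' : 0 < ‖ξ‖ := norm_pos_iff.2 hξ
  have hA : ‖f ξ‖ ≤ C1 * ‖ξ‖⁻¹ := by
    have := h1 ξ
    rw [pow_one, norm_iteratedFDeriv_zero] at this
    rw [← div_eq_mul_inv, le_div_iff₀ hξ']
    linarith
  have hB : ‖f ξ‖ ≤ C2 * ‖ξ‖ := by
    have := Convex.norm_image_sub_le_of_norm_fderiv_le (𝕜 := ℝ) (f := f) (C := C2) (s := univ)
      (x := 0) (y := ξ) (fun x _ => f.differentiable.differentiableAt) (fun x _ => by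
        have := h2 x
        rwa [pow_zero, one_mul, norm_iteratedFDeriv_one] at this) convex_univ (mem_univ _)
        (mem_univ _)
    simpa [hf0] using this
  rcases min_cases ‖ξ‖ ‖ξ‖⁻¹ with ⟨h, _⟩ | ⟨h, _⟩
  · rw [h]; exact hB.trans (by gcongr; exact le_max_right _ _)
  · rw [h]; exact hA.trans (by gcongr; exact le_max_left _ _)

theorem fourier_dilSum {ψ : E3 → ℝ} (hψ : ContDiff ℝ ∞ ψ) (hψ' : HasCompactSupport ψ) (N : ℕ)
    (ξ : E3) :
    𝓕 (toComplexSchwartz (dilSum N ψ) (contDiff_dilSum hψ N) (hasCompactSupport_dilSum hψ' N)) ξ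
      = ∑ n ∈ Finset.range N, 𝓕 (toComplexSchwartz ψ hψ hψ') (((2 : ℝ) ^ n)⁻¹ • ξ) := by
  have hdil : ∀ n : ℕ, 𝓕 (toComplexSchwartz ψ hψ hψ') (((2 : ℝ) ^ n)⁻¹ • ξ)
      = 𝓕 (toComplexSchwartz (dil n ψ) (contDiff_dil hψ n) (hasCompactSupport_dil hψ' n)) ξ := by
    intro n
    rw [SchwartzMap.fourier_coe, SchwartzMap.fourier_coe, Real.fourier_eq, Real.fourier_eq]
    have hn : (0 : ℝ) < 2 ^ n := by positivity
    have h := Measure.integral_comp_smul_of_nonneg (volume : Measure E3)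
      (fun w => Real.fourierChar (-⟪w, ((2 : ℝ) ^ n)⁻¹ • ξ⟫) •
        ((8 : ℝ) ^ n • toComplexSchwartz ψ hψ hψ' w)) ((2 : ℝ) ^ n) (hR := hn.le)
    rw [finrank_euclideanSpace_fin] at h
    have h8 : (8 : ℝ) ^ n = ((2 : ℝ) ^ n) ^ 3 := by rw [← pow_mul, mul_comm, pow_mul]; norm_num
    have h2 : ∀ v : E3, ⟪(2 : ℝ) ^ n • v, ((2 : ℝ) ^ n)⁻¹ • ξ⟫ = ⟪v, ξ⟫ := by
      intro v
      rw [real_inner_smul_left, real_inner_smul_right]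
      field_simp
    simp_rw [h2] at h
    have h3 : ∀ w : E3, Real.fourierChar (-⟪w, ((2 : ℝ) ^ n)⁻¹ • ξ⟫) •
        ((8 : ℝ) ^ n • toComplexSchwartz ψ hψ hψ' w) = (8 : ℝ) ^ n •
        (Real.fourierChar (-⟪w, ((2 : ℝ) ^ n)⁻¹ • ξ⟫) • toComplexSchwartz ψ hψ hψ' w) := by
      intro w
      rw [smul_comm]
    simp_rw [h3] at h
    rw [integral_smul, ← h8, smul_smul, inv_mul_cancel₀ (by positivity), one_smul] at h
    rw [← h]
    refine integral_congr_ae (Filter.Eventually.of_forall fun v => ?_)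
    simp [toComplexSchwartz_apply, dil]
  simp_rw [hdil]
  have hsum : toComplexSchwartz (dilSum N ψ) (contDiff_dilSum hψ N) (hasCompactSupport_dilSum hψ' N)
      = ∑ n ∈ Finset.range N,
        toComplexSchwartz (dil n ψ) (contDiff_dil hψ n) (hasCompactSupport_dil hψ' n) := by
    ext x
    simp [toComplexSchwartz_apply, dilSum]
  rw [hsum]
  have := map_sum (SchwartzMap.fourierTransformCLM ℂ (V := E3) (E := ℂ)) (fun n => toComplexSchwartz
    (dil n ψ) (contDiff_dil hψ n) (hasCompactSupport_dil hψ' n)) (Finset.range N)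
  simp only [SchwartzMap.fourierTransformCLM_apply] at this
  rw [this]
  simp

/-- Uniform `L²` bound for singular integrals: at each frequency, the Fourier transforms of the
dilated kernels form two geometric series. -/
theorem exists_integral_sq_dilSum_le {ψ : E3 → ℝ} (hψ : ContDiff ℝ ∞ ψ) (hψ' : HasCompactSupport ψ)
    (h0 : ∫ x, ψ x = 0) :
    ∃ B : ℝ, 0 ≤ B ∧ ∀ (N : ℕ) (g : E3 → ℝ), ContDiff ℝ ∞ g → HasCompactSupport g →
      ∫ x, (dilSum N ψ ⋆[lsmul ℝ ℝ, volume] g) x ^ 2 ≤ B * ∫ x, g x ^ 2 := by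
  obtain ⟨D, hD, hbound⟩ := exists_fourier_bound hψ hψ' h0
  refine ⟨(4 * D) ^ 2, by positivity, fun N g hg hg' => ?_⟩
  have hne : ∀ ξ : E3, ξ ≠ 0 →
      ‖𝓕 (toComplexSchwartz (dilSum N ψ) (contDiff_dilSum hψ N) (hasCompactSupport_dilSum hψ' N)) ξ‖
        ≤ 4 * D := by
    intro ξ hξ
    rw [fourier_dilSum hψ hψ']
    have hξ' : 0 < ‖ξ‖ := norm_pos_iff.2 hξ
    have hs := sum_min_pow_le N ‖ξ‖ hξ'
    calc _ ≤ ∑ n ∈ Finset.range N, ‖𝓕 (toComplexSchwartz ψ hψ hψ') (((2 : ℝ) ^ n)⁻¹ • ξ)‖ :=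
          norm_sum_le _ _
      _ ≤ ∑ n ∈ Finset.range N, D * min ((2 ^ n)⁻¹ * ‖ξ‖) ((2 ^ n)⁻¹ * ‖ξ‖)⁻¹ := by
          refine Finset.sum_le_sum fun n _ => ?_
          have h := hbound (((2 : ℝ) ^ n)⁻¹ • ξ) (smul_ne_zero (by positivity) hξ)
          rwa [norm_smul, norm_inv, norm_pow, Real.norm_ofNat] at h
      _ = D * ∑ n ∈ Finset.range N, min ((2 ^ n)⁻¹ * ‖ξ‖) ((2 ^ n)⁻¹ * ‖ξ‖)⁻¹ := by
          rw [Finset.mul_sum]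
      _ ≤ D * 4 := by
          gcongr
          refine hs.trans ?_
          split_ifs with h
          · linarith
          · have : 0 < 2 / ‖ξ‖ := by positivity
            linarith
      _ = 4 * D := by ring
  refine integral_sq_convolution_le (contDiff_dilSum hψ N) (hasCompactSupport_dilSum hψ' N) hg hg' fun ξ => ?_
  -- at `ξ = 0` the bound follows by continuity
  have hcl : IsClosed {ξ : E3 | ‖𝓕 (toComplexSchwartz (dilSum N ψ) (contDiff_dilSum hψ N)
      (hasCompactSupport_dilSum hψ' N)) ξ‖ ≤ 4 * D} :=
    isClosed_le (SchwartzMap.continuous _).norm continuous_const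
  have hdense : Dense ({0}ᶜ : Set E3) := dense_compl_singleton 0
  exact hcl.closure_subset_iff.2 (fun ξ hξ => hne ξ hξ) (hdense ξ)

/-- A geometric series with ratio `2`, cut off where its terms exceed `R`, is bounded by `2 R`. The
sharper bound is the one that goes through by induction on the number of terms. -/
theorem sum_pow_mul_le (N : ℕ) {R : ℝ} {a : ℝ} (ha : 0 < a) :
    ∑ n ∈ Finset.range N, (if 2 ^ n * a ≤ R then 2 ^ n * a else 0)
      ≤ if a ≤ R then 2 * R - a else 0 := by
  induction N generalizing a with
  | zero =>
    simp only [Finset.range_zero, Finset.sum_empty]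
    split_ifs with h <;> linarith
  | succ N ih =>
    rw [Finset.sum_range_succ']
    have h := ih (a := 2 * a) (by positivity)
    have hs : ∑ n ∈ Finset.range N, (if 2 ^ (n + 1) * a ≤ R then 2 ^ (n + 1) * a else 0)
        = ∑ n ∈ Finset.range N, (if 2 ^ n * (2 * a) ≤ R then 2 ^ n * (2 * a) else 0) := by
      refine Finset.sum_congr rfl fun n _ => ?_
      have : (2 : ℝ) ^ (n + 1) * a = 2 ^ n * (2 * a) := by ring
      rw [this]
    rw [hs]
    simp only [pow_zero, one_mul]
    by_cases h1 : a ≤ R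
    · rw [if_pos h1, if_pos h1]
      by_cases h2 : 2 * a ≤ R
      · rw [if_pos h2] at h; linarith
      · rw [if_neg h2] at h; linarith
    · rw [if_neg h1, if_neg h1]
      rw [if_neg (by linarith)] at h
      linarith

/-- The Cauchy–Schwarz inequality for averages. -/
theorem setIntegral_abs_le_sqrt_mul {g : E3 → ℝ} (hg : Continuous g) (hg' : HasCompactSupport g)
    {s : Set E3} (hs : volume s ≠ ⊤) {m : ℝ} (hm : 0 ≤ m)
    (h : ∫ y in s, g y ^ 2 ≤ m * volume.real s) :
    ∫ y in s, |g y| ≤ √m * volume.real s := by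
  have hi1 : IntegrableOn (fun y => |g y|) s :=
    (hg.integrable_of_hasCompactSupport hg').abs.integrableOn
  have hi2 : IntegrableOn (fun y => g y ^ 2) s := by
    refine Integrable.integrableOn (Continuous.integrable_of_hasCompactSupport (by fun_prop) ?_)
    exact hg'.comp_left (g := fun t : ℝ => t ^ 2) (by simp)
  have key : ∀ c : ℝ, 0 < c → ∫ y in s, |g y| ≤ (m * volume.real s / c + c * volume.real s) / 2 := by
    intro c hc
    have hi3 : IntegrableOn (fun _ : E3 => c) s := integrableOn_const hs
    calc ∫ y in s, |g y| ≤ ∫ y in s, (g y ^ 2 / c + c) / 2 := by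
          refine setIntegral_mono hi1 (((hi2.div_const c).add hi3).div_const 2) fun y => ?_
          have h1 : g y ^ 2 / c + c - 2 * |g y| = (|g y| - c) ^ 2 / c := by
            rw [← sq_abs]; field_simp; ring
          have h2 : 0 ≤ (|g y| - c) ^ 2 / c := by positivity
          simp only
          linarith
      _ = ((∫ y in s, g y ^ 2) / c + c * volume.real s) / 2 := by
          rw [integral_div, integral_add (hi2.div_const c) hi3, integral_div, setIntegral_const,
            smul_eq_mul, mul_comm c]
      _ ≤ _ := by gcongr
  rcases hm.eq_or_lt with h0 | h0
  · rw [← h0] at key ⊢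
    rw [Real.sqrt_zero, zero_mul]
    refine le_of_forall_pos_le_add fun ε hε => ?_
    have hv : 0 ≤ volume.real s := measureReal_nonneg
    have h1 := key (ε / (volume.real s + 1)) (by positivity)
    rw [zero_mul, zero_div, zero_add] at h1
    have h2 : ε / (volume.real s + 1) * volume.real s ≤ ε := by
      rw [div_mul_eq_mul_div, div_le_iff₀ (by positivity)]
      nlinarith
    linarith
  · have h1 := key (√m) (Real.sqrt_pos.2 h0)
    have h2 : m * volume.real s / √m = √m * volume.real s := by
      have := Real.mul_self_sqrt hm
      have h3 := (Real.sqrt_pos.2 h0).ne'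
      field_simp
      linear_combination (-volume.real s) * this
    rw [h2] at h1
    linarith

section Oscillation

variable {ψ : E3 → ℝ} {K : ℝ≥0} {R : ℝ}

/-- If `g` vanishes near `x₀`, then at the scale `2⁻ⁿ` the kernel meets the support of `g` only if
`2ⁿ ρ ≤ R`; in that case the Lipschitz bound of the kernel is used on a ball around `z`. -/
theorem dil_sub_dil_mul_le (hL : LipschitzWith K ψ) (hR : ∀ x, R < ‖x‖ → ψ x = 0)
    {g : E3 → ℝ} {x₀ z x x' : E3} {ρ : ℝ} (hz : z ∈ Metric.ball x₀ (5 * ρ))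
    (hx : x ∈ Metric.ball x₀ (6 * ρ)) (hx' : x' ∈ Metric.ball x₀ (6 * ρ))
    (hgz : ∀ y ∈ Metric.ball x₀ (12 * ρ), g y = 0) (n : ℕ) (t : E3) :
    |(dil n ψ (x - t) - dil n ψ (x' - t)) * g t| ≤
      if 2 ^ n * ρ ≤ R then
        (16 ^ n * K * (12 * ρ)) * (Metric.ball z (4 * R / 2 ^ n)).indicator (fun t => |g t|) t
      else 0 := by
  have hn : (0 : ℝ) < 2 ^ n := by positivity
  rw [Metric.mem_ball] at hz hx hx'
  have hρ : 0 < ρ := by linarith [dist_nonneg (x := z) (y := x₀)]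
  have hrhs : 0 ≤ if 2 ^ n * ρ ≤ R then
      (16 ^ n * K * (12 * ρ)) * (Metric.ball z (4 * R / 2 ^ n)).indicator (fun t => |g t|) t
      else 0 := by
    split_ifs
    · exact mul_nonneg (by positivity) (indicator_nonneg (fun _ _ => abs_nonneg _) _)
    · exact le_rfl
  by_cases ht : t ∈ Metric.ball x₀ (12 * ρ)
  · rw [hgz t ht, mul_zero, abs_zero]; exact hrhs
  rw [Metric.mem_ball, not_lt] at ht
  have hzero : ∀ w, dist w x₀ < 6 * ρ → dil n ψ (w - t) ≠ 0 →
      2 ^ n * ρ ≤ R ∧ t ∈ Metric.ball z (4 * R / 2 ^ n) := by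
    intro w hw hne
    have h1 : ‖(2 : ℝ) ^ n • (w - t)‖ ≤ R := by
      by_contra! hcon
      exact hne (by rw [dil, hR _ hcon, smul_zero])
    rw [norm_smul, norm_pow, Real.norm_ofNat, ← dist_eq_norm] at h1
    have h2 : 6 * ρ < dist w t := by
      have := dist_triangle t w x₀
      rw [dist_comm t w] at this
      linarith
    refine ⟨?_, ?_⟩
    · nlinarith
    · rw [Metric.mem_ball, lt_div_iff₀ hn]
      have h3 : dist t z < 4 * dist w t := by
        have e1 := dist_triangle t w z
        have e2 := dist_triangle w x₀ z
        rw [dist_comm t w] at e1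
        rw [dist_comm x₀ z] at e2
        linarith
      nlinarith
  by_cases hcase : dil n ψ (x - t) ≠ 0 ∨ dil n ψ (x' - t) ≠ 0
  · obtain ⟨hle, hmem⟩ : 2 ^ n * ρ ≤ R ∧ t ∈ Metric.ball z (4 * R / 2 ^ n) := by
      rcases hcase with h | h
      · exact hzero x hx h
      · exact hzero x' hx' h
    rw [if_pos hle, indicator_of_mem hmem, abs_mul]
    gcongr
    have h1 := hL.dist_le_mul ((2 : ℝ) ^ n • (x - t)) ((2 : ℝ) ^ n • (x' - t))
    rw [dist_eq_norm (_ • _), ← smul_sub, norm_smul, norm_pow, Real.norm_ofNat, sub_sub_sub_cancel_right,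
      ← dist_eq_norm, Real.dist_eq] at h1
    have h2 : dist x x' ≤ 12 * ρ := by
      have := dist_triangle_right x x' x₀
      linarith
    have h3 : |dil n ψ (x - t) - dil n ψ (x' - t)|
        = 8 ^ n * |ψ ((2 : ℝ) ^ n • (x - t)) - ψ ((2 : ℝ) ^ n • (x' - t))| := by
      rw [dil, dil, smul_eq_mul, smul_eq_mul, ← mul_sub, abs_mul, abs_of_pos (by positivity)]
    have h16 : (16 : ℝ) ^ n = 8 ^ n * 2 ^ n := by rw [← mul_pow]; norm_num
    rw [h3, h16]
    calc (8 : ℝ) ^ n * |ψ ((2 : ℝ) ^ n • (x - t)) - ψ ((2 : ℝ) ^ n • (x' - t))|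
        ≤ 8 ^ n * (K * (2 ^ n * (12 * ρ))) := by
          gcongr
          exact h1.trans (by gcongr)
      _ = _ := by ring
  · push Not at hcase
    rw [hcase.1, hcase.2, sub_zero, zero_mul, abs_zero]
    exact hrhs

/-- The oscillation of a singular integral on a ball away from the support of `g` is controlled
by the quadratic averages of `g` around a nearby point `z`. -/
theorem abs_convolution_dilSum_sub_le (hψ : ContDiff ℝ ∞ ψ) (hL : LipschitzWith K ψ) (hR0 : 0 < R)
    (hR : ∀ x, R < ‖x‖ → ψ x = 0) {g : E3 → ℝ} (hg : Continuous g) (hg' : HasCompactSupport g)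
    {x₀ z x x' : E3} {ρ m : ℝ} (hm : 0 ≤ m) (hz : z ∈ Metric.ball x₀ (5 * ρ))
    (hx : x ∈ Metric.ball x₀ (6 * ρ)) (hx' : x' ∈ Metric.ball x₀ (6 * ρ))
    (hgz : ∀ y ∈ Metric.ball x₀ (12 * ρ), g y = 0)
    (hgm : ∀ r, 0 < r → ∫ y in Metric.ball z r, g y ^ 2 ≤ m * volume.real (Metric.ball z r))
    (N : ℕ) :
    |(dilSum N ψ ⋆[lsmul ℝ ℝ, volume] g) x - (dilSum N ψ ⋆[lsmul ℝ ℝ, volume] g) x'|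
      ≤ 768 * K * R ^ 3 * volume.real (Metric.ball (0 : E3) 1) * (2 * R) * √m := by
  set v := volume.real (Metric.ball (0 : E3) 1) with hv
  have hρ : 0 < ρ := by
    rw [Metric.mem_ball] at hz
    linarith [dist_nonneg (x := z) (y := x₀)]
  have hgi : Integrable g := hg.integrable_of_hasCompactSupport hg'
  have hint : ∀ (n : ℕ) (w : E3), Integrable fun t => dil n ψ (w - t) * g t := by
    intro n w
    refine Continuous.integrable_of_hasCompactSupport ?_ hg'.mul_left
    have := (contDiff_dil hψ n).continuous
    fun_prop
  have hterm : ∀ n : ℕ, |∫ t, (dil n ψ (x - t) - dil n ψ (x' - t)) * g t|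
      ≤ 768 * K * R ^ 3 * v * √m * (if 2 ^ n * ρ ≤ R then 2 ^ n * ρ else 0) := by
    intro n
    have hn : (0 : ℝ) < 2 ^ n := by positivity
    have hr : 0 < 4 * R / 2 ^ n := by positivity
    have hpt := dil_sub_dil_mul_le hL hR hz hx hx' hgz n
    by_cases hle : 2 ^ n * ρ ≤ R
    · simp only [if_pos hle] at hpt ⊢
      have hvol : volume.real (Metric.ball z (4 * R / 2 ^ n)) = (4 * R / 2 ^ n) ^ 3 * v := by
        have := volume_ball_mul z 0 (c := 4 * R / 2 ^ n) (r := 1) hr.le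
        rw [mul_one] at this
        rw [Measure.real, this, ENNReal.toReal_mul, ENNReal.toReal_ofReal (by positivity), hv,
          Measure.real]
      calc |∫ t, (dil n ψ (x - t) - dil n ψ (x' - t)) * g t|
          ≤ ∫ t, (16 ^ n * K * (12 * ρ)) *
              (Metric.ball z (4 * R / 2 ^ n)).indicator (fun t => |g t|) t := by
            rw [← Real.norm_eq_abs]
            exact norm_integral_le_of_norm_le ((hgi.abs.indicator measurableSet_ball).const_mul _)
              (Filter.Eventually.of_forall fun t => hpt t)
        _ = (16 ^ n * K * (12 * ρ)) * ∫ t in Metric.ball z (4 * R / 2 ^ n), |g t| := by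
            rw [integral_const_mul, integral_indicator measurableSet_ball]
        _ ≤ (16 ^ n * K * (12 * ρ)) * (√m * ((4 * R / 2 ^ n) ^ 3 * v)) := by
            gcongr
            rw [← hvol]
            exact setIntegral_abs_le_sqrt_mul hg hg' (volume_ball_ne_top _ _) hm (hgm _ hr)
        _ = 768 * K * R ^ 3 * v * √m * (2 ^ n * ρ) := by
            have h16 : (16 : ℝ) ^ n = (2 ^ n) ^ 4 := by rw [← pow_mul, mul_comm, pow_mul]; norm_num
            rw [h16]
            field_simp
            ring
    · simp only [if_neg hle] at hpt ⊢
      have : ∀ t, (dil n ψ (x - t) - dil n ψ (x' - t)) * g t = 0 := fun t =>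
        abs_eq_zero.1 (le_antisymm (hpt t) (abs_nonneg _))
      simp [this]
  have hconv : ∀ w, (dilSum N ψ ⋆[lsmul ℝ ℝ, volume] g) w
      = ∑ n ∈ Finset.range N, ∫ t, dil n ψ (w - t) * g t := by
    intro w
    rw [convolution_lsmul_swap, ← integral_finsetSum _ fun n _ => hint n w]
    refine integral_congr_ae (Filter.Eventually.of_forall fun t => ?_)
    simp [dilSum, Finset.sum_mul]
  rw [hconv, hconv, ← Finset.sum_sub_distrib]
  calc |∑ n ∈ Finset.range N, ((∫ t, dil n ψ (x - t) * g t) - ∫ t, dil n ψ (x' - t) * g t)|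
      ≤ ∑ n ∈ Finset.range N, |∫ t, (dil n ψ (x - t) - dil n ψ (x' - t)) * g t| := by
        refine (Finset.abs_sum_le_sum_abs _ _).trans (Finset.sum_le_sum fun n _ => ?_)
        rw [← integral_sub (hint n x) (hint n x')]
        simp only [sub_mul, le_refl]
    _ ≤ ∑ n ∈ Finset.range N,
          768 * K * R ^ 3 * v * √m * (if 2 ^ n * ρ ≤ R then 2 ^ n * ρ else 0) :=
        Finset.sum_le_sum fun n _ => hterm n
    _ = 768 * K * R ^ 3 * v * √m * ∑ n ∈ Finset.range N,
          (if 2 ^ n * ρ ≤ R then 2 ^ n * ρ else 0) := by rw [Finset.mul_sum]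
    _ ≤ 768 * K * R ^ 3 * v * √m * (2 * R) := by
        gcongr
        refine (sum_pow_mul_le N hρ).trans ?_
        split_ifs <;> linarith
    _ = _ := by ring

end Oscillation

/-- For a singular integral, `g` is cut into a part near `x₀`, whose image is estimated in `L²`, and
a part away from `x₀`, whose image has bounded oscillation near `x₀`. -/
theorem exists_hasLocalSplitting {ψ : E3 → ℝ} (hψ : ContDiff ℝ ∞ ψ) (hψ' : HasCompactSupport ψ)
    (h0 : ∫ x, ψ x = 0) :
    ∃ C : ℝ≥0, ∀ (N : ℕ) (g : E3 → ℝ), ContDiff ℝ ∞ g → HasCompactSupport g →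
      HasLocalSplitting C
        (fun x => ENNReal.ofReal ((dilSum N ψ ⋆[lsmul ℝ ℝ, volume] g) x ^ 2))
        (fun x => ENNReal.ofReal (g x ^ 2)) := by
  obtain ⟨B, hB0, hB⟩ := exists_integral_sq_dilSum_le hψ hψ' h0
  obtain ⟨K, hK⟩ := ContDiff.lipschitzWith_of_hasCompactSupport hψ' hψ (by simp)
  obtain ⟨R, hR0, hR⟩ : ∃ R : ℝ, 0 < R ∧ ∀ x, R < ‖x‖ → ψ x = 0 := by
    obtain ⟨R, hR⟩ := hψ'.isCompact.isBounded.subset_closedBall 0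
    refine ⟨max R 1, by positivity, fun x hx => image_eq_zero_of_notMem_tsupport fun hmem => ?_⟩
    have := hR hmem
    rw [mem_closedBall_zero_iff] at this
    exact absurd hx (not_lt.2 (this.trans (le_max_left _ _)))
  set C₁ := 768 * K * R ^ 3 * volume.real (Metric.ball (0 : E3) 1) * (2 * R) with hC₁
  have hC₁0 : 0 ≤ C₁ := by positivity
  set C : ℝ := 2 * B * 24389 + 8 + 4 * C₁ ^ 2 with hC
  have hC0 : 0 ≤ C := by positivity
  refine ⟨C.toNNReal, fun N g hg hg' x₀ z ρ m hρ hz hm => ?_⟩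
  change ∃ V W : E3 → ℝ≥0∞, Measurable V ∧ _ ∧ _ ≤ ENNReal.ofReal C * m * _ ∧
    ∀ y ∈ _, ∀ y' ∈ _, W y ≤ ENNReal.ofReal C * _
  have hCpos : 0 < C := by positivity
  set T : (E3 → ℝ) → E3 → ℝ := fun g => dilSum N ψ ⋆[lsmul ℝ ℝ, volume] g with hT
  have hTc : ∀ g : E3 → ℝ, ContDiff ℝ ∞ g → HasCompactSupport g → Continuous (T g) := by
    intro g hg hg'
    exact hg'.continuous_convolution_right _
      ((contDiff_dilSum hψ N).continuous.locallyIntegrable) hg.continuous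
  -- for `m = ⊤` there is nothing to estimate
  rcases eq_or_ne m ⊤ with rfl | hmtop
  · refine ⟨fun x => ENNReal.ofReal (T g x ^ 2), 0, ?_, fun y _ => le_self_add, ?_, ?_⟩
    · have := hTc g hg hg'
      fun_prop
    · rw [ENNReal.mul_top (by simpa using hCpos), ENNReal.top_mul (volume_ball_ne_zero _ hρ)]
      exact le_top
    · intro y _ y' _
      simp
  set M := m.toReal with hM
  have hmM : m = ENNReal.ofReal M := (ENNReal.ofReal_toReal hmtop).symm
  have hM0 : 0 ≤ M := ENNReal.toReal_nonneg
  have hsqint : ∀ f : E3 → ℝ, ContDiff ℝ ∞ f → HasCompactSupport f → Integrable fun y => f y ^ 2 := by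
    intro f hf hf'
    have := hf.continuous
    exact Continuous.integrable_of_hasCompactSupport (by fun_prop)
      (hf'.comp_left (g := fun t : ℝ => t ^ 2) (by simp))
  have havg : ∀ r, 0 < r → ∫ y in Metric.ball z r, g y ^ 2 ≤ M * volume.real (Metric.ball z r) := by
    intro r hr
    have h1 := hm r hr
    rw [← ofReal_integral_eq_lintegral_ofReal (hsqint g hg hg').integrableOn
      (Filter.Eventually.of_forall fun y => sq_nonneg _)] at h1
    have h2 := (ENNReal.ofReal_le_iff_le_toReal
      (ENNReal.mul_ne_top hmtop (volume_ball_ne_top _ _))).1 h1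
    rwa [ENNReal.toReal_mul] at h2
  let χ : ContDiffBump x₀ := ⟨12 * ρ, 24 * ρ, by positivity, by linarith⟩
  set g₁ : E3 → ℝ := fun x => χ x * g x with hg₁
  set g₂ : E3 → ℝ := fun x => (1 - χ x) * g x with hg₂
  have hg₁s : ContDiff ℝ ∞ g₁ := χ.contDiff.mul hg
  have hg₂s : ContDiff ℝ ∞ g₂ := (contDiff_const.sub χ.contDiff).mul hg
  have hg₁c : HasCompactSupport g₁ := hg'.mul_left
  have hg₂c : HasCompactSupport g₂ := hg'.mul_left
  have hTadd : ∀ x, T g x = T g₁ x + T g₂ x := by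
    intro x
    have hex : ∀ f : E3 → ℝ, ContDiff ℝ ∞ f → HasCompactSupport f →
        ConvolutionExists (dilSum N ψ) f (lsmul ℝ ℝ) volume := fun f hf hf' =>
      hf'.convolutionExists_right _ ((contDiff_dilSum hψ N).continuous.locallyIntegrable)
        hf.continuous
    have hgg : g = g₁ + g₂ := by ext y; simp [hg₁, hg₂]; ring
    have h1 := (hex g₁ hg₁s hg₁c).distrib_add (hex g₂ hg₂s hg₂c)
    rw [← hgg] at h1
    exact congrFun h1 x
  have hosc : ∀ y ∈ Metric.ball x₀ (6 * ρ), ∀ y' ∈ Metric.ball x₀ (6 * ρ),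
      |T g₂ y - T g₂ y'| ≤ C₁ * √M := by
    intro y hy y' hy'
    refine abs_convolution_dilSum_sub_le hψ hK hR0 hR hg₂s.continuous hg₂c hM0 hz hy hy' ?_ ?_ N
    · intro w hw
      have : χ w = 1 := χ.one_of_mem_closedBall (Metric.ball_subset_closedBall hw)
      simp [hg₂, this]
    · intro r hr
      refine le_trans ?_ (havg r hr)
      refine setIntegral_mono (hsqint g₂ hg₂s hg₂c).integrableOn (hsqint g hg hg').integrableOn
        fun w => ?_
      simp only [hg₂, mul_pow]
      have h1 := χ.nonneg (x := w)
      have h2 := χ.le_one (x := w)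
      have : (1 - χ w) ^ 2 ≤ 1 := by nlinarith
      exact mul_le_of_le_one_left (sq_nonneg _) this
  refine ⟨fun x => ENNReal.ofReal (2 * T g₁ x ^ 2), fun x => ENNReal.ofReal (2 * T g₂ x ^ 2),
    ?_, ?_, ?_, ?_⟩
  · have := hTc g₁ hg₁s hg₁c
    fun_prop
  · intro y _
    rw [← ENNReal.ofReal_add (by positivity) (by positivity)]
    refine ENNReal.ofReal_le_ofReal ?_
    change T g y ^ 2 ≤ _
    rw [hTadd y]
    nlinarith [sq_nonneg (T g₁ y - T g₂ y)]
  · have hi : Integrable fun y => T g₁ y ^ 2 := by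
      have hcs : HasCompactSupport (T g₁) :=
        HasCompactSupport.convolution _ (hasCompactSupport_dilSum hψ' N) hg₁c
      have := hTc g₁ hg₁s hg₁c
      exact Continuous.integrable_of_hasCompactSupport (by fun_prop)
        (hcs.comp_left (g := fun t : ℝ => t ^ 2) (by simp))
    rw [← ofReal_integral_eq_lintegral_ofReal (hi.const_mul 2)
      (Filter.Eventually.of_forall fun y => by positivity)]
    -- `g₁` lives on the ball of radius `24 ρ` around `x₀`, and `z` is at distance at most `5 ρ`;
    -- below, `24389 = 29 ^ 3`
    have hg₁le : ∫ y, g₁ y ^ 2 ≤ M * volume.real (Metric.ball z (29 * ρ)) := by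
      refine le_trans ?_ (havg (29 * ρ) (by positivity))
      rw [← integral_indicator measurableSet_ball]
      refine integral_mono (hsqint g₁ hg₁s hg₁c)
        ((hsqint g hg hg').indicator measurableSet_ball) fun w => ?_
      by_cases hw : w ∈ Metric.ball z (29 * ρ)
      · simp only [indicator_of_mem hw, hg₁, mul_pow]
        have h1 := χ.nonneg (x := w)
        have h2 := χ.le_one (x := w)
        have : χ w ^ 2 ≤ 1 := by nlinarith
        exact mul_le_of_le_one_left (sq_nonneg _) this
      · simp only [indicator_of_notMem hw, hg₁]
        have : χ w = 0 := by
          refine χ.zero_of_le_dist ?_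
          rw [Metric.mem_ball, not_lt] at hw
          rw [Metric.mem_ball, dist_comm] at hz
          have := dist_triangle w x₀ z
          change 24 * ρ ≤ _
          linarith
        simp [this]
    have hvol : volume (Metric.ball z (29 * ρ)) = ENNReal.ofReal 24389 * volume (Metric.ball x₀ ρ) := by
      rw [volume_ball_mul z x₀ (by norm_num : (0 : ℝ) ≤ 29)]
      norm_num
    have h1 : ∫ y, 2 * T g₁ y ^ 2 ≤ 2 * B * (M * volume.real (Metric.ball z (29 * ρ))) := by
      rw [integral_const_mul, mul_assoc]
      gcongr
      exact (hB N g₁ hg₁s hg₁c).trans (by gcongr)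
    calc ENNReal.ofReal (∫ y, 2 * T g₁ y ^ 2)
        ≤ ENNReal.ofReal (2 * B * (M * volume.real (Metric.ball z (29 * ρ)))) :=
          ENNReal.ofReal_le_ofReal h1
      _ = ENNReal.ofReal (2 * B * 24389) * m * volume (Metric.ball x₀ ρ) := by
          rw [ENNReal.ofReal_mul (by positivity), ENNReal.ofReal_mul hM0, ← hmM, Measure.real,
            ENNReal.ofReal_toReal (volume_ball_ne_top _ _), hvol,
            ENNReal.ofReal_mul (p := 2 * B) (by positivity)]
          ring
      _ ≤ _ := by
          gcongr
          rw [hC]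
          have : 0 ≤ 4 * C₁ ^ 2 := by positivity
          linarith
  · intro y hy y' hy'
    rw [hmM, ← ENNReal.ofReal_add (by positivity) (by positivity),
      ← ENNReal.ofReal_add (by positivity) hM0, ← ENNReal.ofReal_mul hC0]
    refine ENNReal.ofReal_le_ofReal ?_
    change _ ≤ C * (T g y' ^ 2 + 2 * T g₁ y' ^ 2 + M)
    have h1 := hosc y hy y' hy'
    have h2 : (T g₂ y - T g₂ y') ^ 2 ≤ C₁ ^ 2 * M := by
      have := pow_le_pow_left₀ (abs_nonneg _) h1 2
      rwa [sq_abs, mul_pow, Real.sq_sqrt hM0] at this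
    have h3 : T g₂ y' = T g y' - T g₁ y' := by rw [hTadd]; ring
    have h4 : 2 * T g₂ y ^ 2 ≤ 8 * T g y' ^ 2 + 8 * T g₁ y' ^ 2 + 4 * C₁ ^ 2 * M := by
      rw [h3] at h2
      nlinarith [sq_nonneg (T g₂ y - 2 * (T g y' - T g₁ y')), sq_nonneg (T g y' + T g₁ y')]
    have h5 : 8 ≤ C := by
      rw [hC]
      have : 0 ≤ 4 * C₁ ^ 2 := by positivity
      have : 0 ≤ 2 * B * 24389 := by positivity
      linarith
    have h6 : 4 * C₁ ^ 2 ≤ C := by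
      rw [hC]
      have : 0 ≤ 2 * B * 24389 := by positivity
      linarith
    have h7 : 8 * T g y' ^ 2 ≤ C * T g y' ^ 2 := by gcongr
    have h8 : 8 * T g₁ y' ^ 2 ≤ C * (2 * T g₁ y' ^ 2) := by
      have : 8 * T g₁ y' ^ 2 ≤ C * T g₁ y' ^ 2 := by gcongr
      nlinarith [mul_nonneg hC0 (sq_nonneg (T g₁ y'))]
    have h9 : 4 * C₁ ^ 2 * M ≤ C * M := by gcongr
    linarith

/-- Singular integrals with dyadically self-similar kernels are bounded on `L^s` for `s ≥ 2`,
uniformly in the number of scales. -/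
theorem exists_singular_integral_bound {ψ : E3 → ℝ} (hψ : ContDiff ℝ ∞ ψ)
    (hψ' : HasCompactSupport ψ) (h0 : ∫ x, ψ x = 0) {s : ℝ} (hs : 2 ≤ s) :
    ∃ C : ℝ≥0∞, C ≠ ⊤ ∧ ∀ (N : ℕ) (g : E3 → ℝ), ContDiff ℝ ∞ g → HasCompactSupport g →
      ∫⁻ x, ENNReal.ofReal (|(dilSum N ψ ⋆[lsmul ℝ ℝ, volume] g) x| ^ s)
        ≤ C * ∫⁻ x, ENNReal.ofReal (|g x| ^ s) := by
  have hTc : ∀ (N : ℕ) (g : E3 → ℝ), ContDiff ℝ ∞ g → HasCompactSupport g →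
      Continuous (dilSum N ψ ⋆[lsmul ℝ ℝ, volume] g) := fun N g hg hg' =>
    hg'.continuous_convolution_right _ ((contDiff_dilSum hψ N).continuous.locallyIntegrable)
      hg.continuous
  have hsq : ∀ f : E3 → ℝ, Continuous f → HasCompactSupport f → Integrable fun y => f y ^ 2 :=
    fun f hf hf' => Continuous.integrable_of_hasCompactSupport (by fun_prop)
      (hf'.comp_left (g := fun t : ℝ => t ^ 2) (by simp))
  have hTs : ∀ (N : ℕ) (g : E3 → ℝ), HasCompactSupport g →
      HasCompactSupport (dilSum N ψ ⋆[lsmul ℝ ℝ, volume] g) := fun N g hg' =>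
    HasCompactSupport.convolution _ (hasCompactSupport_dilSum hψ' N) hg'
  -- the good-`λ` inequality concerns squares, and gives `s / 2 > 1`
  rcases hs.eq_or_lt with rfl | hs2
  · obtain ⟨B, hB0, hB⟩ := exists_integral_sq_dilSum_le hψ hψ' h0
    refine ⟨ENNReal.ofReal B, ENNReal.ofReal_ne_top, fun N g hg hg' => ?_⟩
    simp only [Real.rpow_two, sq_abs]
    rw [← ofReal_integral_eq_lintegral_ofReal (hsq _ (hTc N g hg hg') (hTs N g hg'))
      (Filter.Eventually.of_forall fun y => sq_nonneg _),
      ← ofReal_integral_eq_lintegral_ofReal (hsq _ hg.continuous hg')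
      (Filter.Eventually.of_forall fun y => sq_nonneg _), ← ENNReal.ofReal_mul hB0]
    exact ENNReal.ofReal_le_ofReal (hB N g hg hg')
  · obtain ⟨C, hC⟩ := exists_hasLocalSplitting hψ hψ' h0
    obtain ⟨D, hD, hD'⟩ := exists_lintegral_rpow_le_of_splitting C (q := s / 2) (by linarith)
    refine ⟨D, hD, fun N g hg hg' => ?_⟩
    have hcont := hTc N g hg hg'
    have hgc := hg.continuous
    have h := hD' (fun x => (dilSum N ψ ⋆[lsmul ℝ ℝ, volume] g) x ^ 2) (fun x => g x ^ 2)
      (by fun_prop) (by fun_prop) (fun x => sq_nonneg _) (fun x => sq_nonneg _)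
      (Integrable.lintegral_lt_top (hsq _ hcont (hTs N g hg'))).ne (hC N g hg hg')
    have hpow : ∀ t : ℝ, (t ^ 2) ^ (s / 2) = |t| ^ s := by
      intro t
      rw [← sq_abs, ← Real.rpow_natCast, ← Real.rpow_mul (abs_nonneg _)]
      congr 1
      push_cast
      ring
    simpa only [hpow] using h

/-! ### A divergence formula with kernels supported in a cone -/

/-- The part within height `r` of the open cone spanned by the ball of radius `κ` around `e`. -/
def coneSet (e : E3) (κ r : ℝ) : Set E3 :=
  {x | ∃ (t : ℝ) (a : E3), 0 < t ∧ t < r ∧ ‖a - e‖ < κ ∧ x = t • a}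

section ConeKernel

variable {e₀ : E3} (β : ContDiffBump e₀)

/-- In the coordinates `t = ⟪z, e₀⟫`, `a = z / t`, this is the function `h t * t⁻ᵏ * β a`. -/
def coneFun (h : ℝ → ℝ) (k : ℕ) (z : E3) : ℝ :=
  h ⟪z, e₀⟫ * (⟪z, e₀⟫ ^ k)⁻¹ * β (⟪z, e₀⟫⁻¹ • z)

variable {h : ℝ → ℝ} {k : ℕ} {τ : ℝ}

theorem contDiff_coneFun (hh : ContDiff ℝ ∞ h) (hτ : 0 < τ) (h0 : ∀ t < τ, h t = 0) :
    ContDiff ℝ ∞ (coneFun β h k) := by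
  have hl : ContDiff ℝ ∞ fun z : E3 => ⟪z, e₀⟫ := contDiff_id.inner ℝ contDiff_const
  rw [contDiff_iff_contDiffAt]
  intro z
  rcases lt_or_ge ⟪z, e₀⟫ τ with hz | hz
  · have : coneFun β h k =ᶠ[nhds z] fun _ => 0 := by
      filter_upwards [hl.continuous.continuousAt.eventually_lt continuousAt_const hz] with w hw
      simp [coneFun, h0 _ hw]
    exact contDiffAt_const.congr_of_eventuallyEq this
  · have hz0 : ⟪z, e₀⟫ ≠ 0 := by linarith
    unfold coneFun
    refine ((hh.comp hl).contDiffAt.mul ((hl.pow k).contDiffAt.inv (pow_ne_zero k hz0))).mul ?_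
    exact β.contDiff.contDiffAt.comp z ((hl.contDiffAt.inv hz0).smul contDiffAt_id)

theorem coneFun_eq_zero {t₀ t₁ : ℝ} (h0 : ∀ t, t ∉ Icc t₀ t₁ → h t = 0) (ht₀ : 0 < t₀) {z : E3}
    (hz : z ∉ (fun p : ℝ × E3 => p.1 • p.2) '' (Icc t₀ t₁ ×ˢ Metric.closedBall e₀ β.rOut)) :
    coneFun β h k z = 0 := by
  by_contra hne
  unfold coneFun at hne
  have h1 : ⟪z, e₀⟫ ∈ Icc t₀ t₁ := by
    by_contra hcon
    simp [h0 _ hcon] at hne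
  have h2 : ⟪z, e₀⟫⁻¹ • z ∈ Metric.closedBall e₀ β.rOut := by
    by_contra hcon
    rw [Metric.mem_closedBall, not_le] at hcon
    simp [β.zero_of_le_dist hcon.le] at hne
  refine hz ⟨(⟪z, e₀⟫, ⟪z, e₀⟫⁻¹ • z), ⟨h1, h2⟩, ?_⟩
  have : ⟪z, e₀⟫ ≠ 0 := by linarith [h1.1]
  simp [smul_smul, this]

/-- Euler's identity: the radial derivative only sees the dependence on `t = ⟪z, e₀⟫`. -/
theorem fderiv_coneFun_self (hh : ContDiff ℝ ∞ h) (hτ : 0 < τ) (h0 : ∀ t < τ, h t = 0) {z : E3}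
    (hz : 0 < ⟪z, e₀⟫) :
    fderiv ℝ (coneFun β h k) z z
      = (deriv h ⟪z, e₀⟫ * ⟪z, e₀⟫ - k * h ⟪z, e₀⟫) * (⟪z, e₀⟫ ^ k)⁻¹ * β (⟪z, e₀⟫⁻¹ • z) := by
  set l := ⟪z, e₀⟫ with hl
  have hd : HasFDerivAt (coneFun β h k) (fderiv ℝ (coneFun β h k) z) z :=
    ((contDiff_coneFun β hh hτ h0).differentiable (by simp)).differentiableAt.hasFDerivAt
  have hline : HasDerivAt (fun s : ℝ => s • z) z 1 := by
    simpa using (hasDerivAt_id (1 : ℝ)).smul_const z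
  have h1 : HasDerivAt (fun s : ℝ => coneFun β h k (s • z)) (fderiv ℝ (coneFun β h k) z z) 1 := by
    have hd' : HasFDerivAt (coneFun β h k) (fderiv ℝ (coneFun β h k) z) ((1 : ℝ) • z) := by
      rwa [one_smul]
    exact hd'.comp_hasDerivAt (1 : ℝ) hline
  have hsl : HasDerivAt (fun s : ℝ => s * l) l 1 := by
    simpa using (hasDerivAt_id (1 : ℝ)).mul_const l
  have hh1 : HasDerivAt (fun s : ℝ => h (s * l)) (deriv h l * l) 1 := by
    have hhd : HasDerivAt h (deriv h l) (1 * l) := by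
      rw [one_mul]
      exact ((hh.differentiable (by simp)) l).hasDerivAt
    exact hhd.comp (1 : ℝ) hsl
  have hp1 : HasDerivAt (fun s : ℝ => ((s * l) ^ k)⁻¹) (-(k * (1 * l) ^ (k - 1) * l) / ((1 * l) ^ k) ^ 2) 1 :=
    (hsl.pow k).inv (by simp only [Pi.pow_apply, one_mul]; positivity)
  have h2 := (hh1.mul hp1).mul_const (β (l⁻¹ • z))
  have heq : (fun s : ℝ => coneFun β h k (s • z))
      =ᶠ[nhds 1] fun s => h (s * l) * ((s * l) ^ k)⁻¹ * β (l⁻¹ • z) := by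
    filter_upwards [lt_mem_nhds (zero_lt_one' ℝ)] with s hs
    have h3 : ⟪s • z, e₀⟫ = s * l := real_inner_smul_left _ _ _
    have h4 : (s * l)⁻¹ • s • z = l⁻¹ • z := by
      rw [smul_smul]
      congr 1
      field_simp
    rw [coneFun, h3, h4]
  rw [h1.unique (h2.congr_of_eventuallyEq heq)]
  simp only [one_mul]
  rcases k with _ | k
  · simp
  · rw [Nat.add_sub_cancel]
    push_cast
    field_simp
    try ring

end ConeKernel

theorem tr_fderiv_smul_id {f : E3 → ℝ} {z : E3} (hf : DifferentiableAt ℝ f z) :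
    tr (fderiv ℝ (fun z => f z • z) z) = 3 * f z + fderiv ℝ f z z := by
  have h := hf.hasFDerivAt.smul (hasFDerivAt_id z)
  have hz : z = ∑ i, z i • e i := by
    ext j
    simp [e, Fin.sum_univ_three]
    fin_cases j <;> simp
  have hfd : fderiv ℝ (fun z => f z • z) z
      = f z • ContinuousLinearMap.id ℝ E3 + (fderiv ℝ f z).smulRight z := h.fderiv
  have hsum : fderiv ℝ f z z = ∑ i, fderiv ℝ f z (e i) * z i := by
    rw [congrArg (fderiv ℝ f z) hz, map_sum]
    refine Finset.sum_congr rfl fun i _ => ?_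
    rw [map_smul, smul_eq_mul, mul_comm]
  rw [hfd, hsum, tr]
  simp [e, Fin.sum_univ_three]
  ring

/-- A smooth field `Θ` supported in a cone, whose divergence is the difference between a mollifier
`σ` at scale `1/2` and at scale `1`. -/
theorem exists_cone_kernel {e₀ : E3} (he : ‖e₀‖ = 1) {κ r : ℝ} (hκ : 0 < κ) (hr : 0 < r) :
    ∃ (σ : E3 → ℝ) (Θ : E3 → E3), ContDiff ℝ ∞ σ ∧ ContDiff ℝ ∞ Θ ∧ HasCompactSupport σ ∧
      HasCompactSupport Θ ∧ tsupport σ ⊆ coneSet e₀ κ r ∧ tsupport Θ ⊆ coneSet e₀ κ r ∧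
      (∀ x, 0 ≤ σ x) ∧ ∫ x, σ x = 1 ∧
      ∀ x, tr (fderiv ℝ Θ x) = 8 * σ ((2 : ℝ) • x) - σ x := by
  -- `β` cuts off the directions, `η` the heights. With `H t = η (2 t) - η t`, the divergence of
  -- `H t * t⁻³ * β a * z` is the difference of `η' t * t⁻² * β a` at two scales.
  let β : ContDiffBump e₀ := ⟨κ / 4, κ / 2, by positivity, by linarith⟩
  set η : ℝ → ℝ := fun t => Real.smoothTransition (4 / r * t - 1) with hη
  have hηs : ContDiff ℝ ∞ η := Real.smoothTransition.contDiff.comp (by fun_prop)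
  have hη0 : ∀ t, t ≤ r / 4 → η t = 0 := fun t ht => by
    refine Real.smoothTransition.zero_of_nonpos ?_
    have : 4 / r * t ≤ 4 / r * (r / 4) := by gcongr
    have h2 : 4 / r * (r / 4) = 1 := by field_simp
    linarith
  have hη1 : ∀ t, r / 2 ≤ t → η t = 1 := fun t ht => by
    refine Real.smoothTransition.one_of_one_le ?_
    have : 4 / r * (r / 2) ≤ 4 / r * t := by gcongr
    have h2 : 4 / r * (r / 2) = 2 := by field_simp; norm_num
    linarith
  have hηm : Monotone η := Real.smoothTransition.monotone.comp fun a b hab => by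
    have : 4 / r * a ≤ 4 / r * b := by gcongr
    simpa using this
  set η' : ℝ → ℝ := deriv η with hη'
  have hη's : ContDiff ℝ ∞ η' := (contDiff_infty_iff_deriv.1 hηs).2
  have hη'0 : ∀ t, t ∉ Icc (r / 4) (r / 2) → η' t = 0 := by
    intro t ht
    have : ∃ c : ℝ, η =ᶠ[nhds t] fun _ => c := by
      rcases lt_or_ge t (r / 4) with h | h
      · exact ⟨0, by filter_upwards [gt_mem_nhds h] with s hs using hη0 s hs.le⟩
      · have h2 : r / 2 < t := by
          by_contra! hcon
          exact ht ⟨h, hcon⟩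
        exact ⟨1, by filter_upwards [lt_mem_nhds h2] with s hs using hη1 s hs.le⟩
    obtain ⟨c, hc⟩ := this
    rw [hη', hc.deriv_eq, deriv_const]
  set H : ℝ → ℝ := fun t => η (2 * t) - η t with hH
  have hHs : ContDiff ℝ ∞ H := (hηs.comp (contDiff_const.mul contDiff_id)).sub hηs
  have hH0 : ∀ t, t ∉ Icc (r / 8) (r / 2) → H t = 0 := by
    intro t ht
    rcases lt_or_ge t (r / 8) with h | h
    · simp [hH, hη0 t (by linarith), hη0 (2 * t) (by linarith)]
    · have h2 : r / 2 < t := by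
        by_contra! hcon
        exact ht ⟨h, hcon⟩
      simp [hH, hη1 t (by linarith), hη1 (2 * t) (by linarith)]
  have hHd : ∀ t, deriv H t = 2 * η' (2 * t) - η' t := by
    intro t
    have hd := hηs.differentiable (by simp)
    have h1 : HasDerivAt (fun t => η (2 * t)) (η' (2 * t) * 2) t := by
      have h2 : HasDerivAt (fun t : ℝ => 2 * t) 2 t := by
        simpa using (hasDerivAt_id t).const_mul (2 : ℝ)
      exact (hd (2 * t)).hasDerivAt.comp t h2
    have h3 : HasDerivAt H (η' (2 * t) * 2 - η' t) t := h1.sub (hd t).hasDerivAt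
    rw [h3.deriv]
    ring
  have hr8 : 0 < r / 8 := by positivity
  have hH0' : ∀ t < r / 8, H t = 0 := fun t ht => hH0 t fun h => by linarith [h.1]
  have hη'0' : ∀ t < r / 4, η' t = 0 := fun t ht => hη'0 t fun h => by linarith [h.1]
  set σ₀ : E3 → ℝ := coneFun β η' 2 with hσ₀
  set f : E3 → ℝ := coneFun β H 3 with hf
  have hσ₀s : ContDiff ℝ ∞ σ₀ := contDiff_coneFun β hη's (by positivity : 0 < r / 4) hη'0'
  have hfs : ContDiff ℝ ∞ f := contDiff_coneFun β hHs hr8 hH0'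
  have hdiv : ∀ x, tr (fderiv ℝ (fun z => f z • z) x) = 8 * σ₀ ((2 : ℝ) • x) - σ₀ x := by
    intro x
    rw [tr_fderiv_smul_id (hfs.differentiable (by simp) x)]
    have hin : ⟪(2 : ℝ) • x, e₀⟫ = 2 * ⟪x, e₀⟫ := real_inner_smul_left _ _ _
    rcases le_or_gt ⟪x, e₀⟫ 0 with hx | hx
    · have hfz : f =ᶠ[nhds x] fun _ => 0 := by
        have hc : Continuous fun z : E3 => ⟪z, e₀⟫ := by fun_prop
        filter_upwards [hc.continuousAt.eventually_lt continuousAt_const (hx.trans_lt hr8)] with w hw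
        simp [hf, coneFun, hH0' _ hw]
      rw [hfz.fderiv_eq, hfz.eq_of_nhds]
      simp only [hσ₀, coneFun, hin]
      rw [hη'0' _ (by linarith : ⟪x, e₀⟫ < r / 4), hη'0' _ (by linarith : 2 * ⟪x, e₀⟫ < r / 4)]
      simp
    · rw [hf, fderiv_coneFun_self β hHs hr8 hH0' hx, hHd]
      simp only [hσ₀, coneFun, hin]
      have : (2 * ⟪x, e₀⟫)⁻¹ • (2 : ℝ) • x = ⟪x, e₀⟫⁻¹ • x := by
        rw [smul_smul]
        congr 1
        field_simp
      rw [this]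
      field_simp
      push_cast
      ring
  set Z : Set E3 := (fun p : ℝ × E3 => p.1 • p.2) '' (Icc (r / 8) (r / 2) ×ˢ Metric.closedBall e₀ β.rOut)
    with hZ
  have hZc : IsCompact Z :=
    (isCompact_Icc.prod (isCompact_closedBall _ _)).image (by fun_prop)
  have hZcone : Z ⊆ coneSet e₀ κ r := by
    rintro _ ⟨⟨t, a⟩, ⟨ht, ha⟩, rfl⟩
    refine ⟨t, a, by linarith [ht.1], by linarith [ht.2], ?_, rfl⟩
    rw [mem_closedBall_iff_norm] at ha
    have : β.rOut = κ / 2 := rfl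
    linarith
  have hσZ : ∀ x, x ∉ Z → σ₀ x = 0 := fun x hx => coneFun_eq_zero β
    (fun t ht => hη'0 t fun h => ht ⟨by linarith [h.1], h.2⟩) hr8 hx
  have hΘZ : ∀ x, x ∉ Z → f x • x = 0 := fun x hx => by
    rw [hf, coneFun_eq_zero β hH0 hr8 hx, zero_smul]
  have hσ₀c : HasCompactSupport σ₀ := HasCompactSupport.intro hZc hσZ
  have hnn : ∀ x, 0 ≤ σ₀ x := by
    intro x
    have h1 : 0 ≤ η' ⟪x, e₀⟫ := hηm.deriv_nonneg
    have h2 := β.nonneg (x := ⟪x, e₀⟫⁻¹ • x)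
    simp only [hσ₀, coneFun]
    positivity
  have hint : Integrable σ₀ := hσ₀s.continuous.integrable_of_hasCompactSupport hσ₀c
  have hpos : 0 < ∫ x, σ₀ x := by
    refine lt_of_le_of_ne (integral_nonneg hnn) fun h0 => ?_
    -- otherwise `η` would be constant on the ray spanned by `e₀`
    have hz : σ₀ = 0 := (Continuous.ae_eq_iff_eq volume hσ₀s.continuous continuous_const).1
      ((integral_eq_zero_iff_of_nonneg hnn hint).1 h0.symm)
    have hη'z : ∀ t, η' t = 0 := by
      intro t
      rcases lt_or_ge t (r / 4) with ht | ht
      · exact hη'0' t ht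
      have ht0 : t ≠ 0 := by linarith
      have h1 := congrFun hz (t • e₀)
      have hi : ⟪t • e₀, e₀⟫ = t := by
        rw [real_inner_smul_left, real_inner_self_eq_norm_sq, he]; norm_num
      have hb : β (t⁻¹ • t • e₀) = 1 := by
        rw [smul_smul, inv_mul_cancel₀ ht0, one_smul]
        exact β.one_of_mem_closedBall (Metric.mem_closedBall_self β.rIn_pos.le)
      simp only [hσ₀, coneFun, hi, hb, mul_one, Pi.zero_apply, mul_eq_zero, inv_eq_zero] at h1
      exact h1.resolve_right (pow_ne_zero 2 ht0)
    have := is_const_of_deriv_eq_zero (hηs.differentiable (by simp)) hη'z 0 r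
    rw [hη0 0 (by positivity), hη1 r (by linarith)] at this
    norm_num at this
  set c := (∫ x, σ₀ x)⁻¹ with hc
  have hc0 : 0 < c := by positivity
  refine ⟨fun x => c * σ₀ x, fun x => c • (f x • x), contDiff_const.mul hσ₀s,
    (hfs.smul contDiff_id).const_smul c, hσ₀c.mul_left, ?_, ?_, ?_, fun x => ?_, ?_, fun x => ?_⟩
  · exact HasCompactSupport.intro hZc fun x hx => by rw [hΘZ x hx, smul_zero]
  · refine subset_trans (closure_minimal ?_ hZc.isClosed) hZcone
    exact fun x hx => by_contra fun h => hx (by simp [hσZ x h])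
  · refine subset_trans (closure_minimal ?_ hZc.isClosed) hZcone
    exact fun x hx => by_contra fun h => hx (by simp only [hΘZ x h, smul_zero])
  · exact mul_nonneg hc0.le (hnn x)
  · rw [integral_const_mul, hc, inv_mul_cancel₀ hpos.ne']
  · have h1 : fderiv ℝ (fun x => c • (f x • x)) x = c • fderiv ℝ (fun x => f x • x) x :=
      fderiv_const_smul ((hfs.smul contDiff_id).differentiable (by simp) x) c
    have h2 : ∀ A : E3 →L[ℝ] E3, tr (c • A) = c * tr A := by
      intro A
      simp [tr, Finset.mul_sum]
    rw [h1, h2, hdiv]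
    ring

/-! ### The cone condition for Lipschitz domains -/

/-- Near `x`, every point of the closure of `Ω` is the vertex of a cone contained in `Ω`, with a
direction and a size that do not depend on the point. -/
def HasConeAt (Ω : Set E3) (x : E3) : Prop :=
  ∃ (e₀ : E3) (κ r : ℝ), ‖e₀‖ = 1 ∧ 0 < κ ∧ 0 < r ∧
    ∀ y ∈ closure Ω, y ∈ Metric.ball x r → ∀ z ∈ coneSet e₀ κ r, y + z ∈ Ω

theorem norm_lt_of_mem_coneSet {e₀ z : E3} {κ r : ℝ} (he : ‖e₀‖ = 1) (hκ : κ ≤ 1)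
    (hz : z ∈ coneSet e₀ κ r) : ‖z‖ < 2 * r := by
  obtain ⟨t, a, ht0, htr, ha, rfl⟩ := hz
  have h1 : ‖a‖ ≤ 1 + ‖a - e₀‖ := by
    have := norm_add_le e₀ (a - e₀)
    rw [add_sub_cancel, he] at this
    exact this
  rw [norm_smul, Real.norm_eq_abs, abs_of_pos ht0]
  nlinarith [norm_nonneg a]

theorem norm_e (i : Fin 3) : ‖e i‖ = 1 := by simp [e]

theorem hasConeAt_of_mem {Ω : Set E3} (hΩ : IsOpen Ω) {x : E3} (hx : x ∈ Ω) : HasConeAt Ω x := by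
  obtain ⟨d, hd, hball⟩ := Metric.isOpen_iff.1 hΩ x hx
  refine ⟨e 0, 1, d / 3, norm_e 0, one_pos, by positivity, fun y _ hy z hz => hball ?_⟩
  have h1 := norm_lt_of_mem_coneSet (norm_e 0) le_rfl hz
  rw [mem_ball_iff_norm] at hy ⊢
  have := norm_add_le (y - x) z
  rw [show y + z - x = y - x + z by abel]
  linarith

section Graph

variable {Ω : Set E3} {x : E3} {r : ℝ} {A : E3 ≃ₗᵢ[ℝ] E3} {g : EuclideanSpace ℝ (Fin 2) → ℝ}

theorem continuous_graph_coord (A : E3 ≃ₗᵢ[ℝ] E3) :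
    Continuous fun y : E3 => (!₂[A y 0, A y 1] : EuclideanSpace ℝ (Fin 2)) := by
  refine (PiLp.continuous_toLp 2 _).comp ?_
  refine continuous_pi fun i => ?_
  fin_cases i <;> simp <;> fun_prop

theorem le_of_mem_closure_of_graph (hg : Continuous g)
    (h : ∀ y ∈ Metric.ball x r, (y ∈ Ω ↔ g (!₂[A y 0, A y 1]) < A y 2)) {y : E3}
    (hy : y ∈ closure Ω) (hyx : y ∈ Metric.ball x r) : g (!₂[A y 0, A y 1]) ≤ A y 2 := by
  have hcl : IsClosed {y : E3 | g (!₂[A y 0, A y 1]) ≤ A y 2} := by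
    refine isClosed_le (hg.comp (continuous_graph_coord A)) ?_
    fun_prop
  have h1 : y ∈ closure (Ω ∩ Metric.ball x r) := by
    rw [inter_comm]
    exact Metric.isOpen_ball.inter_closure ⟨hyx, hy⟩
  exact hcl.closure_subset_iff.2 (fun w hw => ((h w hw.2).1 hw.1).le) h1

theorem norm_graph_coord_le (A : E3 ≃ₗᵢ[ℝ] E3) (w : E3) :
    ‖(!₂[A w 0, A w 1] : EuclideanSpace ℝ (Fin 2))‖ ≤ ‖w‖ := by
  rw [← A.norm_map w, EuclideanSpace.norm_eq, EuclideanSpace.norm_eq]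
  refine Real.sqrt_le_sqrt ?_
  simp only [Fin.sum_univ_two, Fin.sum_univ_three]
  simp
  positivity

/-- A cone with axis in the direction of the graph coordinate, and with opening determined by the
Lipschitz constant, stays above the graph. -/
theorem hasConeAt_of_graph {K : ℝ≥0} (hr : 0 < r) (hg : LipschitzWith K g)
    (h : ∀ y ∈ Metric.ball x r, (y ∈ Ω ↔ g (!₂[A y 0, A y 1]) < A y 2)) : HasConeAt Ω x := by
  set κ : ℝ := 1 / (K + 2) with hκ
  have hK : (0 : ℝ) ≤ K := K.2
  have hκ0 : 0 < κ := by positivity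
  have hκ1 : κ ≤ 1 := by rw [hκ, div_le_one (by positivity)]; linarith
  have hκK : K * κ < 1 - κ := by
    have : κ * (K + 2) = 1 := by rw [hκ]; field_simp
    nlinarith
  have he : ‖A.symm (e 2)‖ = 1 := by rw [A.symm.norm_map, norm_e]
  refine ⟨A.symm (e 2), κ, r / 4, he, hκ0, by positivity, fun y hy hyx z hz => ?_⟩
  have hzn := norm_lt_of_mem_coneSet he hκ1 hz
  obtain ⟨t, a, ht0, -, ha, rfl⟩ := hz
  have hyx' : y ∈ Metric.ball x r := Metric.ball_subset_ball (by linarith) hyx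
  have hyz : y + t • a ∈ Metric.ball x r := by
    rw [mem_ball_iff_norm] at hyx ⊢
    have := norm_add_le (y - x) (t • a)
    rw [show y + t • a - x = y - x + t • a by abel]
    linarith
  rw [h _ hyz]
  have h1 := le_of_mem_closure_of_graph hg.continuous h hy hyx'
  set b := a - A.symm (e 2) with hb
  have hab : A a = e 2 + A b := by rw [hb, map_sub, A.apply_symm_apply]; abel
  have hbn : ∀ i, |A b i| ≤ ‖b‖ := fun i => by
    rw [← A.norm_map b]
    simpa using PiLp.norm_apply_le (A b) i
  have h2 := hg.dist_le_mul (!₂[A (y + t • a) 0, A (y + t • a) 1]) (!₂[A y 0, A y 1])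
  have h3 : dist (!₂[A (y + t • a) 0, A (y + t • a) 1] : EuclideanSpace ℝ (Fin 2)) (!₂[A y 0, A y 1])
      ≤ t * ‖b‖ := by
    have heq : (!₂[A (y + t • a) 0, A (y + t • a) 1] : EuclideanSpace ℝ (Fin 2)) - !₂[A y 0, A y 1]
        = !₂[A (t • b) 0, A (t • b) 1] := by
      ext i
      fin_cases i <;> simp [hab, e]
    rw [dist_eq_norm, heq]
    refine (norm_graph_coord_le A (t • b)).trans_eq ?_
    rw [norm_smul, Real.norm_eq_abs, abs_of_pos ht0]
  have h4 : A (y + t • a) 2 = A y 2 + t * (1 + A b 2) := by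
    simp [hab, e]
    ring
  have h5 := neg_le_of_abs_le (hbn 2)
  rw [h4]
  rw [Real.dist_eq] at h2
  have h6 := le_of_abs_le h2
  have h7 : (K : ℝ) * dist (!₂[A (y + t • a) 0, A (y + t • a) 1] : EuclideanSpace ℝ (Fin 2))
      (!₂[A y 0, A y 1]) ≤ K * (t * ‖b‖) := by gcongr
  have h8 : (K : ℝ) * (t * ‖b‖) ≤ t * (K * κ) := by
    have : (K : ℝ) * (t * ‖b‖) ≤ K * (t * κ) := by gcongr
    linarith
  have h9 : t * (K * κ) < t * (1 - κ) := by gcongr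
  have h10 : t * (1 - κ) ≤ t * (1 + A b 2) := by
    gcongr
    linarith
  linarith

theorem volume_graph_eq_zero (A : E3 ≃ₗᵢ[ℝ] E3) (hg : Continuous g) :
    volume {y : E3 | g (!₂[A y 0, A y 1]) = A y 2} = 0 := by
  have hcl : IsClosed {y : E3 | g (!₂[A y 0, A y 1]) = A y 2} := by
    refine isClosed_eq (hg.comp (continuous_graph_coord A)) ?_
    fun_prop
  -- the vertical translates of a graph are pairwise disjoint
  refine Measure.addHaar_eq_zero_of_disjoint_translates volume
    (u := fun n : ℕ => (1 / ((n : ℝ) + 1)) • A.symm (e 2)) ?_ ?_ hcl.measurableSet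
  · refine (Metric.isBounded_closedBall (x := (0 : E3)) (r := 1)).subset ?_
    rintro _ ⟨n, rfl⟩
    rw [mem_closedBall_zero_iff, norm_smul, A.symm.norm_map, norm_e, mul_one, Real.norm_eq_abs,
      abs_of_pos (by positivity), div_le_one (by positivity)]
    have : (0 : ℝ) ≤ n := by positivity
    linarith
  · intro m n hmn
    rw [Function.onFun, Set.disjoint_left]
    simp only [singleton_add, mem_image, mem_ofPred_eq, not_exists, not_and]
    rintro _ ⟨y, hy, rfl⟩ w hw heq
    apply hmn
    have hcoord : ∀ i, A (((1 : ℝ) / ((n : ℝ) + 1)) • A.symm (e 2) + w) i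
        = A ((1 / ((m : ℝ) + 1)) • A.symm (e 2) + y) i := fun i => by rw [heq]
    have h0 := hcoord 0
    have h1 := hcoord 1
    have h2 := hcoord 2
    simp [e] at h0 h1 h2
    rw [← hy, ← hw, h0, h1] at h2
    have h3 : ((n : ℝ) + 1)⁻¹ = ((m : ℝ) + 1)⁻¹ := by linarith
    have h4 := inv_injective h3
    have h5 : (n : ℝ) = m := by linarith
    exact (by exact_mod_cast h5.symm : m = n)

end Graph

theorem HasLipschitzBoundary.hasConeAt {Ω : Set E3} (hΩ : IsOpen Ω) (h : HasLipschitzBoundary Ω)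
    {x : E3} (hx : x ∈ closure Ω) : HasConeAt Ω x := by
  by_cases hxΩ : x ∈ Ω
  · exact hasConeAt_of_mem hΩ hxΩ
  · obtain ⟨r, hr, A, g, K, hg, hgr⟩ := h x (by rw [hΩ.frontier_eq]; exact ⟨hx, hxΩ⟩)
    exact hasConeAt_of_graph hr hg hgr

theorem HasLipschitzBoundary.volume_frontier {Ω : Set E3} (hΩ : IsOpen Ω)
    (h : HasLipschitzBoundary Ω) : volume (frontier Ω) = 0 := by
  refine measure_null_of_locally_null _ fun x hx => ?_
  obtain ⟨r, hr, A, g, K, hg, hgr⟩ := h x hx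
  refine ⟨frontier Ω ∩ Metric.ball x r,
    Filter.inter_mem self_mem_nhdsWithin (mem_nhdsWithin_of_mem_nhds (Metric.ball_mem_nhds x hr)), ?_⟩
  refine measure_mono_null (fun y hy => ?_) (volume_graph_eq_zero A hg.continuous)
  rw [hΩ.frontier_eq] at hy
  refine le_antisymm (le_of_mem_closure_of_graph hg.continuous hgr hy.1.1 hy.2) ?_
  by_contra! hcon
  exact hy.1.2 ((hgr y hy.2).2 hcon)

/-! ### Mollification -/

section Mollify

variable {F : Type*} [NormedAddCommGroup F]

theorem tendsto_eLpNorm_translate_sub {w : E3 → F} {s : ℝ} (hs : 1 ≤ s)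
    (hw : MemLp w (ENNReal.ofReal s)) :
    Filter.Tendsto (fun t : E3 => eLpNorm (fun x => w (x - t) - w x) (ENNReal.ofReal s) volume)
      (nhds 0) (nhds 0) := by
  have : Fact ((1 : ℝ≥0∞) ≤ ENNReal.ofReal s) := ⟨by simpa using hs⟩
  let g₂ : C(E3 × E3, E3) := ⟨fun p => p.2 - p.1, by fun_prop⟩
  let g : C(E3, C(E3, E3)) := g₂.curry
  have hmp : ∀ t : E3, MeasurePreserving (g t) volume volume := fun t =>
    measurePreserving_sub_right volume t
  have h1 := Filter.Tendsto.compMeasurePreservingLp (μ := volume) (ν := volume)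
    (tendsto_const_nhds (x := hw.toLp w) (f := nhds (0 : E3)))
    (g.continuous.tendsto 0) hmp (hmp 0) ENNReal.ofReal_ne_top
  simp only [Lp.toLp_compMeasurePreserving] at h1
  rw [Lp.tendsto_Lp_iff_tendsto_eLpNorm''] at h1
  refine h1.congr fun t => ?_
  congr 1
  ext x
  simp [g, g₂]

theorem lintegral_rpow_enorm_average_le {ν : Measure E3} [IsProbabilityMeasure ν] {f : E3 → F}
    (hf : AEStronglyMeasurable f ν) {s : ℝ} (hs : 1 ≤ s) :
    (∫⁻ t, ‖f t‖ₑ ∂ν) ^ s ≤ ∫⁻ t, ‖f t‖ₑ ^ s ∂ν := by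
  have h := eLpNorm'_le_eLpNorm'_of_exponent_le one_pos hs ν hf
  simp only [eLpNorm', ENNReal.rpow_one, div_one] at h
  calc (∫⁻ t, ‖f t‖ₑ ∂ν) ^ s ≤ ((∫⁻ t, ‖f t‖ₑ ^ s ∂ν) ^ (1 / s)) ^ s := by gcongr
    _ = _ := by rw [← ENNReal.rpow_mul, one_div, inv_mul_cancel₀ (by linarith), ENNReal.rpow_one]

variable [NormedSpace ℝ F]

/-- Jensen's inequality and Tonelli's theorem bound the error of a mollification by the `L^s` modulus
of continuity. -/
theorem eLpNorm_convolution_sub_le [CompleteSpace F] {σ : E3 → ℝ} (hσ : Continuous σ)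
    (hσ' : HasCompactSupport σ)
    (hσ0 : ∀ x, 0 ≤ σ x) (hσ1 : ∫ x, σ x = 1) {w : E3 → F} {s : ℝ} (hs : 1 ≤ s)
    (hw : MemLp w (ENNReal.ofReal s)) {ε : ℝ≥0∞}
    (hε : ∀ t, σ t ≠ 0 → eLpNorm (fun x => w (x - t) - w x) (ENNReal.ofReal s) volume ≤ ε) :
    eLpNorm (σ ⋆[lsmul ℝ ℝ, volume] w - w) (ENNReal.ofReal s) volume ≤ ε := by
  have hs0 : 0 < s := by linarith
  have hp0 : ENNReal.ofReal s ≠ 0 := by simpa using hs0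
  have hpr : (ENNReal.ofReal s).toReal = s := ENNReal.toReal_ofReal hs0.le
  -- replacing `w` by a strongly measurable representative
  wlog hwm : StronglyMeasurable w generalizing w
  · obtain ⟨w', hw', hae⟩ := id hw.1
    have hsub : ∀ x, (fun t => w (x - t)) =ᵐ[volume] fun t => w' (x - t) := fun x =>
      (quasiMeasurePreserving_sub_left volume x).ae_eq_comp hae
    have hsub' : ∀ t, (fun x => w (x - t) - w x) =ᵐ[volume] fun x => w' (x - t) - w' x := fun t =>
      ((measurePreserving_sub_right volume t).quasiMeasurePreserving.ae_eq_comp hae).sub hae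
    have hconv : σ ⋆[lsmul ℝ ℝ, volume] w = σ ⋆[lsmul ℝ ℝ, volume] w' := by
      ext x
      refine integral_congr_ae ?_
      filter_upwards [hsub x] with t ht
      rw [ht]
    have h := this ((memLp_congr_ae hae).1 hw) (fun t ht => by
      rw [← eLpNorm_congr_ae (hsub' t)]; exact hε t ht) hw'
    rw [hconv, eLpNorm_congr_ae (Filter.EventuallyEq.rfl.sub hae)]
    exact h
  set ν := (volume : Measure E3).withDensity fun t => ENNReal.ofReal (σ t) with hν
  have hσm : Measurable fun t => ENNReal.ofReal (σ t) := hσ.measurable.ennreal_ofReal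
  have hσi : Integrable σ := hσ.integrable_of_hasCompactSupport hσ'
  have : IsProbabilityMeasure ν := ⟨by
    rw [hν, withDensity_apply _ MeasurableSet.univ, Measure.restrict_univ,
      ← ofReal_integral_eq_lintegral_ofReal hσi (Filter.Eventually.of_forall hσ0), hσ1,
      ENNReal.ofReal_one]⟩
  have hwl : LocallyIntegrable w volume := hw.locallyIntegrable (by simpa using hs)
  have hjoint : StronglyMeasurable fun p : E3 × E3 => w (p.1 - p.2) - w p.1 :=
    (hwm.comp_measurable (by fun_prop)).sub (hwm.comp_measurable measurable_fst)
  have hpt : ∀ x, ‖(σ ⋆[lsmul ℝ ℝ, volume] w - w) x‖ₑ ^ s ≤ ∫⁻ t, ‖w (x - t) - w x‖ₑ ^ s ∂ν := by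
    intro x
    have hm : StronglyMeasurable fun t => w (x - t) - w x :=
      hjoint.comp_measurable (g := fun t => (x, t)) (by fun_prop)
    refine le_trans ?_ (lintegral_rpow_enorm_average_le hm.aestronglyMeasurable hs)
    gcongr
    have hex : ConvolutionExistsAt σ w x (lsmul ℝ ℝ) volume :=
      hσ'.convolutionExists_left _ hσ hwl x
    have hex' : Integrable fun t => σ t • w x := hσi.smul_const _
    have heq : (σ ⋆[lsmul ℝ ℝ, volume] w - w) x = ∫ t, σ t • (w (x - t) - w x) := by
      rw [Pi.sub_apply, convolution_def]
      have h1 : w x = ∫ t, σ t • w x := by rw [integral_smul_const, hσ1, one_smul]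
      conv_lhs => rw [h1]
      rw [← integral_sub hex hex']
      simp only [ContinuousLinearMap.lsmul_apply, smul_sub]
    rw [heq]
    refine (enorm_integral_le_lintegral_enorm _).trans_eq ?_
    rw [hν, lintegral_withDensity_eq_lintegral_mul _ hσm hm.enorm]
    refine lintegral_congr fun t => ?_
    rw [enorm_smul, Real.enorm_of_nonneg (hσ0 t)]
    rfl
  rw [eLpNorm_eq_lintegral_rpow_enorm_toReal hp0 ENNReal.ofReal_ne_top, hpr]
  have hmain : ∫⁻ x, ‖(σ ⋆[lsmul ℝ ℝ, volume] w - w) x‖ₑ ^ s ≤ ε ^ s :=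
    calc ∫⁻ x, ‖(σ ⋆[lsmul ℝ ℝ, volume] w - w) x‖ₑ ^ s
        ≤ ∫⁻ x, ∫⁻ t, ‖w (x - t) - w x‖ₑ ^ s ∂ν := lintegral_mono hpt
      _ = ∫⁻ t, (∫⁻ x, ‖w (x - t) - w x‖ₑ ^ s) ∂ν := by
          exact lintegral_lintegral_swap (μ := volume) (ν := ν) (f := fun x t => ‖w (x - t) - w x‖ₑ ^ s)
            (hjoint.enorm.pow_const s).aemeasurable
      _ = ∫⁻ t, ENNReal.ofReal (σ t) * ∫⁻ x, ‖w (x - t) - w x‖ₑ ^ s := by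
          exact lintegral_withDensity_eq_lintegral_mul volume hσm
            (g := fun t => ∫⁻ x, ‖w (x - t) - w x‖ₑ ^ s)
            (hjoint.enorm.pow_const s).lintegral_prod_left'
      _ ≤ ∫⁻ t, ENNReal.ofReal (σ t) * ε ^ s := by
          refine lintegral_mono fun t => ?_
          by_cases ht : σ t = 0
          · simp [ht]
          · gcongr
            have h := hε t ht
            rw [eLpNorm_eq_lintegral_rpow_enorm_toReal hp0 ENNReal.ofReal_ne_top, hpr] at h
            rwa [one_div, ENNReal.rpow_inv_le_iff hs0] at h
      _ = ε ^ s := by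
          rw [lintegral_mul_const _ hσm, ← ofReal_integral_eq_lintegral_ofReal hσi
            (Filter.Eventually.of_forall hσ0), hσ1, ENNReal.ofReal_one, one_mul]
  rwa [one_div, ENNReal.rpow_inv_le_iff hs0]

theorem integral_dil (n : ℕ) (σ : E3 → ℝ) : ∫ x, dil n σ x = ∫ x, σ x := by
  have h := Measure.integral_comp_smul_of_nonneg (volume : Measure E3) σ ((2 : ℝ) ^ n)
    (hR := by positivity)
  rw [finrank_euclideanSpace_fin] at h
  have h8 : (8 : ℝ) ^ n = ((2 : ℝ) ^ n) ^ 3 := by rw [← pow_mul, mul_comm, pow_mul]; norm_num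
  simp only [dil]
  rw [integral_smul, h, ← h8, smul_smul, mul_inv_cancel₀ (by positivity), one_smul]

theorem norm_le_of_dil_ne_zero {σ : E3 → ℝ} {R : ℝ} (hR : ∀ x, σ x ≠ 0 → ‖x‖ ≤ R) {n : ℕ} {x : E3}
    (hx : dil n σ x ≠ 0) : ‖x‖ ≤ R / 2 ^ n := by
  have h1 : σ ((2 : ℝ) ^ n • x) ≠ 0 := fun h => hx (by rw [dil, h, smul_zero])
  have h2 := hR _ h1
  rw [norm_smul, norm_pow, Real.norm_ofNat] at h2
  rw [le_div_iff₀ (by positivity)]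
  linarith

theorem exists_bound_of_hasCompactSupport {G : Type*} [Zero G] {σ : E3 → G}
    (hσ : HasCompactSupport σ) : ∃ R, 0 < R ∧ ∀ x, σ x ≠ 0 → ‖x‖ ≤ R := by
  obtain ⟨R, hR⟩ := hσ.isCompact.isBounded.subset_closedBall 0
  refine ⟨max R 1, by positivity, fun x hx => ?_⟩
  have := hR (subset_tsupport _ hx)
  rw [mem_closedBall_zero_iff] at this
  exact this.trans (le_max_left _ _)

theorem tendsto_div_two_pow (R : ℝ) :
    Filter.Tendsto (fun n : ℕ => R / 2 ^ n) Filter.atTop (nhds 0) := by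
  have h1 := (tendsto_pow_atTop_nhds_zero_of_lt_one (r := (2 : ℝ)⁻¹) (by norm_num)
    (by norm_num)).const_mul R
  rw [mul_zero] at h1
  exact h1.congr fun n => by rw [inv_pow, div_eq_mul_inv]

/-- Mollifications converge in `L^s`. -/
theorem tendsto_eLpNorm_dil_convolution_sub [CompleteSpace F] {σ : E3 → ℝ} (hσ : ContDiff ℝ ∞ σ)
    (hσ' : HasCompactSupport σ) (hσ0 : ∀ x, 0 ≤ σ x) (hσ1 : ∫ x, σ x = 1) {w : E3 → F} {s : ℝ}
    (hs : 1 ≤ s) (hw : MemLp w (ENNReal.ofReal s)) :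
    Filter.Tendsto (fun n => eLpNorm (dil n σ ⋆[lsmul ℝ ℝ, volume] w - w) (ENNReal.ofReal s) volume)
      Filter.atTop (nhds 0) := by
  obtain ⟨R, hR0, hR⟩ := exists_bound_of_hasCompactSupport hσ'
  rw [ENNReal.tendsto_nhds_zero]
  intro ε hε
  have h1 := (ENNReal.tendsto_nhds_zero.1 (tendsto_eLpNorm_translate_sub hs hw)) ε hε
  obtain ⟨d, hd, hball⟩ := Metric.eventually_nhds_iff_ball.1 h1
  filter_upwards [(tendsto_div_two_pow R).eventually_lt_const hd] with n hn
  refine eLpNorm_convolution_sub_le (contDiff_dil hσ n).continuous (hasCompactSupport_dil hσ' n)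
    (fun x => ?_) (by rw [integral_dil, hσ1]) hs hw fun t ht => hball t ?_
  · exact mul_nonneg (by positivity) (hσ0 _)
  · rw [mem_ball_zero_iff]
    exact (norm_le_of_dil_ne_zero hR ht).trans_lt hn

/-- Mollifications of a Lipschitz function converge uniformly, with a rate. -/
theorem abs_dil_convolution_sub_le {σ : E3 → ℝ} (hσ : ContDiff ℝ ∞ σ)
    (hσ' : HasCompactSupport σ) (hσ0 : ∀ x, 0 ≤ σ x) (hσ1 : ∫ x, σ x = 1) {R : ℝ}
    (hR : ∀ x, σ x ≠ 0 → ‖x‖ ≤ R) {g : E3 → ℝ} {K : ℝ≥0} (hg : LipschitzWith K g) (n : ℕ) (x : E3) :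
    |(dil n σ ⋆[lsmul ℝ ℝ, volume] g) x - g x| ≤ K * (R / 2 ^ n) := by
  have hs1 : ∫ t, dil n σ t = 1 := by rw [integral_dil, hσ1]
  have hi : Integrable (dil n σ) :=
    (contDiff_dil hσ n).continuous.integrable_of_hasCompactSupport (hasCompactSupport_dil hσ' n)
  have h0 : ∀ t, 0 ≤ dil n σ t := fun t => mul_nonneg (by positivity) (hσ0 _)
  have hex : ConvolutionExistsAt (dil n σ) g x (lsmul ℝ ℝ) volume :=
    (hasCompactSupport_dil hσ' n).convolutionExists_left _ (contDiff_dil hσ n).continuous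
      hg.continuous.locallyIntegrable x
  have heq : (dil n σ ⋆[lsmul ℝ ℝ, volume] g) x - g x = ∫ t, dil n σ t • (g (x - t) - g x) := by
    rw [convolution_def]
    have h1 : g x = ∫ t, dil n σ t • g x := by rw [integral_smul_const, hs1, one_smul]
    conv_lhs => rw [h1]
    rw [← integral_sub hex (hi.smul_const _)]
    simp only [ContinuousLinearMap.lsmul_apply, smul_sub]
  rw [heq, ← Real.norm_eq_abs]
  calc ‖∫ t, dil n σ t • (g (x - t) - g x)‖ ≤ ∫ t, dil n σ t * (K * (R / 2 ^ n)) := by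
        refine norm_integral_le_of_norm_le (hi.mul_const _) (Filter.Eventually.of_forall fun t => ?_)
        rw [norm_smul, Real.norm_of_nonneg (h0 t)]
        by_cases ht : dil n σ t = 0
        · simp [ht]
        · gcongr
          · exact h0 t
          · have h2 := hg.dist_le_mul (x - t) x
            rw [dist_eq_norm, dist_eq_norm, sub_sub_cancel_left, norm_neg] at h2
            exact h2.trans (by gcongr; exact norm_le_of_dil_ne_zero hR ht)
    _ = K * (R / 2 ^ n) := by rw [integral_mul_const, hs1, one_mul]

end Mollify

/-- `G` is the weak gradient of `w` in the whole space. -/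
def HasGlobalGradient (w : E3 → E3) (G : E3 → E3 →L[ℝ] E3) : Prop :=
  LocallyIntegrable w volume ∧ LocallyIntegrable G volume ∧
    ∀ φ : E3 → ℝ, ContDiff ℝ ∞ φ → HasCompactSupport φ → ∀ h : E3,
      ∫ x, (fderiv ℝ φ x h) • w x = - ∫ x, φ x • G x h

/-- Mollification commutes with the weak gradient. -/
theorem HasGlobalGradient.fderiv_convolution {w : E3 → E3} {G : E3 → E3 →L[ℝ] E3}
    (hw : HasGlobalGradient w G) {σ : E3 → ℝ} (hσ : ContDiff ℝ ∞ σ) (hσ' : HasCompactSupport σ)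
    (x : E3) :
    fderiv ℝ (σ ⋆[lsmul ℝ ℝ, volume] w) x = (σ ⋆[lsmul ℝ ℝ, volume] G) x := by
  have hd := hσ'.hasFDerivAt_convolution_left (lsmul ℝ ℝ) (hσ.of_le (by simp)) hw.1 x
  rw [hd.fderiv]
  have hexG : ConvolutionExistsAt σ G x (lsmul ℝ ℝ) volume :=
    hσ'.convolutionExists_left _ hσ.continuous hw.2.1 x
  have hexw : ConvolutionExistsAt (fderiv ℝ σ) w x ((lsmul ℝ ℝ).precompL E3) volume :=
    (hσ'.fderiv ℝ).convolutionExists_left _ (hσ.continuous_fderiv (by simp)) hw.1 x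
  ext1 h
  have hφ : ContDiff ℝ ∞ fun t => σ (x - t) := hσ.comp (contDiff_const.sub contDiff_id)
  have hφ' : HasCompactSupport fun t => σ (x - t) :=
    hσ'.comp_homeomorph (Homeomorph.subLeft x)
  have hφd : ∀ t, fderiv ℝ (fun t => σ (x - t)) t h = - fderiv ℝ σ (x - t) h := by
    intro t
    have h1 : HasFDerivAt (fun t : E3 => x - t) (-ContinuousLinearMap.id ℝ E3) t := by
      simpa using (hasFDerivAt_id t).const_sub x
    have h2 := ((hσ.differentiable (by simp)) (x - t)).hasFDerivAt.comp t h1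
    have h3 : fderiv ℝ (fun t => σ (x - t)) t = (fderiv ℝ σ (x - t)).comp (-ContinuousLinearMap.id ℝ E3) :=
      h2.fderiv
    rw [h3]
    simp
  have hparts := hw.2.2 _ hφ hφ' h
  have hL : ((fderiv ℝ σ ⋆[(lsmul ℝ ℝ).precompL E3, volume] w) x) h
      = ∫ t, fderiv ℝ σ (x - t) h • w t := by
    rw [convolution_def, ContinuousLinearMap.integral_apply hexw,
      ← integral_sub_left_eq_self _ volume x]
    refine integral_congr_ae (Filter.Eventually.of_forall fun t => ?_)
    simp
  have hR : ((σ ⋆[lsmul ℝ ℝ, volume] G) x) h = ∫ t, σ (x - t) • G t h := by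
    rw [convolution_def, ContinuousLinearMap.integral_apply hexG,
      ← integral_sub_left_eq_self _ volume x]
    refine integral_congr_ae (Filter.Eventually.of_forall fun t => ?_)
    simp
  rw [hL, hR]
  simp only [hφd, neg_smul, integral_neg, neg_inj] at hparts
  exact hparts

/-! ### A local right inverse of the divergence -/

theorem eq_sum_smul_e (x : E3) : x = ∑ i, x i • e i := by
  ext j
  fin_cases j <;> simp [e, Fin.sum_univ_three]

theorem norm_le_sum_abs (x : E3) : ‖x‖ ≤ ∑ i, |x i| := by
  conv_lhs => rw [eq_sum_smul_e x]
  refine (norm_sum_le _ _).trans (Finset.sum_le_sum fun i _ => ?_)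
  rw [norm_smul, norm_e, mul_one, Real.norm_eq_abs]

theorem abs_apply_le_norm (x : E3) (i : Fin 3) : |x i| ≤ ‖x‖ := PiLp.norm_apply_le x i

theorem norm_le_sum_norm_apply_e {F : Type*} [NormedAddCommGroup F] [NormedSpace ℝ F]
    (A : E3 →L[ℝ] F) : ‖A‖ ≤ ∑ i, ‖A (e i)‖ := by
  refine A.opNorm_le_bound (by positivity) fun x => ?_
  conv_lhs => rw [eq_sum_smul_e x, map_sum]
  rw [Finset.sum_mul]
  refine (norm_sum_le _ _).trans (Finset.sum_le_sum fun i _ => ?_)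
  rw [map_smul, norm_smul, mul_comm]
  gcongr
  exact abs_apply_le_norm x i

theorem norm_le_sum_abs_entries (A : E3 →L[ℝ] E3) :
    ‖A‖ ≤ ∑ p : Fin 3 × Fin 3, |A (e p.1) p.2| := by
  rw [Fintype.sum_prod_type]
  exact (norm_le_sum_norm_apply_e A).trans (Finset.sum_le_sum fun i _ => norm_le_sum_abs _)

/-- The `j`-th component of `A (e_i)`, as a linear functional of the tensor `A`. -/
def entryL (i j : Fin 3) : (E3 →L[ℝ] E3) →L[ℝ] ℝ :=
  (EuclideanSpace.proj j : E3 →L[ℝ] ℝ).comp (ContinuousLinearMap.apply ℝ E3 (e i))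

@[simp] theorem entryL_apply (i j : Fin 3) (A : E3 →L[ℝ] E3) : entryL i j A = A (e i) j := rfl

/-- The trace as a continuous linear functional. -/
def trL : (E3 →L[ℝ] E3) →L[ℝ] ℝ := ∑ i, entryL i i

@[simp] theorem trL_apply (A : E3 →L[ℝ] E3) : trL A = tr A := by
  simp [trL, tr]

/-- The kernel `∑_{n<N} 4ⁿ Θ(2ⁿ x)`. If `div Θ = 8 σ(2 ·) - σ` then its divergence telescopes to
`8ᴺ σ(2ᴺ ·) - σ`, so that convolution with it is, up to smooth terms and in the limit `N → ∞`, a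
right inverse of the divergence. -/
def divKernel (N : ℕ) (Θ : E3 → E3) (x : E3) : E3 :=
  ∑ n ∈ Finset.range N, (4 : ℝ) ^ n • Θ ((2 : ℝ) ^ n • x)

section DivKernel

variable {Θ : E3 → E3} {σ : E3 → ℝ}

theorem contDiff_divKernel (hΘ : ContDiff ℝ ∞ Θ) (N : ℕ) : ContDiff ℝ ∞ (divKernel N Θ) := by
  unfold divKernel
  exact ContDiff.sum fun n _ =>
    (hΘ.comp (contDiff_id.const_smul ((2 : ℝ) ^ n))).const_smul ((4 : ℝ) ^ n)

theorem fderiv_divKernel (hΘ : ContDiff ℝ ∞ Θ) (N : ℕ) (x : E3) :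
    fderiv ℝ (divKernel N Θ) x = dilSum N (fderiv ℝ Θ) x := by
  have h : ∀ n : ℕ, HasFDerivAt (fun x => (4 : ℝ) ^ n • Θ ((2 : ℝ) ^ n • x))
      (dil n (fderiv ℝ Θ) x) x := by
    intro n
    have h1 : HasFDerivAt (fun x : E3 => (2 : ℝ) ^ n • x)
        ((2 : ℝ) ^ n • ContinuousLinearMap.id ℝ E3) x := (hasFDerivAt_id x).fun_const_smul _
    have h2 := (((hΘ.differentiable (by simp)) ((2 : ℝ) ^ n • x)).hasFDerivAt.comp x h1).fun_const_smul
      ((4 : ℝ) ^ n)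
    refine h2.congr_fderiv ?_
    ext1 v
    simp only [dil, _root_.smul_apply, ContinuousLinearMap.comp_apply,
      ContinuousLinearMap.id_apply, map_smul, smul_smul]
    rw [← mul_pow]
    norm_num
  exact (HasFDerivAt.fun_sum fun n _ => h n).fderiv

theorem tr_fderiv_divKernel (hΘ : ContDiff ℝ ∞ Θ)
    (hdiv : ∀ x, tr (fderiv ℝ Θ x) = 8 * σ ((2 : ℝ) • x) - σ x) (N : ℕ) (x : E3) :
    tr (fderiv ℝ (divKernel N Θ) x) = dil N σ x - σ x := by
  rw [fderiv_divKernel hΘ, ← trL_apply, dilSum, map_sum]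
  have h : ∀ n ∈ Finset.range N, trL (dil n (fderiv ℝ Θ) x) = dil (n + 1) σ x - dil n σ x := by
    intro n _
    rw [dil, map_smul, trL_apply, hdiv, smul_smul, dil, dil, pow_succ, pow_succ,
      mul_comm (2 : ℝ) (2 ^ n)]
    simp only [smul_eq_mul]
    ring
  rw [Finset.sum_congr rfl h, Finset.sum_range_sub (fun n => dil n σ x)]
  simp [dil]

theorem tsupport_divKernel_subset {e₀ : E3} {κ r : ℝ} (h : tsupport Θ ⊆ coneSet e₀ κ r) (N : ℕ) :
    tsupport (divKernel N Θ) ⊆ coneSet e₀ κ r := by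
  have hcl : IsClosed (⋃ n ∈ Finset.range N, (fun x : E3 => (2 : ℝ) ^ n • x) ⁻¹' tsupport Θ) :=
    isClosed_biUnion_finset fun n _ => (isClosed_tsupport Θ).preimage (by fun_prop)
  refine (closure_minimal (fun x hx => ?_) hcl).trans fun x hx => ?_
  · by_contra hne
    simp only [mem_iUnion, not_exists] at hne
    refine hx (Finset.sum_eq_zero fun n hn => ?_)
    rw [image_eq_zero_of_notMem_tsupport (hne n hn), smul_zero]
  · simp only [mem_iUnion] at hx
    obtain ⟨n, -, hx⟩ := hx
    obtain ⟨t, a, ht0, htr, ha, hxa⟩ := h hx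
    have h2 : (1 : ℝ) ≤ 2 ^ n := one_le_pow₀ (by norm_num)
    refine ⟨((2 : ℝ) ^ n)⁻¹ * t, a, by positivity, lt_of_le_of_lt ?_ htr, ha, ?_⟩
    · exact mul_le_of_le_one_left ht0.le (inv_le_one_of_one_le₀ h2)
    · rw [mul_smul, ← hxa, smul_smul, inv_mul_cancel₀ (by positivity), one_smul]

theorem hasCompactSupport_divKernel (hΘ : HasCompactSupport Θ) (N : ℕ) :
    HasCompactSupport (divKernel N Θ) := by
  induction N with
  | zero =>
    have : divKernel 0 Θ = 0 := by ext x; simp [divKernel]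
    rw [this]
    exact HasCompactSupport.zero
  | succ N ih =>
    have : divKernel (N + 1) Θ
        = divKernel N Θ + (fun _ : E3 => (4 : ℝ) ^ N) • fun x => Θ ((2 : ℝ) ^ N • x) := by
      ext x; simp [divKernel, Finset.sum_range_succ]
    rw [this]
    exact ih.add (HasCompactSupport.smul_left (hΘ.comp_smul (by positivity)))

end DivKernel

open scoped Pointwise in
theorem tsupport_convolution_subset {F F' F'' : Type*} [NormedAddCommGroup F] [NormedSpace ℝ F]
    [NormedAddCommGroup F'] [NormedSpace ℝ F'] [NormedAddCommGroup F''] [NormedSpace ℝ F'']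
    {L : F →L[ℝ] F' →L[ℝ] F''} {f : E3 → F} {g : E3 → F'} (hf : HasCompactSupport f)
    (hg : HasCompactSupport g) : tsupport (f ⋆[L, volume] g) ⊆ tsupport f + tsupport g :=
  closure_minimal ((support_convolution_subset L).trans
    (add_subset_add (subset_tsupport f) (subset_tsupport g)))
    (hf.isCompact.add hg.isCompact).isClosed

theorem eLpNorm_le_of_lintegral_ofReal_le {f g : E3 → ℝ} {s : ℝ} (hs : 0 < s) {C : ℝ≥0∞}
    (h : ∫⁻ x, ENNReal.ofReal (|f x| ^ s) ≤ C * ∫⁻ x, ENNReal.ofReal (|g x| ^ s)) :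
    eLpNorm f (ENNReal.ofReal s) volume ≤ C ^ (1 / s) * eLpNorm g (ENNReal.ofReal s) volume := by
  have hp0 : ENNReal.ofReal s ≠ 0 := by simpa using hs
  have hf : ∀ f : E3 → ℝ, eLpNorm f (ENNReal.ofReal s) volume
      = (∫⁻ x, ENNReal.ofReal (|f x| ^ s)) ^ (1 / s) := by
    intro f
    rw [eLpNorm_eq_lintegral_rpow_enorm_toReal hp0 ENNReal.ofReal_ne_top,
      ENNReal.toReal_ofReal hs.le]
    congr 1
    refine lintegral_congr fun x => ?_
    rw [← ENNReal.ofReal_rpow_of_nonneg (abs_nonneg _) hs.le, Real.enorm_eq_ofReal_abs]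
  rw [hf f, hf g, ← ENNReal.mul_rpow_of_nonneg _ _ (by positivity)]
  gcongr

theorem integral_fderiv_apply_eq_zero {F : Type*} [NormedAddCommGroup F] [NormedSpace ℝ F]
    {f : E3 → F} (hf : ContDiff ℝ ∞ f) (hf' : HasCompactSupport f) (v : E3) :
    ∫ x, fderiv ℝ f x v = 0 := by
  have hc : Continuous fun x => fderiv ℝ f x v :=
    (hf.continuous_fderiv (by simp)).clm_apply continuous_const
  have hi : Integrable fun x => fderiv ℝ f x v :=
    hc.integrable_of_hasCompactSupport ((hf'.fderiv ℝ).comp_left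
      (g := fun A : E3 →L[ℝ] F => A v) rfl)
  have h := integral_smul_fderiv_eq_neg_fderiv_smul_of_integrable (μ := volume) (𝕜 := ℝ)
    (f := fun _ : E3 => (1 : ℝ)) (g := f) (v := v) (by simp) (by simpa using hi)
    (by simpa using hf.continuous.integrable_of_hasCompactSupport hf')
    (fun _ _ => differentiableAt_const _) (fun x _ => hf.differentiable (by simp) x)
  simpa using h

/-- Near each point of `closure C` there is an approximate right inverse of the divergence with
values in the test fields of `C`, bounded from `L^s` to `W^{1,s}` uniformly in `N`. -/
theorem HasConeAt.exists_approx_right_inverse {C : Set E3} {x₀ : E3} (hC : HasConeAt C x₀) {s : ℝ}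
    (hs : 2 ≤ s) :
    ∃ (δ : ℝ) (σ : E3 → ℝ) (M : ℝ≥0∞), 0 < δ ∧ M ≠ ⊤ ∧ ContDiff ℝ ∞ σ ∧ HasCompactSupport σ ∧
      (∀ x, 0 ≤ σ x) ∧ ∫ x, σ x = 1 ∧
      ∀ (N : ℕ) (g : E3 → ℝ), ContDiff ℝ ∞ g → HasCompactSupport g →
        tsupport g ⊆ closure C ∩ Metric.ball x₀ δ →
        ∃ φ : E3 → E3, IsTest C φ ∧
          (∀ x, tr (fderiv ℝ φ x) = (dil N σ ⋆[lsmul ℝ ℝ, volume] g) x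
            - (σ ⋆[lsmul ℝ ℝ, volume] g) x) ∧
          eLpNorm (fderiv ℝ φ) (ENNReal.ofReal s) volume
            ≤ M * eLpNorm g (ENNReal.ofReal s) volume := by
  obtain ⟨e₀, κ, δ, he, hκ, hδ, hcone⟩ := hC
  obtain ⟨σ, Θ, hσ, hΘ, hσc, hΘc, -, hΘs, hσ0, hσ1, hdiv⟩ := exists_cone_kernel he hκ hδ
  -- the entries of `∇Θ` are kernels of mean zero, to which the singular integral bound applies
  have hψ : ∀ p : Fin 3 × Fin 3, ContDiff ℝ ∞ fun x => fderiv ℝ Θ x (e p.1) p.2 := fun p =>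
    (entryL p.1 p.2).contDiff.comp (hΘ.fderiv_right (m := ∞) (by simp))
  have hψc : ∀ p : Fin 3 × Fin 3, HasCompactSupport fun x => fderiv ℝ Θ x (e p.1) p.2 := fun p =>
    (hΘc.fderiv ℝ).comp_left (g := entryL p.1 p.2) (map_zero _)
  have hψ0 : ∀ p : Fin 3 × Fin 3, ∫ x, fderiv ℝ Θ x (e p.1) p.2 = 0 := by
    intro p
    have hi : Integrable (fderiv ℝ Θ) :=
      (hΘ.continuous_fderiv (by simp)).integrable_of_hasCompactSupport (hΘc.fderiv ℝ)
    have h0 := integral_fderiv_apply_eq_zero hΘ hΘc (e p.1)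
    have h1 : ∫ x, entryL p.1 p.2 (fderiv ℝ Θ x) = (∫ x, fderiv ℝ Θ x (e p.1)) p.2 := by
      rw [ContinuousLinearMap.integral_comp_comm _ hi, entryL_apply,
        ContinuousLinearMap.integral_apply hi]
    rw [h0] at h1
    exact h1
  choose B hB hbound using fun p : Fin 3 × Fin 3 =>
    exists_singular_integral_bound (hψ p) (hψc p) (hψ0 p) hs
  have hs0 : 0 < s := by linarith
  refine ⟨δ, σ, ∑ p, B p ^ (1 / s), hδ, ?_, hσ, hσc, hσ0, hσ1, fun N g hg hgc hgs => ?_⟩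
  · exact ENNReal.sum_ne_top.2 fun p _ => ENNReal.rpow_ne_top_of_nonneg (by positivity) (hB p)
  have hK := contDiff_divKernel hΘ N
  have hKc := hasCompactSupport_divKernel hΘc N
  set φ : E3 → E3 := divKernel N Θ ⋆[(lsmul ℝ ℝ).flip, volume] g with hφ
  have hgl : LocallyIntegrable g volume := hg.continuous.locallyIntegrable
  have hd : ∀ x, fderiv ℝ φ x
      = (fderiv ℝ (divKernel N Θ) ⋆[(lsmul ℝ ℝ).flip, volume] g) x := by
    intro x
    rw [(hKc.hasFDerivAt_convolution_left (lsmul ℝ ℝ).flip (hK.of_le (by simp)) hgl x).fderiv]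
    refine integral_congr_ae (Filter.Eventually.of_forall fun t => ?_)
    ext1 v
    simp
  have hex : ∀ x, Integrable fun t => (lsmul ℝ ℝ).flip (fderiv ℝ (divKernel N Θ) t) (g (x - t)) :=
    fun x => (hKc.fderiv ℝ).convolutionExists_left _ (hK.continuous_fderiv (by simp)) hgl x
  have hL : ∀ (l : (E3 →L[ℝ] E3) →L[ℝ] ℝ) x, l (fderiv ℝ φ x)
      = ((fun t => l (fderiv ℝ (divKernel N Θ) t)) ⋆[lsmul ℝ ℝ, volume] g) x := by
    intro l x
    rw [hd, convolution_def, ← l.integral_comp_comm (hex x), convolution_def]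
    refine integral_congr_ae (Filter.Eventually.of_forall fun t => ?_)
    simp [mul_comm]
  refine ⟨φ, ⟨?_, ?_, ?_⟩, fun x => ?_, ?_⟩
  · exact hKc.contDiff_convolution_left _ hK hgl
  · exact hKc.convolution _ hgc
  · intro x hx
    obtain ⟨z, hz, y, hy, rfl⟩ := tsupport_convolution_subset hKc hgc hx
    change z + y ∈ C
    rw [add_comm]
    exact hcone y (hgs hy).1 (hgs hy).2 z (tsupport_divKernel_subset hΘs N hz)
  · rw [← trL_apply, hL]
    simp only [trL_apply, tr_fderiv_divKernel hΘ hdiv]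
    have h1 : ConvolutionExistsAt (dil N σ) g x (lsmul ℝ ℝ) volume :=
      (hasCompactSupport_dil hσc N).convolutionExists_left _ (contDiff_dil hσ N).continuous hgl x
    have h2 : ConvolutionExistsAt σ g x (lsmul ℝ ℝ) volume :=
      hσc.convolutionExists_left _ hσ.continuous hgl x
    rw [convolution_def, convolution_def, convolution_def, ← integral_sub h1 h2]
    refine integral_congr_ae (Filter.Eventually.of_forall fun t => ?_)
    simp
  · have hent : ∀ p : Fin 3 × Fin 3, (fun x => fderiv ℝ φ x (e p.1) p.2)
        = dilSum N (fun x => fderiv ℝ Θ x (e p.1) p.2) ⋆[lsmul ℝ ℝ, volume] g := by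
      intro p
      ext x
      rw [← entryL_apply, hL]
      congr 1
      ext t
      rw [fderiv_divKernel hΘ, dilSum, map_sum]
      simp [dilSum, dil]
    have hcont : Continuous (fderiv ℝ φ) :=
      (hKc.contDiff_convolution_left (lsmul ℝ ℝ).flip hK hgl).continuous_fderiv (by simp)
    calc eLpNorm (fderiv ℝ φ) (ENNReal.ofReal s) volume
        ≤ eLpNorm (∑ p : Fin 3 × Fin 3, fun x => |fderiv ℝ φ x (e p.1) p.2|)
            (ENNReal.ofReal s) volume := by
          refine eLpNorm_mono_real fun x => ?_
          rw [Finset.sum_apply]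
          exact norm_le_sum_abs_entries _
      _ ≤ ∑ p : Fin 3 × Fin 3, eLpNorm (fun x => |fderiv ℝ φ x (e p.1) p.2|)
            (ENNReal.ofReal s) volume := by
          refine eLpNorm_sum_le (fun p _ => ?_) (by simp; linarith)
          exact (((entryL p.1 p.2).continuous.comp hcont).abs).aestronglyMeasurable
      _ ≤ ∑ p : Fin 3 × Fin 3, B p ^ (1 / s) * eLpNorm g (ENNReal.ofReal s) volume := by
          refine Finset.sum_le_sum fun p _ => ?_
          have h1 : eLpNorm (fun x => |fderiv ℝ φ x (e p.1) p.2|) (ENNReal.ofReal s) volume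
              = eLpNorm (fun x => fderiv ℝ φ x (e p.1) p.2) (ENNReal.ofReal s) volume :=
            eLpNorm_norm (fun x => fderiv ℝ φ x (e p.1) p.2)
          rw [h1, hent p]
          exact eLpNorm_le_of_lintegral_ofReal_le hs0 (hbound p N g hg hgc)
      _ = _ := by rw [Finset.sum_mul]

/-! ### Higher integrability of the pressure -/

theorem enorm_integral_bilin_le {α E F G : Type*} [MeasurableSpace α] {μ : Measure α}
    [NormedAddCommGroup E] [NormedAddCommGroup F] [NormedAddCommGroup G] [NormedSpace ℝ G]
    {p q : ℝ≥0∞} [ENNReal.HolderConjugate p q] {f : α → E} {g : α → F}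
    (hf : AEStronglyMeasurable f μ) (hg : AEStronglyMeasurable g μ) (b : E → F → G) {c : ℝ≥0}
    (h : ∀ x y, ‖b x y‖ ≤ c * ‖x‖ * ‖y‖) :
    ‖∫ x, b (f x) (g x) ∂μ‖ₑ ≤ c * eLpNorm f p μ * eLpNorm g q μ := by
  refine (enorm_integral_le_lintegral_enorm _).trans ?_
  rw [← eLpNorm_one_eq_lintegral_enorm]
  exact eLpNorm_le_eLpNorm_mul_eLpNorm'_of_norm hf hg b c
    (Filter.Eventually.of_forall fun x => h _ _)

theorem enorm_convolution_le {p q : ℝ} (hpq : p.HolderConjugate q) {σ g : E3 → ℝ}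
    (hσ : Continuous σ) (hg : Continuous g) (x : E3) :
    ‖(σ ⋆[lsmul ℝ ℝ, volume] g) x‖ₑ
      ≤ eLpNorm σ (ENNReal.ofReal q) volume * eLpNorm g (ENNReal.ofReal p) volume := by
  have := hpq.symm.ennrealOfReal
  have h := enorm_integral_bilin_le (μ := (volume : Measure E3)) (p := ENNReal.ofReal q)
    (q := ENNReal.ofReal p) (f := σ) (g := fun t => g (x - t)) hσ.aestronglyMeasurable
    (by fun_prop) (fun a b : ℝ => a * b) (c := 1) (fun a b => by simp)
  have h2 : eLpNorm (fun t => g (x - t)) (ENNReal.ofReal p) volume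
      = eLpNorm g (ENNReal.ofReal p) volume :=
    eLpNorm_comp_measurePreserving hg.aestronglyMeasurable
      (Measure.measurePreserving_sub_left volume x)
  rw [h2, ENNReal.coe_one, one_mul] at h
  exact h

/-- A functional bounded by the `L^s`-norm of the gradient of the test field controls, near each
point with the cone property, the pairing with functions in `L^s`. -/
theorem HasConeAt.exists_enorm_integral_le {C : Set E3} {x₀ : E3}
    (hx₀ : HasConeAt C x₀) {s q : ℝ} (hs : 2 ≤ s) (hsq : s.HolderConjugate q) {p : E3 → ℝ}
    (hp : IntegrableOn p C) {M : ℝ≥0∞} (hM : M ≠ ⊤)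
    (hF : ∀ φ : E3 → E3, IsTest C φ →
      ‖∫ x in C, p x * tr (fderiv ℝ φ x)‖ₑ
        ≤ M * eLpNorm (fderiv ℝ φ) (ENNReal.ofReal s) volume) :
    ∃ (δ : ℝ) (M' : ℝ≥0∞), 0 < δ ∧ M' ≠ ⊤ ∧ ∀ g : E3 → ℝ,
      IsTest (C ∩ Metric.ball x₀ δ) g →
        ‖∫ x in C, p x * g x‖ₑ ≤ M' * eLpNorm g (ENNReal.ofReal s) volume := by
  obtain ⟨δ, σ, M₁, hδ, hM₁, hσ, hσc, hσ0, hσ1, hinv⟩ := hx₀.exists_approx_right_inverse hs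
  obtain ⟨R, hR0, hR⟩ := exists_bound_of_hasCompactSupport hσc
  set A := ∫⁻ x in C, ‖p x‖ₑ with hA
  have hAtop : A ≠ ⊤ := hp.2.ne
  set B := eLpNorm σ (ENNReal.ofReal q) volume with hB
  have hBtop : B ≠ ⊤ := (hσ.continuous.memLp_of_hasCompactSupport hσc).eLpNorm_ne_top
  refine ⟨δ, M * M₁ + A * B, hδ, by finiteness, fun g ⟨hg, hgc, hgs⟩ => ?_⟩
  obtain ⟨K, hK⟩ := hg.lipschitzWith_of_hasCompactSupport hgc (by simp)
  have hint : ∀ f : E3 → ℝ, Continuous f → HasCompactSupport f →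
      IntegrableOn (fun x => p x * f x) C := by
    intro f hf hfc
    obtain ⟨c, hc⟩ := hfc.exists_bound_of_continuous hf
    exact hp.mul_bdd hf.aestronglyMeasurable (Filter.Eventually.of_forall hc)
  have hcont : ∀ τ : E3 → ℝ, ContDiff ℝ ∞ τ → HasCompactSupport τ →
      Continuous (τ ⋆[lsmul ℝ ℝ, volume] g) ∧ HasCompactSupport (τ ⋆[lsmul ℝ ℝ, volume] g) :=
    fun τ hτ hτc => ⟨hτc.continuous_convolution_left _ hτ.continuous
      hg.continuous.locallyIntegrable, hτc.convolution _ hgc⟩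
  have hbd : ∀ N, ‖∫ x in C, p x * (dil N σ ⋆[lsmul ℝ ℝ, volume] g) x‖ₑ
      ≤ (M * M₁ + A * B) * eLpNorm g (ENNReal.ofReal s) volume := by
    intro N
    obtain ⟨φ, hφ, htr, hφn⟩ := hinv N g hg hgc fun x hx => ⟨subset_closure (hgs hx).1, (hgs hx).2⟩
    have h1 := hcont _ (contDiff_dil hσ N) (hasCompactSupport_dil hσc N)
    have h2 := hcont _ hσ hσc
    have hsplit : ∫ x in C, p x * (dil N σ ⋆[lsmul ℝ ℝ, volume] g) x
        = (∫ x in C, p x * tr (fderiv ℝ φ x))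
          + ∫ x in C, p x * (σ ⋆[lsmul ℝ ℝ, volume] g) x := by
      simp only [htr, mul_sub]
      rw [integral_sub (hint _ h1.1 h1.2) (hint _ h2.1 h2.2), sub_add_cancel]
    rw [hsplit]
    refine (enorm_add_le _ _).trans ?_
    rw [add_mul]
    refine add_le_add ((hF φ hφ).trans ?_) ?_
    · rw [mul_assoc]
      gcongr
    · refine (enorm_integral_le_lintegral_enorm _).trans ?_
      rw [mul_assoc, hA, ← lintegral_mul_const'' _ hp.1.enorm]
      refine lintegral_mono fun x => ?_
      rw [enorm_mul]
      gcongr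
      exact enorm_convolution_le hsq hσ.continuous hg.continuous x
  -- the right inverse is exact in the limit: the mollifications of `g` converge uniformly
  have hlim : Filter.Tendsto (fun N => ∫ x in C, p x * (dil N σ ⋆[lsmul ℝ ℝ, volume] g) x)
      Filter.atTop (nhds (∫ x in C, p x * g x)) := by
    rw [tendsto_iff_norm_sub_tendsto_zero]
    have h0 := (tendsto_div_two_pow R).const_mul ((∫ x in C, ‖p x‖) * K)
    rw [mul_zero] at h0
    refine squeeze_zero (fun _ => norm_nonneg _) (fun N => ?_) h0
    have h1 := hcont _ (contDiff_dil hσ N) (hasCompactSupport_dil hσc N)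
    rw [← integral_sub (hint _ h1.1 h1.2) (hint _ hg.continuous hgc), mul_assoc,
      ← integral_mul_const]
    refine norm_integral_le_of_norm_le (hp.norm.mul_const _) (Filter.Eventually.of_forall fun x => ?_)
    rw [← mul_sub, norm_mul]
    gcongr
    exact abs_dil_convolution_sub_le hσ hσc hσ0 hσ1 hR hK N x
  exact le_of_tendsto (hlim.enorm) (Filter.Eventually.of_forall hbd)

theorem exists_mollifier : ∃ σ : E3 → ℝ, ContDiff ℝ ∞ σ ∧ HasCompactSupport σ ∧
    (∀ x, 0 ≤ σ x) ∧ ∫ x, σ x = 1 := by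
  let β : ContDiffBump (0 : E3) := ⟨1, 2, one_pos, one_lt_two⟩
  exact ⟨β.normed volume, β.contDiff_normed, β.hasCompactSupport_normed, β.nonneg_normed,
    β.integral_normed⟩

open scoped Pointwise in
theorem eventually_tsupport_dil_convolution_subset {F : Type*} [NormedAddCommGroup F]
    [NormedSpace ℝ F] {σ : E3 → ℝ} (hσ : HasCompactSupport σ) {g : E3 → F} {K U : Set E3}
    (hK : IsCompact K) (hU : IsOpen U) (hKU : K ⊆ U) (hg : Function.support g ⊆ K) :
    ∀ᶠ n in Filter.atTop, tsupport (dil n σ ⋆[lsmul ℝ ℝ, volume] g) ⊆ U := by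
  obtain ⟨R, hR0, hR⟩ := exists_bound_of_hasCompactSupport hσ
  obtain ⟨d, hd, hdU⟩ := hK.exists_cthickening_subset_open hU hKU
  filter_upwards [(tendsto_div_two_pow R).eventually_lt_const hd] with n hn
  refine (closure_minimal ?_ Metric.isClosed_cthickening).trans hdU
  refine (support_convolution_subset _).trans ?_
  rintro _ ⟨z, hz, y, hy, rfl⟩
  refine Metric.mem_cthickening_of_dist_le _ y _ _ (hg hy) ?_
  rw [dist_eq_norm]
  simp only [add_sub_cancel_right]
  exact (norm_le_of_dil_ne_zero hR hz).trans hn.le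

/-- A bound for the pairing with test functions extends to bounded functions with compact
support. -/
theorem enorm_integral_mul_le_of_isTest {U : Set E3} (hU : IsOpen U) {s : ℝ} (hs : 1 ≤ s)
    {p : E3 → ℝ} (hp : IntegrableOn p U) {M : ℝ≥0∞}
    (hF : ∀ g : E3 → ℝ, IsTest U g →
      ‖∫ x in U, p x * g x‖ₑ ≤ M * eLpNorm g (ENNReal.ofReal s) volume)
    {g : E3 → ℝ} (hg : Measurable g) {b : ℝ} (hgb : ∀ x, |g x| ≤ b) {K : Set E3} (hK : IsCompact K)
    (hKU : K ⊆ U) (hgK : Function.support g ⊆ K) :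
    ‖∫ x in U, p x * g x‖ₑ ≤ M * eLpNorm g (ENNReal.ofReal s) volume := by
  obtain ⟨σ, hσ, hσc, hσ0, hσ1⟩ := exists_mollifier
  have hb0 : 0 ≤ b := (abs_nonneg _).trans (hgb 0)
  have hgint : MemLp g (ENNReal.ofReal s) volume := by
    have h1 : MemLp (K.indicator fun _ => b) (ENNReal.ofReal s) (volume : Measure E3) :=
      memLp_indicator_const _ hK.measurableSet _ (Or.inr hK.measure_lt_top.ne)
    refine h1.mono hg.aestronglyMeasurable (Filter.Eventually.of_forall fun x => ?_)
    by_cases hx : x ∈ K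
    · rw [indicator_of_mem hx, Real.norm_eq_abs, Real.norm_of_nonneg hb0]
      exact hgb x
    · rw [Function.notMem_support.1 fun h => hx (hgK h)]
      simp
  have hgl : LocallyIntegrable g volume := hgint.locallyIntegrable (by simpa using hs)
  have hgc : HasCompactSupport g := HasCompactSupport.of_support_subset_isCompact hK hgK
  have hconv := tendsto_eLpNorm_dil_convolution_sub hσ hσc hσ0 hσ1 hs hgint
  have hcont : ∀ n, ContDiff ℝ ∞ (dil n σ ⋆[lsmul ℝ ℝ, volume] g) := fun n =>
    (hasCompactSupport_dil hσc n).contDiff_convolution_left _ (contDiff_dil hσ n) hgl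
  obtain ⟨ns, hns, hae⟩ := (tendstoInMeasure_of_tendsto_eLpNorm (by simp; linarith)
    (fun n => (hcont n).continuous.aestronglyMeasurable) hgint.1 hconv).exists_seq_tendsto_ae
  have hbound : ∀ n x, |(dil n σ ⋆[lsmul ℝ ℝ, volume] g) x| ≤ b := by
    intro n x
    have hi : Integrable (dil n σ) :=
      (contDiff_dil hσ n).continuous.integrable_of_hasCompactSupport (hasCompactSupport_dil hσc n)
    calc |(dil n σ ⋆[lsmul ℝ ℝ, volume] g) x| ≤ ∫ t, dil n σ t * b := by
          rw [← Real.norm_eq_abs]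
          refine norm_integral_le_of_norm_le (hi.mul_const _) (Filter.Eventually.of_forall fun t => ?_)
          have h0 : 0 ≤ dil n σ t := mul_nonneg (by positivity) (hσ0 _)
          rw [ContinuousLinearMap.lsmul_apply, norm_smul, Real.norm_of_nonneg h0]
          exact mul_le_mul_of_nonneg_left (hgb _) h0
      _ = b := by rw [integral_mul_const, integral_dil, hσ1, one_mul]
  have hlim1 : Filter.Tendsto
      (fun n => ∫ x in U, p x * (dil (ns n) σ ⋆[lsmul ℝ ℝ, volume] g) x)
      Filter.atTop (nhds (∫ x in U, p x * g x)) := by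
    refine tendsto_integral_of_dominated_convergence (fun x => ‖p x‖ * b) (fun n => ?_)
      (hp.norm.mul_const _) (fun n => Filter.Eventually.of_forall fun x => ?_) ?_
    · exact hp.1.mul (hcont _).continuous.aestronglyMeasurable
    · rw [norm_mul]
      gcongr
      exact hbound _ _
    · filter_upwards [ae_restrict_of_ae hae] with x hx
      exact hx.const_mul _
  have hlim2 : Filter.Tendsto
      (fun n => eLpNorm (dil (ns n) σ ⋆[lsmul ℝ ℝ, volume] g - g) (ENNReal.ofReal s) volume
        + eLpNorm g (ENNReal.ofReal s) volume)
      Filter.atTop (nhds (eLpNorm g (ENNReal.ofReal s) volume)) := by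
    have h1 := (hconv.comp hns.tendsto_atTop).add_const (eLpNorm g (ENNReal.ofReal s) volume)
    rwa [zero_add] at h1
  by_cases hMtop : M = ⊤
  · by_cases h0 : eLpNorm g (ENNReal.ofReal s) volume = 0
    · rw [eLpNorm_eq_zero_iff hgint.1 (by simp; linarith)] at h0
      have : ∫ x in U, p x * g x = 0 := by
        refine integral_eq_zero_of_ae ?_
        filter_upwards [ae_restrict_of_ae h0] with x hx
        rw [hx]; simp
      simp [this]
    · rw [hMtop, ENNReal.top_mul h0]
      exact le_top
  refine le_of_tendsto_of_tendsto hlim1.enorm (ENNReal.Tendsto.const_mul hlim2 (Or.inr hMtop)) ?_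
  filter_upwards [hns.tendsto_atTop.eventually
    (eventually_tsupport_dil_convolution_subset hσc hK hU hKU hgK)] with n hn
  refine (hF _ ⟨hcont _, (hasCompactSupport_dil hσc _).convolution _ hgc, hn⟩).trans ?_
  gcongr
  have h1 := eLpNorm_add_le (p := ENNReal.ofReal s)
    ((hcont (ns n)).continuous.aestronglyMeasurable.sub hgint.1) hgint.1 (by simpa using hs)
  rwa [sub_add_cancel] at h1

/-- The duality characterization of `L^q`: only test functions are needed. -/
theorem eLpNorm_le_of_enorm_integral_mul_le {U : Set E3} (hU : IsOpen U)
    (hUb : Bornology.IsBounded U) {s q : ℝ} (hsq : s.HolderConjugate q)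
    {p : E3 → ℝ} (hp : IntegrableOn p U) (hp0 : ∀ᵐ x ∂(volume.restrict U), 0 ≤ p x) {M : ℝ≥0∞}
    (hF : ∀ g : E3 → ℝ, IsTest U g →
      ‖∫ x in U, p x * g x‖ₑ ≤ M * eLpNorm g (ENNReal.ofReal s) volume) :
    eLpNorm p (ENNReal.ofReal q) (volume.restrict U) ≤ M := by
  have hs0 := hsq.pos
  have hq0 := hsq.symm.pos
  obtain ⟨F, hFc, hFU, hFun, hFm⟩ := hU.exists_iUnion_isClosed
  have hFcomp : ∀ n, IsCompact (F n) := fun n =>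
    Metric.isCompact_of_isClosed_isBounded (hFc n) (hUb.subset (hFU n))
  obtain ⟨p', hp', hpp'⟩ := id hp.1
  have hp'm : Measurable p' := hp'.measurable
  -- bounded functions with compact support, increasing to the positive part of `p`
  set f : ℕ → E3 → ℝ := fun k => (F k).indicator fun x => min (max (p' x) 0) k with hf
  have hfm : ∀ k, Measurable (f k) := fun k =>
    ((hp'm.max measurable_const).min measurable_const).indicator (hFc k).measurableSet
  have hf0 : ∀ k x, 0 ≤ f k x := fun k x =>
    indicator_nonneg (fun x _ => le_min (le_max_right _ _) (Nat.cast_nonneg k)) x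
  have hfk : ∀ k x, f k x ≤ k := by
    intro k x
    by_cases hx : x ∈ F k
    · simp only [hf, indicator_of_mem hx]; exact min_le_right _ _
    · simp only [hf, indicator_of_notMem hx]; exact Nat.cast_nonneg k
  have hfs : ∀ k, Function.support (f k) ⊆ F k := fun k => support_indicator_subset
  have hq1 : 0 < q - 1 := hsq.symm.sub_one_pos
  have hle : ∀ k, eLpNorm (f k) (ENNReal.ofReal q) (volume.restrict U) ≤ M := by
    intro k
    set I : ℝ≥0∞ := ∫⁻ x, ENNReal.ofReal (f k x ^ q) with hI
    have hItop : I ≠ ⊤ := by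
      have : I ≤ ∫⁻ x in F k, ENNReal.ofReal ((k : ℝ) ^ q) := by
        rw [hI, ← lintegral_indicator (hFc k).measurableSet]
        refine lintegral_mono fun x => ?_
        by_cases hx : x ∈ F k
        · rw [indicator_of_mem hx]
          exact ENNReal.ofReal_le_ofReal (Real.rpow_le_rpow (hf0 k x) (hfk k x) hq0.le)
        · rw [indicator_of_notMem hx, Function.notMem_support.1 fun h => hx (hfs k h),
            Real.zero_rpow hq0.ne', ENNReal.ofReal_zero]
      refine (this.trans_lt ?_).ne
      rw [setLIntegral_const]
      exact ENNReal.mul_lt_top ENNReal.ofReal_lt_top (hFcomp k).measure_lt_top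
    set g : E3 → ℝ := fun x => f k x ^ (q - 1) with hg
    have hgsupp : Function.support g ⊆ F k := by
      intro x hx
      refine hfs k fun h => hx ?_
      simp only [hg, h, Real.zero_rpow hq1.ne']
    have hg0 : ∀ x, 0 ≤ g x := fun x => Real.rpow_nonneg (hf0 k x) _
    have h1 := enorm_integral_mul_le_of_isTest hU hsq.lt.le hp hF
      (g := g) ((hfm k).pow_const _) (b := (k : ℝ) ^ (q - 1)) (fun x => by
        rw [abs_of_nonneg (hg0 x)]
        exact Real.rpow_le_rpow (hf0 k x) (hfk k x) hq1.le) (hFcomp k) (hFU k) hgsupp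
    have h2 : eLpNorm g (ENNReal.ofReal s) volume = I ^ (1 / s) := by
      rw [eLpNorm_eq_lintegral_rpow_enorm_toReal (by simpa using hs0) ENNReal.ofReal_ne_top,
        ENNReal.toReal_ofReal hs0.le]
      congr 1
      refine lintegral_congr fun x => ?_
      rw [Real.enorm_of_nonneg (hg0 x), ENNReal.ofReal_rpow_of_nonneg (hg0 x) hs0.le,
        ← Real.rpow_mul (hf0 k x), hsq.symm.sub_one_mul_conj]
    have hfp : ∀ᵐ x ∂(volume.restrict U), f k x ≤ p x := by
      filter_upwards [hpp', hp0] with x hx hx0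
      by_cases hxk : x ∈ F k
      · simp only [hf, indicator_of_mem hxk, ← hx, max_eq_left hx0]
        exact min_le_left _ _
      · simp only [hf, indicator_of_notMem hxk, hx0]
    have h3 : I ≤ ‖∫ x in U, p x * g x‖ₑ := by
      have hpg : 0 ≤ᵐ[volume.restrict U] fun x => p x * g x := by
        filter_upwards [hp0] with x hx using mul_nonneg hx (hg0 x)
      have hint : IntegrableOn (fun x => p x * g x) U := by
        refine hp.mul_bdd (c := (k : ℝ) ^ (q - 1)) ((hfm k).pow_const _).aestronglyMeasurable
          (Filter.Eventually.of_forall fun x => ?_)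
        rw [Real.norm_of_nonneg (hg0 x)]
        exact Real.rpow_le_rpow (hf0 k x) (hfk k x) hq1.le
      rw [Real.enorm_of_nonneg (integral_nonneg_of_ae hpg),
        ofReal_integral_eq_lintegral_ofReal hint hpg]
      have hIU : I = ∫⁻ x in U, ENNReal.ofReal (f k x ^ q) := by
        rw [hI, ← lintegral_indicator hU.measurableSet]
        refine lintegral_congr fun x => ?_
        by_cases hx : x ∈ U
        · rw [indicator_of_mem hx]
        · rw [indicator_of_notMem hx, Function.notMem_support.1 fun h => hx (hFU k (hfs k h)),
            Real.zero_rpow hq0.ne', ENNReal.ofReal_zero]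
      rw [hIU]
      refine lintegral_mono_ae ?_
      filter_upwards [hfp] with x hx
      refine ENNReal.ofReal_le_ofReal ?_
      have : f k x ^ q = f k x * g x := by
        by_cases h0 : f k x = 0
        · simp [h0, hq0.ne']
        · rw [hg, ← Real.rpow_one_add' (hf0 k x) (by linarith)]
          congr 1; ring
      rw [this]
      exact mul_le_mul_of_nonneg_right hx (hg0 x)
    -- testing with `g = f ^ (q - 1)` gives `‖f‖^q ≤ M ‖f‖^(q - 1)`
    have h4 : I ≤ M * I ^ (1 / s) := h3.trans (h1.trans_eq (by rw [h2]))
    have h5 : eLpNorm (f k) (ENNReal.ofReal q) (volume.restrict U) ≤ I ^ (1 / q) := by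
      rw [eLpNorm_eq_lintegral_rpow_enorm_toReal (by simpa using hq0) ENNReal.ofReal_ne_top,
        ENNReal.toReal_ofReal hq0.le]
      gcongr
      refine (setLIntegral_le_lintegral _ _).trans_eq (lintegral_congr fun x => ?_)
      rw [Real.enorm_of_nonneg (hf0 k x), ENNReal.ofReal_rpow_of_nonneg (hf0 k x) hq0.le]
    refine h5.trans ?_
    by_cases hI0 : I = 0
    · rw [hI0, ENNReal.zero_rpow_of_pos (by positivity)]
      exact zero_le
    · have h6 : I = I ^ (1 / q) * I ^ (1 / s) := by
        rw [← ENNReal.rpow_add _ _ hI0 hItop, one_div, one_div, hsq.symm.inv_add_inv_eq_one,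
          ENNReal.rpow_one]
      have h7 : I ^ (1 / s) ≠ 0 := by
        simp [ENNReal.rpow_eq_zero_iff, hI0, hItop]
      have h8 : I ^ (1 / s) ≠ ⊤ := ENNReal.rpow_ne_top_of_nonneg (by positivity) hItop
      conv_lhs at h4 => rw [h6]
      exact (ENNReal.mul_le_mul_iff_left h7 h8).1 h4
  have hlim : ∀ᵐ x ∂(volume.restrict U), Filter.Tendsto (fun k => f k x) Filter.atTop
      (nhds (p x)) := by
    filter_upwards [hpp', hp0, ae_restrict_mem hU.measurableSet] with x hx hx0 hxU
    rw [← hFun] at hxU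
    obtain ⟨k₀, hk₀⟩ := mem_iUnion.1 hxU
    obtain ⟨k₁, hk₁⟩ := exists_nat_ge (p x)
    refine tendsto_const_nhds.congr' ?_
    filter_upwards [Filter.eventually_ge_atTop (max k₀ k₁)] with k hk
    have hxk : x ∈ F k := hFm ((le_max_left _ _).trans hk) hk₀
    have hk' : (k₁ : ℝ) ≤ k := by exact_mod_cast (le_max_right _ _).trans hk
    simp only [hf, indicator_of_mem hxk, ← hx, max_eq_left hx0]
    rw [min_eq_left (hk₁.trans hk')]
  refine (Lp.eLpNorm_lim_le_liminf_eLpNorm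
    (fun k => (hfm k).aestronglyMeasurable) p hlim).trans ?_
  exact Filter.liminf_le_of_le (by isBoundedDefault) fun b hb =>
    (hb.exists.choose_spec).trans (hle _)

/-- Estimating the pressure by testing with right inverses of the divergence: if the functional
`φ ↦ ∫ p div φ` is bounded by the `L^s`-norm of the gradient, then `p` lies in the dual space. -/
theorem memLp_of_enorm_integral_mul_tr_le {C : Set E3} (hC : IsOpen C)
    (hCb : Bornology.IsBounded C) (hcone : ∀ x ∈ closure C, HasConeAt C x) {s q : ℝ} (hs : 2 ≤ s)
    (hsq : s.HolderConjugate q) {p : E3 → ℝ} (hp : IntegrableOn p C)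
    (hp0 : ∀ᵐ x ∂(volume.restrict C), 0 ≤ p x) {M : ℝ≥0∞} (hM : M ≠ ⊤)
    (hF : ∀ φ : E3 → E3, IsTest C φ →
      ‖∫ x in C, p x * tr (fderiv ℝ φ x)‖ₑ
        ≤ M * eLpNorm (fderiv ℝ φ) (ENNReal.ofReal s) volume) :
    MemLp p (ENNReal.ofReal q) (volume.restrict C) := by
  have hq0 := hsq.symm.pos
  refine ⟨hp.1, ?_⟩
  rw [eLpNorm_lt_top_iff_lintegral_rpow_enorm_lt_top (by simpa using hq0) ENNReal.ofReal_ne_top,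
    ENNReal.toReal_ofReal hq0.le]
  suffices h : ∫⁻ x in C ∩ closure C, ‖p x‖ₑ ^ q < ⊤ by
    rwa [inter_eq_left.2 subset_closure] at h
  -- by compactness, local integrability at the points of the closure suffices
  refine hCb.isCompact_closure.induction_on
    (p := fun t => ∫⁻ x in C ∩ t, ‖p x‖ₑ ^ q < ⊤) (by simp) (fun t t' htt' ht' => ?_)
    (fun t t' ht ht' => ?_) fun x₀ hx₀ => ?_
  · exact (lintegral_mono_set (inter_subset_inter_right _ htt')).trans_lt ht'
  · rw [inter_union_distrib_left]
    exact (lintegral_union_le _ _ _).trans_lt (ENNReal.add_lt_top.2 ⟨ht, ht'⟩)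
  · obtain ⟨δ, M', hδ, hM', hbound⟩ := (hcone x₀ hx₀).exists_enorm_integral_le hs hsq hp hM hF
    refine ⟨Metric.ball x₀ δ, mem_nhdsWithin_of_mem_nhds (Metric.ball_mem_nhds _ hδ), ?_⟩
    have hsub : C ∩ Metric.ball x₀ δ ⊆ C := inter_subset_left
    have h1 := eLpNorm_le_of_enorm_integral_mul_le (hC.inter Metric.isOpen_ball)
      (hCb.subset hsub) hsq (hp.mono_set hsub) (ae_restrict_of_ae_restrict_of_subset hsub hp0)
      (M := M') (fun g hg => by
        refine le_trans (le_of_eq ?_) (hbound g hg)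
        congr 1
        refine (setIntegral_eq_of_subset_of_forall_sdiff_eq_zero hC.measurableSet hsub
          fun x hx => ?_).symm
        rw [image_eq_zero_of_notMem_tsupport fun h => hx.2 (hg.2.2 h), mul_zero])
    have h2 := h1.trans_lt (lt_top_iff_ne_top.2 hM')
    rwa [eLpNorm_lt_top_iff_lintegral_rpow_enorm_lt_top (by simpa using hq0)
      ENNReal.ofReal_ne_top, ENNReal.toReal_ofReal hq0.le] at h2

/-! ### Extension by zero and approximation by test fields -/

theorem exists_cutoff {K U : Set E3} (hK : IsCompact K) (hU : IsOpen U) (hKU : K ⊆ U) :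
    ∃ χ : E3 → ℝ, IsTest U χ ∧ ∀ x ∈ K, χ x = 1 := by
  obtain ⟨K', hK', hKK', hK'U⟩ := exists_compact_between hK hU hKU
  obtain ⟨f, hf1, hf0, -⟩ := exists_contMDiffMap_one_nhds_of_subset_interior
    (modelWithCornersSelf ℝ E3) (n := (⊤ : ℕ∞)) hK.isClosed hKK'
  have hsub : tsupport f ⊆ K' := closure_minimal (fun x hx => by
    by_contra h
    exact hx (hf0 x h)) hK'.isClosed
  exact ⟨f, ⟨f.contMDiff.contDiff, hK'.of_isClosed_subset (isClosed_tsupport _) hsub,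
    hsub.trans hK'U⟩, fun x hx => hf1.self_of_nhdsSet x hx⟩

theorem locallyIntegrable_indicator {F : Type*} [NormedAddCommGroup F] {C : Set E3}
    (hC : MeasurableSet C) {f : E3 → F} (h : IntegrableOn f C) :
    LocallyIntegrable (C.indicator f) volume :=
  (h.integrable_indicator hC).locallyIntegrable

theorem memLp_fun_add {F : Type*} [NormedAddCommGroup F] {f g : E3 → F} {p : ℝ≥0∞}
    (hf : MemLp f p volume) (hg : MemLp g p volume) : MemLp (fun x => f x + g x) p volume :=
  hf.add hg

theorem integrable_smul_of_hasCompactSupport {F : Type*} [NormedAddCommGroup F] [NormedSpace ℝ F]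
    {w : E3 → F} (hw : LocallyIntegrable w volume) {f : E3 → ℝ} (hf : Continuous f)
    (hf' : HasCompactSupport f) : Integrable fun x => f x • w x :=
  hw.integrable_smul_left_of_hasCompactSupport hf hf'

theorem continuous_fderiv_apply {F : Type*} [NormedAddCommGroup F] [NormedSpace ℝ F] {f : E3 → F}
    (hf : ContDiff ℝ ∞ f) (h : E3) : Continuous fun x => fderiv ℝ f x h :=
  (hf.continuous_fderiv (by simp)).clm_apply continuous_const

theorem hasCompactSupport_fderiv_apply {F : Type*} [NormedAddCommGroup F] [NormedSpace ℝ F]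
    {f : E3 → F} (hf : HasCompactSupport f) (h : E3) :
    HasCompactSupport fun x => fderiv ℝ f x h :=
  (hf.fderiv ℝ).comp_left (g := fun A : E3 →L[ℝ] F => A h) rfl

theorem fderiv_eq_zero_of_notMem_tsupport {F : Type*} [NormedAddCommGroup F] [NormedSpace ℝ F]
    {f : E3 → F} {x : E3} (hx : x ∉ tsupport f) : fderiv ℝ f x = 0 :=
  image_eq_zero_of_notMem_tsupport fun h => hx (tsupport_fderiv_subset ℝ h)

theorem IsTest.add {F : Type*} [NormedAddCommGroup F] [NormedSpace ℝ F] {Ω : Set E3}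
    {f g : E3 → F} (hf : IsTest Ω f) (hg : IsTest Ω g) : IsTest Ω (f + g) :=
  ⟨hf.1.add hg.1, hf.2.1.add hg.2.1,
    (tsupport_add f g).trans (union_subset hf.2.2 hg.2.2)⟩

theorem IsTest.sum {ι F : Type*} [NormedAddCommGroup F] [NormedSpace ℝ F] {Ω : Set E3}
    (t : Finset ι) {f : ι → E3 → F} (hf : ∀ i ∈ t, IsTest Ω (f i)) :
    IsTest Ω (∑ i ∈ t, f i) := by
  classical
  induction t using Finset.induction_on with
  | empty =>
    refine ⟨contDiff_const, HasCompactSupport.zero, ?_⟩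
    rw [Finset.sum_empty, tsupport_zero]
    exact empty_subset _
  | insert i t hi ih =>
    rw [Finset.sum_insert hi]
    exact (hf i (Finset.mem_insert_self i t)).add
      (ih fun j hj => hf j (Finset.mem_insert_of_mem hj))

/-- If `w` vanishes on an open set, so does its weak gradient. -/
theorem HasWeakGradient.ae_eq_zero {S O : Set E3} {w : E3 → E3} {G : E3 → E3 →L[ℝ] E3}
    (h : HasWeakGradient S w G) (hO : IsOpen O) (hOS : O ⊆ S)
    (hw : ∀ᵐ x ∂volume, x ∈ O → w x = 0) :
    ∀ᵐ x ∂volume, x ∈ O → G x = 0 := by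
  have hi : ∀ i : Fin 3, ∀ᵐ x ∂volume, x ∈ O → G x (e i) = 0 := by
    intro i
    have hloc : LocallyIntegrableOn (fun x => G x (e i)) O volume := by
      intro x hx
      obtain ⟨u, hu, hi⟩ := (h.2.1.mono_set hOS) x hx
      exact ⟨u, hu, hi.apply_continuousLinearMap (e i)⟩
    refine hO.ae_eq_zero_of_integral_contDiff_smul_eq_zero hloc fun φ hφ hφc hφs => ?_
    have h1 := h.2.2 φ ⟨hφ, hφc, hφs.trans hOS⟩ (e i)
    have h2 : ∫ x in S, fderiv ℝ φ x (e i) • w x = 0 := by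
      refine integral_eq_zero_of_ae (ae_restrict_of_ae ?_)
      filter_upwards [hw] with x hx
      by_cases hxO : x ∈ O
      · rw [hx hxO, smul_zero]; rfl
      · rw [fderiv_eq_zero_of_notMem_tsupport fun hxs => hxO (hφs hxs)]
        simp
    rw [h2, eq_comm, neg_eq_zero] at h1
    rw [← h1]
    refine (setIntegral_eq_integral_of_forall_compl_eq_zero fun x hx => ?_).symm
    rw [image_eq_zero_of_notMem_tsupport fun hxs => hx (hOS (hφs hxs)), zero_smul]
  filter_upwards [ae_all_iff.2 hi] with x hx hxO
  ext1 v
  rw [eq_sum_smul_e v]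
  simp [hx _ hxO]

theorem HasWeakGradient.ae_eq_zero_sdiff {S C : Set E3} {w : E3 → E3}
    {G : E3 → E3 →L[ℝ] E3} (h : HasWeakGradient S w G) (hS : IsOpen S) (hC : IsOpen C)
    (hfr : volume (frontier C) = 0) (hw : ∀ᵐ x ∂volume, x ∈ S \ C → w x = 0) :
    ∀ᵐ x ∂volume, x ∈ S \ C → G x = 0 := by
  have h1 := h.ae_eq_zero (O := S \ closure C) (hS.sdiff isClosed_closure)
    sdiff_subset (hw.mono fun x hx hxO => hx ⟨hxO.1, fun hxC => hxO.2 (subset_closure hxC)⟩)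
  have h2 : ∀ᵐ x ∂volume, x ∉ frontier C := measure_eq_zero_iff_ae_notMem.1 hfr
  filter_upwards [h1, h2] with x hx hxf hxS
  refine hx ⟨hxS.1, fun hxc => hxf ?_⟩
  rw [hC.frontier_eq]
  exact ⟨hxc, hxS.2⟩

theorem setIntegral_smul_eq_integral_indicator {F : Type*} [NormedAddCommGroup F] [NormedSpace ℝ F]
    {S C : Set E3} (hS : MeasurableSet S) (hCS : C ⊆ S) {w : E3 → F}
    (hw : ∀ᵐ x ∂volume, x ∈ S \ C → w x = 0) {a b : E3 → ℝ} (hab : ∀ x ∈ C, a x = b x) :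
    ∫ x in S, a x • w x = ∫ x, b x • C.indicator w x := by
  rw [← integral_indicator hS]
  refine integral_congr_ae ?_
  filter_upwards [hw] with x hx
  by_cases hxC : x ∈ C
  · rw [indicator_of_mem (hCS hxC), indicator_of_mem hxC, hab x hxC]
  · rw [indicator_of_notMem hxC, smul_zero]
    by_cases hxS : x ∈ S
    · rw [indicator_of_mem hxS, hx ⟨hxS, hxC⟩, smul_zero]
    · rw [indicator_of_notMem hxS]

/-- A Sobolev function on `S` that vanishes on `S \ C` is still one after extension by zero. -/
theorem HasWeakGradient.hasGlobalGradient_indicator {S C : Set E3} {w : E3 → E3}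
    {G : E3 → E3 →L[ℝ] E3} (h : HasWeakGradient S w G) (hS : IsOpen S) (hC : IsOpen C)
    (hCb : Bornology.IsBounded C) (hCS : closure C ⊆ S) (hfr : volume (frontier C) = 0)
    (hw : ∀ᵐ x ∂volume, x ∈ S \ C → w x = 0) :
    HasGlobalGradient (C.indicator w) (C.indicator G) := by
  have hK : IsCompact (closure C) := hCb.isCompact_closure
  have hwi : IntegrableOn w C :=
    (h.1.integrableOn_compact_subset hCS hK).mono_set subset_closure
  have hGi : IntegrableOn G C :=
    (h.2.1.integrableOn_compact_subset hCS hK).mono_set subset_closure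
  have hG0 := h.ae_eq_zero_sdiff hS hC hfr hw
  refine ⟨locallyIntegrable_indicator hC.measurableSet hwi,
    locallyIntegrable_indicator hC.measurableSet hGi, fun φ hφ hφc v => ?_⟩
  obtain ⟨χ, ⟨hχ, hχc, hχs⟩, hχ1⟩ := exists_cutoff hK hS hCS
  have h1 := h.2.2 (fun x => χ x * φ x) ⟨hχ.mul hφ, hχc.mul_right,
    (tsupport_mul_subset_left).trans hχs⟩ v
  have hderiv : ∀ x ∈ C, fderiv ℝ (fun x => χ x * φ x) x = fderiv ℝ φ x := by
    intro x hx
    refine Filter.EventuallyEq.fderiv_eq ?_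
    filter_upwards [hC.mem_nhds hx] with y hy
    rw [hχ1 y (subset_closure hy), one_mul]
  have hL : ∫ x in S, fderiv ℝ (fun x => χ x * φ x) x v • w x
      = ∫ x, fderiv ℝ φ x v • C.indicator w x :=
    setIntegral_smul_eq_integral_indicator hS.measurableSet (subset_closure.trans hCS) hw
      fun x hx => by rw [hderiv x hx]
  have hR : ∫ x in S, (χ x * φ x) • G x v = ∫ x, φ x • C.indicator (fun x => G x v) x :=
    setIntegral_smul_eq_integral_indicator hS.measurableSet (subset_closure.trans hCS)
      (hG0.mono fun x hx hxS => by rw [hx hxS]; rfl)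
      fun x hx => by rw [hχ1 x (subset_closure hx), one_mul]
  have hev : ∀ x, C.indicator (fun x => G x v) x = C.indicator G x v := by
    intro x
    by_cases hx : x ∈ C
    · rw [indicator_of_mem hx, indicator_of_mem hx]
    · rw [indicator_of_notMem hx, indicator_of_notMem hx]; rfl
  simp only [hev] at hR
  exact hL.symm.trans (h1.trans (congrArg Neg.neg hR))

theorem aestronglyMeasurable_smulRight {μ : Measure E3} {f : E3 → E3 →L[ℝ] ℝ} {w : E3 → E3}
    (hf : AEStronglyMeasurable f μ) (hw : AEStronglyMeasurable w μ) :
    AEStronglyMeasurable (fun x => (f x).smulRight (w x)) μ :=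
  (ContinuousLinearMap.smulRightL ℝ E3 E3).aestronglyMeasurable_comp₂ hf hw

/-- The product rule for a smooth cutoff and a weakly differentiable field. -/
theorem HasGlobalGradient.smul {w : E3 → E3} {G : E3 → E3 →L[ℝ] E3} (h : HasGlobalGradient w G)
    {χ : E3 → ℝ} (hχ : ContDiff ℝ ∞ χ) :
    HasGlobalGradient (fun x => χ x • w x)
      (fun x => χ x • G x + (fderiv ℝ χ x).smulRight (w x)) := by
  have hdχ : Continuous (fderiv ℝ χ) := hχ.continuous_fderiv (by simp)
  have h1 : LocallyIntegrable (fun x => χ x • w x) volume := h.1.continuous_smul hχ.continuous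
  have h2 : LocallyIntegrable (fun x => χ x • G x) volume := h.2.1.continuous_smul hχ.continuous
  have h3 : LocallyIntegrable (fun x => (fderiv ℝ χ x).smulRight (w x)) volume := by
    rw [locallyIntegrable_iff]
    intro k hk
    obtain ⟨c, hc⟩ := hk.exists_bound_of_continuousOn hdχ.continuousOn
    have hwk : IntegrableOn w k volume := h.1.integrableOn_isCompact hk
    refine (hwk.norm.const_mul c).mono' (aestronglyMeasurable_smulRight
      hdχ.aestronglyMeasurable hwk.1) ?_
    filter_upwards [ae_restrict_mem hk.measurableSet] with x hx
    rw [ContinuousLinearMap.norm_smulRight_apply]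
    gcongr
    exact hc x hx
  refine ⟨h1, LocallyIntegrable.add (f := fun x => χ x • G x)
    (g := fun x => (fderiv ℝ χ x).smulRight (w x)) h2 h3, fun φ hφ hφc v => ?_⟩
  have hp := h.2.2 (fun x => χ x * φ x) (hχ.mul hφ) hφc.mul_left v
  have hd : ∀ x, fderiv ℝ (fun x => χ x * φ x) x v
      = χ x * fderiv ℝ φ x v + φ x * fderiv ℝ χ x v := by
    intro x
    rw [fderiv_fun_mul (hχ.differentiable (by simp) x) (hφ.differentiable (by simp) x)]
    simp
  have hdφ := continuous_fderiv_apply hφ v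
  have hdφc := hasCompactSupport_fderiv_apply hφc v
  have i1 : Integrable fun x => (χ x * fderiv ℝ φ x v) • w x :=
    integrable_smul_of_hasCompactSupport h.1 (hχ.continuous.mul hdφ) hdφc.mul_left
  have i2 : Integrable fun x => (φ x * fderiv ℝ χ x v) • w x :=
    integrable_smul_of_hasCompactSupport h.1 (hφ.continuous.mul (continuous_fderiv_apply hχ v)) hφc.mul_right
  have i3 : Integrable fun x => (χ x * φ x) • G x v :=
    (integrable_smul_of_hasCompactSupport h.2.1 (hχ.continuous.mul hφ.continuous)
      hφc.mul_left).apply_continuousLinearMap v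
  have hl : ∫ x, fderiv ℝ φ x v • χ x • w x
      = (∫ x, fderiv ℝ (fun x => χ x * φ x) x v • w x) - ∫ x, (φ x * fderiv ℝ χ x v) • w x := by
    rw [← integral_sub _ i2]
    · refine integral_congr_ae (Filter.Eventually.of_forall fun x => ?_)
      simp only [hd, add_smul, add_sub_cancel_right, smul_smul, mul_comm]
    · simp only [hd, add_smul]
      exact i1.add i2
  have hr : ∫ x, φ x • (χ x • G x + (fderiv ℝ χ x).smulRight (w x)) v
      = (∫ x, (χ x * φ x) • G x v) + ∫ x, (φ x * fderiv ℝ χ x v) • w x := by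
    rw [← integral_add i3 i2]
    refine integral_congr_ae (Filter.Eventually.of_forall fun x => ?_)
    simp [smul_smul, mul_comm]
  rw [hl, hr, hp]
  abel

theorem tsupport_dil_subset_coneSet {e₀ : E3} {κ r : ℝ} {σ : E3 → ℝ}
    (h : tsupport σ ⊆ coneSet e₀ κ r) (n : ℕ) : tsupport (dil n σ) ⊆ coneSet e₀ κ r := by
  have hcl : IsClosed ((fun x : E3 => (2 : ℝ) ^ n • x) ⁻¹' tsupport σ) :=
    (isClosed_tsupport σ).preimage (by fun_prop)
  refine (closure_minimal (fun x hx => ?_) hcl).trans fun x hx => ?_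
  · by_contra hne
    refine hx ?_
    rw [dil, image_eq_zero_of_notMem_tsupport hne, smul_zero]
  · obtain ⟨t, a, ht0, htr, ha, hxa⟩ := h hx
    have h2 : (1 : ℝ) ≤ 2 ^ n := one_le_pow₀ (by norm_num)
    refine ⟨((2 : ℝ) ^ n)⁻¹ * t, a, by positivity, lt_of_le_of_lt ?_ htr, ha, ?_⟩
    · exact mul_le_of_le_one_left ht0.le (inv_le_one_of_one_le₀ h2)
    · have hxa' : (2 : ℝ) ^ n • x = t • a := hxa
      rw [mul_smul, ← hxa', smul_smul, inv_mul_cancel₀ (by positivity), one_smul]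

/-- In a domain with the cone property, a Sobolev function whose extension by zero is again
Sobolev is a limit of test fields: mollify it locally with kernels supported in the cones. -/
theorem exists_isTest_tendsto {C : Set E3} (hC : IsOpen C)
    (hCb : Bornology.IsBounded C) (hcone : ∀ x ∈ closure C, HasConeAt C x) {s : ℝ} (hs : 1 ≤ s)
    {w : E3 → E3} {G : E3 → E3 →L[ℝ] E3} (hG : HasGlobalGradient w G)
    (hw0 : ∀ x ∉ C, w x = 0) (hG0 : ∀ x ∉ C, G x = 0)
    (hws : MemLp w (ENNReal.ofReal s) volume) (hGs : MemLp G (ENNReal.ofReal s) volume) :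
    ∃ φ : ℕ → E3 → E3, (∀ n, IsTest C (φ n)) ∧
      Filter.Tendsto (fun n => eLpNorm (φ n - w) (ENNReal.ofReal s) volume) Filter.atTop (nhds 0) ∧
      Filter.Tendsto (fun n => eLpNorm (fderiv ℝ (φ n) - G) (ENNReal.ofReal s) volume)
        Filter.atTop (nhds 0) := by
  have hK : IsCompact (closure C) := hCb.isCompact_closure
  choose! e₀ κ δ he hκ hδ hcn using hcone
  obtain ⟨t, ht, htcov⟩ := hK.elim_nhds_subcover (fun x => Metric.ball x (δ x))
    fun x hx => Metric.ball_mem_nhds x (hδ x hx)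
  obtain ⟨f, hf⟩ := SmoothPartitionOfUnity.exists_isSubordinate (modelWithCornersSelf ℝ E3)
    (isClosed_closure (s := C)) (fun i : t => Metric.ball (i : E3) (δ i))
    (fun i => Metric.isOpen_ball) (by
      intro x hx
      obtain ⟨y, hy, hxy⟩ := mem_iUnion₂.1 (htcov hx)
      exact mem_iUnion.2 ⟨⟨y, hy⟩, hxy⟩)
  have hfc : ∀ i, ContDiff ℝ ∞ (f i) := fun i => (f i).contMDiff.contDiff
  have hfcomp : ∀ i, HasCompactSupport (f i) := fun i =>
    (isCompact_closedBall (i : E3) (δ i)).of_isClosed_subset (isClosed_tsupport _)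
      ((hf i).trans Metric.ball_subset_closedBall)
  have hf1 : ∀ x ∈ closure C, ∑ i, f i x = 1 := by
    intro x hx
    rw [← finsum_eq_sum_of_fintype]
    exact f.sum_eq_one hx
  -- the pieces of `w` and their weak gradients
  set W : t → E3 → E3 := fun i x => f i x • w x with hW
  set D : t → E3 → E3 →L[ℝ] E3 := fun i x => f i x • G x + (fderiv ℝ (f i) x).smulRight (w x)
    with hD
  have hWsum : ∑ i, W i = w := by
    ext1 x
    simp only [Finset.sum_apply, hW, ← Finset.sum_smul]
    by_cases hx : x ∈ C
    · rw [hf1 x (subset_closure hx), one_smul]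
    · rw [hw0 x hx, smul_zero]
  have hDsum : ∑ i, D i = G := by
    ext1 x
    simp only [Finset.sum_apply, hD, Finset.sum_add_distrib, ← Finset.sum_smul]
    by_cases hx : x ∈ C
    · have h0 : ∑ i, fderiv ℝ (f i) x = 0 := by
        rw [← fderiv_fun_sum fun i _ => (hfc i).differentiable (by simp) x]
        have : (fun y => ∑ i, f i y) =ᶠ[nhds x] fun _ => (1 : ℝ) := by
          filter_upwards [hC.mem_nhds hx] with y hy using hf1 y (subset_closure hy)
        rw [this.fderiv_eq, fderiv_fun_const]
        rfl
      have h1 : ∑ i, (fderiv ℝ (f i) x).smulRight (w x) = 0 := by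
        ext1 v
        rw [_root_.sum_apply]
        simp only [ContinuousLinearMap.smulRight_apply, ← Finset.sum_smul]
        rw [← _root_.sum_apply, h0]
        simp
      rw [hf1 x (subset_closure hx), one_smul, h1, add_zero]
    · rw [hw0 x hx, hG0 x hx, smul_zero, zero_add]
      refine Finset.sum_eq_zero fun i _ => ?_
      ext1 v
      simp
  have hWg : ∀ i, HasGlobalGradient (W i) (D i) := fun i => hG.smul (hfc i)
  have hbf : ∀ i, ∃ c, ∀ x, ‖f i x‖ ≤ c := fun i =>
    (hfcomp i).exists_bound_of_continuous (hfc i).continuous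
  have hbdf : ∀ i, ∃ c, ∀ x, ‖fderiv ℝ (f i) x‖ ≤ c := fun i =>
    ((hfcomp i).fderiv ℝ).exists_bound_of_continuous ((hfc i).continuous_fderiv (by simp))
  have hWs : ∀ i, MemLp (W i) (ENNReal.ofReal s) volume := by
    intro i
    obtain ⟨c, hc⟩ := hbf i
    refine hws.of_le_mul (c := c) ((hfc i).continuous.aestronglyMeasurable.smul hws.1)
      (Filter.Eventually.of_forall fun x => ?_)
    rw [norm_smul]
    gcongr
    exact hc x
  have hDs : ∀ i, MemLp (D i) (ENNReal.ofReal s) volume := by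
    intro i
    obtain ⟨c, hc⟩ := hbf i
    obtain ⟨c', hc'⟩ := hbdf i
    have a1 : MemLp (fun x => f i x • G x) (ENNReal.ofReal s) volume := by
      refine hGs.of_le_mul (c := c) ((hfc i).continuous.aestronglyMeasurable.smul hGs.1)
        (Filter.Eventually.of_forall fun x => ?_)
      rw [norm_smul]
      gcongr
      exact hc x
    have a2 : MemLp (fun x => (fderiv ℝ (f i) x).smulRight (w x)) (ENNReal.ofReal s) volume := by
      refine hws.of_le_mul (c := c') (aestronglyMeasurable_smulRight
        ((hfc i).continuous_fderiv (by simp)).aestronglyMeasurable hws.1)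
        (Filter.Eventually.of_forall fun x => ?_)
      rw [ContinuousLinearMap.norm_smulRight_apply]
      gcongr
      exact hc' x
    exact memLp_fun_add a1 a2
  -- the mollifier for each piece pushes its support into `C`
  choose σ Θ hσ hΘ hσc hΘc hσs hΘs hσ0 hσ1 hdiv using fun i : t =>
    exists_cone_kernel (he i (ht i i.2)) (hκ i (ht i i.2)) (hδ i (ht i i.2))
  set φ : ℕ → E3 → E3 := fun n => ∑ i, (dil n (σ i) ⋆[lsmul ℝ ℝ, volume] W i) with hφ
  have hterm : ∀ i n, IsTest C (dil n (σ i) ⋆[lsmul ℝ ℝ, volume] W i) := by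
    intro i n
    have hWsub : tsupport (W i) ⊆ closure C ∩ tsupport (f i) := by
      refine closure_minimal (fun x hx => ⟨?_, ?_⟩) (isClosed_closure.inter (isClosed_tsupport _))
      · by_contra hxC
        exact hx (by simp only [hW, hw0 x fun h => hxC (subset_closure h), smul_zero])
      · by_contra hxf
        exact hx (by simp only [hW, image_eq_zero_of_notMem_tsupport hxf, zero_smul])
    have hWc : HasCompactSupport (W i) :=
      hK.of_isClosed_subset (isClosed_tsupport _) (hWsub.trans inter_subset_left)
    refine ⟨(hasCompactSupport_dil (hσc i) n).contDiff_convolution_left _ (contDiff_dil (hσ i) n)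
      (hWg i).1, (hasCompactSupport_dil (hσc i) n).convolution _ hWc, fun x hx => ?_⟩
    obtain ⟨z, hz, y, hy, rfl⟩ :=
      tsupport_convolution_subset (hasCompactSupport_dil (hσc i) n) hWc hx
    change z + y ∈ C
    rw [add_comm]
    exact hcn i (ht i i.2) y (hWsub hy).1 (hf i (hWsub hy).2) z
      (tsupport_dil_subset_coneSet (hσs i) n hz)
  have hfd : ∀ n, fderiv ℝ (φ n) = ∑ i, (dil n (σ i) ⋆[lsmul ℝ ℝ, volume] D i) := by
    intro n
    ext1 x
    rw [hφ]
    simp only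
    rw [fderiv_sum fun i _ => (hterm i n).1.differentiable (by simp) x, Finset.sum_apply]
    exact Finset.sum_congr rfl fun i _ => (hWg i).fderiv_convolution (contDiff_dil (hσ i) n)
      (hasCompactSupport_dil (hσc i) n) x
  have hsumlim : ∀ {F : Type} [NormedAddCommGroup F] [NormedSpace ℝ F] [CompleteSpace F]
      (V : t → E3 → F), (∀ i, MemLp (V i) (ENNReal.ofReal s) volume) →
      Filter.Tendsto (fun n => eLpNorm ((∑ i, (dil n (σ i) ⋆[lsmul ℝ ℝ, volume] V i)) - ∑ i, V i)
        (ENNReal.ofReal s) volume) Filter.atTop (nhds 0) := by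
    intro F _ _ _ V hV
    have h0 : Filter.Tendsto (fun n => ∑ i, eLpNorm ((dil n (σ i) ⋆[lsmul ℝ ℝ, volume] V i) - V i)
        (ENNReal.ofReal s) volume) Filter.atTop (nhds (∑ i : t, 0)) :=
      tendsto_finsetSum _ fun i _ =>
        tendsto_eLpNorm_dil_convolution_sub (hσ i) (hσc i) (hσ0 i) (hσ1 i) hs (hV i)
    rw [Finset.sum_const_zero] at h0
    refine tendsto_of_tendsto_of_tendsto_of_le_of_le tendsto_const_nhds h0 (fun _ => zero_le)
      fun n => ?_
    simp only
    rw [← Finset.sum_sub_distrib]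
    refine eLpNorm_sum_le (fun i _ => ?_) (by simpa using hs)
    refine AEStronglyMeasurable.sub ?_ (hV i).1
    exact ((hasCompactSupport_dil (hσc i) n).continuous_convolution_left _
      (contDiff_dil (hσ i) n).continuous
      ((hV i).locallyIntegrable (by simpa using hs))).aestronglyMeasurable
  refine ⟨φ, fun n => IsTest.sum _ fun i _ => hterm i n, ?_, ?_⟩
  · have h1 := hsumlim W hWs
    rwa [hWsum] at h1
  · have h1 := hsumlim D hDs
    rw [hDsum] at h1
    simpa only [hfd] using h1

/-! ### Sobolev inequalities -/

theorem eLpNorm_eq_eLpNorm_restrict {F : Type*} [NormedAddCommGroup F] {C : Set E3}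
    (hC : MeasurableSet C) {f : E3 → F} (hf : ∀ x ∉ C, f x = 0) (p : ℝ≥0∞) :
    eLpNorm f p volume = eLpNorm f p (volume.restrict C) := by
  rw [← eLpNorm_indicator_eq_eLpNorm_restrict hC]
  congr 1
  ext1 x
  by_cases hx : x ∈ C
  · rw [indicator_of_mem hx]
  · rw [indicator_of_notMem hx, hf x hx]

/-- The Gagliardo–Nirenberg–Sobolev inequality on a bounded set, for every exponent up to the
critical one. -/
theorem exists_eLpNorm_le_of_lt_three {C : Set E3} (hCm : MeasurableSet C)
    (hCb : Bornology.IsBounded C) {p r s : ℝ}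
    (hp : 1 ≤ p) (hp3 : p < 3) (hr : 0 < r) (hpr : p⁻¹ - 3⁻¹ ≤ r⁻¹) (hps : p ≤ s) :
    ∃ K : ℝ≥0∞, K ≠ ⊤ ∧ ∀ φ : E3 → E3, IsTest C φ →
      eLpNorm φ (ENNReal.ofReal r) volume
        ≤ K * eLpNorm (fderiv ℝ φ) (ENNReal.ofReal s) volume := by
  have hp0 : 0 < p := by linarith
  have hs0 : 0 < s := by linarith
  have hvol : volume C ≠ ⊤ := hCb.measure_lt_top.ne
  have hfr : (Module.finrank ℝ E3 : ℝ) = 3 := by simp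
  refine ⟨eLpNormLESNormFDerivOfLeConst E3 (volume : Measure E3) C (p.toNNReal) (r.toNNReal)
    * volume C ^ (1 / p - 1 / s), ENNReal.mul_ne_top ENNReal.coe_ne_top
      (ENNReal.rpow_ne_top_of_nonneg (by
        rw [sub_nonneg]; gcongr) hvol), fun φ ⟨hφ, hφc, hφs⟩ => ?_⟩
  have h1 := eLpNorm_le_eLpNorm_fderiv_of_le (volume : Measure E3) (u := φ) (s := C)
    (hφ.of_le (by simp)) ((subset_tsupport φ).trans hφs) (p := p.toNNReal) (q := r.toNNReal)
    (by rwa [Real.one_le_toNNReal])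
    (by rw [← NNReal.coe_lt_coe, Real.coe_toNNReal _ hp0.le]; simpa using hp3)
    (by rw [hfr, NNReal.coe_inv, Real.coe_toNNReal _ hp0.le, Real.coe_toNNReal _ hr.le]; exact hpr) hCb
  have h2 : eLpNorm (fderiv ℝ φ) (ENNReal.ofReal p) volume
      ≤ eLpNorm (fderiv ℝ φ) (ENNReal.ofReal s) volume * volume C ^ (1 / p - 1 / s) := by
    rw [eLpNorm_eq_eLpNorm_restrict hCm fun x hx =>
      fderiv_eq_zero_of_notMem_tsupport fun h => hx (hφs h)]
    refine (eLpNorm_le_eLpNorm_mul_rpow_measure_univ (ENNReal.ofReal_le_ofReal hps)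
      (hφ.continuous_fderiv (by simp)).aestronglyMeasurable).trans ?_
    rw [Measure.restrict_apply_univ, ENNReal.toReal_ofReal hp0.le, ENNReal.toReal_ofReal hs0.le]
    gcongr
    exact Measure.restrict_le_self
  refine h1.trans ?_
  rw [mul_assoc, mul_comm (volume C ^ _)]
  gcongr
  exact h2

theorem exists_poincare {C : Set E3} (hCm : MeasurableSet C)
    (hCb : Bornology.IsBounded C) {s : ℝ} (hs : 2 ≤ s) :
    ∃ K : ℝ≥0∞, K ≠ ⊤ ∧ ∀ φ : E3 → E3, IsTest C φ →
      eLpNorm φ (ENNReal.ofReal s) volume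
        ≤ K * eLpNorm (fderiv ℝ φ) (ENNReal.ofReal s) volume := by
  have h3 : 0 < 3 + s := by linarith
  refine exists_eLpNorm_le_of_lt_three hCm hCb (p := 3 * s / (3 + s)) ?_ ?_ (by linarith) ?_ ?_
  · rw [le_div_iff₀ h3]; linarith
  · rw [div_lt_iff₀ h3]; linarith
  · have : s ≠ 0 := by linarith
    apply le_of_eq
    field_simp
    ring
  · rw [div_le_iff₀ h3]; nlinarith

theorem eLpNorm_scaled_le {Θ : E3 → E3} {R B : ℝ} (hR0 : 0 ≤ R) (hB0 : 0 ≤ B)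
    (hR : ∀ x, Θ x ≠ 0 → ‖x‖ ≤ R) (hB : ∀ x, ‖Θ x‖ ≤ B) {q : ℝ} (hq : 0 < q) (n : ℕ) :
    eLpNorm (fun x => (4 : ℝ) ^ n • Θ ((2 : ℝ) ^ n • x)) (ENNReal.ofReal q) volume
      ≤ ENNReal.ofReal ((4 * 8 ^ (-1 / q)) ^ n) * (ENNReal.ofReal B
        * volume (Metric.closedBall (0 : E3) R) ^ (1 / q)) := by
  have hq0 : ENNReal.ofReal q ≠ 0 := by simpa using hq
  have h2 : (0 : ℝ) < 2 ^ n := by positivity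
  have h1 : eLpNorm (fun x => (4 : ℝ) ^ n • Θ ((2 : ℝ) ^ n • x)) (ENNReal.ofReal q) volume
      ≤ eLpNorm ((Metric.closedBall (0 : E3) (((2 : ℝ) ^ n)⁻¹ * R)).indicator
        fun _ => (4 : ℝ) ^ n * B) (ENNReal.ofReal q) volume := by
    refine eLpNorm_mono fun x => ?_
    by_cases hx : Θ ((2 : ℝ) ^ n • x) = 0
    · rw [hx, smul_zero, norm_zero]
      exact norm_nonneg _
    · have hn := hR _ hx
      rw [norm_smul, Real.norm_of_nonneg h2.le] at hn
      rw [indicator_of_mem (by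
        rw [mem_closedBall_zero_iff, ← div_eq_inv_mul, le_div_iff₀ h2]; linarith),
        norm_smul, Real.norm_of_nonneg (by positivity : (0 : ℝ) ≤ 4 ^ n),
        Real.norm_of_nonneg (by positivity : (0 : ℝ) ≤ 4 ^ n * B)]
      gcongr
      exact hB _
  refine h1.trans_eq ?_
  rw [eLpNorm_indicator_const measurableSet_closedBall hq0 ENNReal.ofReal_ne_top,
    ENNReal.toReal_ofReal hq.le, Measure.addHaar_closedBall_mul _ _ (by positivity),
    finrank_euclideanSpace_fin, ENNReal.mul_rpow_of_nonneg _ _ (by positivity),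
    ENNReal.ofReal_rpow_of_nonneg (by positivity) (by positivity),
    Real.enorm_of_nonneg (by positivity), ENNReal.ofReal_mul (by positivity)]
  have h8 : ((((2 : ℝ) ^ n)⁻¹) ^ 3) ^ (1 / q) = (8 ^ (-1 / q)) ^ n := by
    rw [← inv_pow, ← pow_mul, mul_comm n 3, pow_mul, ← Real.rpow_natCast,
      ← Real.rpow_natCast (8 ^ (-1 / q)) n, ← Real.rpow_mul (by positivity),
      ← Real.rpow_mul (by norm_num), show ((2 : ℝ)⁻¹ ^ 3) = 8 ^ (-1 : ℝ) by
        rw [Real.rpow_neg_one]; norm_num, ← Real.rpow_mul (by norm_num)]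
    congr 1
    ring
  · rw [h8, mul_pow, ENNReal.ofReal_mul (by positivity)]
    ring
  · exact hR0

/-- The kernels are of the size `|x|⁻²`, uniformly in `N`, and therefore in `L^q` for `q < 3/2`. -/
theorem exists_eLpNorm_divKernel_le {Θ : E3 → E3} (hΘ : ContDiff ℝ ∞ Θ) (hΘc : HasCompactSupport Θ)
    {q : ℝ} (hq1 : 1 ≤ q) (hq : q < 3 / 2) :
    ∃ B : ℝ≥0∞, B ≠ ⊤ ∧ ∀ N, eLpNorm (divKernel N Θ) (ENNReal.ofReal q) volume ≤ B := by
  obtain ⟨R, hR0, hR⟩ := exists_bound_of_hasCompactSupport hΘc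
  obtain ⟨B, hB⟩ := hΘc.exists_bound_of_continuous hΘ.continuous
  have hB0 : 0 ≤ B := (norm_nonneg _).trans (hB 0)
  have hq0 : 0 < q := by linarith
  set ϑ : ℝ := 4 * 8 ^ (-1 / q) with hϑ
  have hϑ0 : 0 ≤ ϑ := by positivity
  have hϑ1 : ϑ < 1 := by
    have h8 : (8 : ℝ) ^ (-1 / q) < 8 ^ (-(2 / 3) : ℝ) := by
      refine Real.rpow_lt_rpow_of_exponent_lt (by norm_num) ?_
      rw [div_lt_iff₀ hq0]
      linarith
    have h4 : (8 : ℝ) ^ (-(2 / 3) : ℝ) = 1 / 4 := by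
      rw [show (8 : ℝ) = 2 ^ (3 : ℝ) by norm_num, ← Real.rpow_mul (by norm_num),
        show (3 : ℝ) * -(2 / 3) = -2 by norm_num, Real.rpow_neg (by norm_num)]
      norm_num
    rw [hϑ]
    linarith
  set V : ℝ≥0∞ := ENNReal.ofReal B * volume (Metric.closedBall (0 : E3) R) ^ (1 / q) with hV
  have hVtop : V ≠ ⊤ := ENNReal.mul_ne_top ENNReal.ofReal_ne_top
    (ENNReal.rpow_ne_top_of_nonneg (by positivity) measure_closedBall_lt_top.ne)
  refine ⟨ENNReal.ofReal (1 - ϑ)⁻¹ * V, ENNReal.mul_ne_top ENNReal.ofReal_ne_top hVtop,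
    fun N => ?_⟩
  calc eLpNorm (divKernel N Θ) (ENNReal.ofReal q) volume
      ≤ ∑ n ∈ Finset.range N,
          eLpNorm (fun x => (4 : ℝ) ^ n • Θ ((2 : ℝ) ^ n • x)) (ENNReal.ofReal q) volume := by
        have h : divKernel N Θ = ∑ n ∈ Finset.range N,
            fun x => (4 : ℝ) ^ n • Θ ((2 : ℝ) ^ n • x) := by
          ext1 x
          rw [Finset.sum_apply]
          rfl
        rw [h]
        refine eLpNorm_sum_le (fun n _ => ?_) (by simpa using hq1)
        have hc : Continuous fun x => (4 : ℝ) ^ n • Θ ((2 : ℝ) ^ n • x) :=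
          Continuous.fun_const_smul (hΘ.continuous.comp
            (by fun_prop : Continuous fun x : E3 => (2 : ℝ) ^ n • x)) _
        exact hc.aestronglyMeasurable
    _ ≤ ∑ n ∈ Finset.range N, ENNReal.ofReal (ϑ ^ n) * V :=
        Finset.sum_le_sum fun n _ => eLpNorm_scaled_le hR0.le hB0 hR hB hq0 n
    _ ≤ ENNReal.ofReal (1 - ϑ)⁻¹ * V := by
        rw [← Finset.sum_mul, ← ENNReal.ofReal_sum_of_nonneg fun n _ => pow_nonneg hϑ0 n]
        gcongr
        rw [← tsum_geometric_of_lt_one hϑ0 hϑ1]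
        exact (summable_geometric_of_lt_one hϑ0 hϑ1).sum_le_tsum _ fun n _ => pow_nonneg hϑ0 n

theorem integral_tr_fderiv_mul {K : E3 → E3} (hK : ContDiff ℝ ∞ K) (hKc : HasCompactSupport K)
    {g : E3 → ℝ} (hg : ContDiff ℝ ∞ g) (x : E3) :
    ∫ t, tr (fderiv ℝ K t) * g (x - t) = ∫ t, fderiv ℝ g (x - t) (K t) := by
  have hh : ContDiff ℝ ∞ fun t => g (x - t) := hg.comp (contDiff_const.sub contDiff_id)
  have hhd : ∀ t v, fderiv ℝ (fun t => g (x - t)) t v = - fderiv ℝ g (x - t) v := by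
    intro t v
    have h1 : HasFDerivAt (fun t : E3 => x - t) (-ContinuousLinearMap.id ℝ E3) t := by
      simpa using (hasFDerivAt_id t).const_sub x
    have h2 := ((hg.differentiable (by simp)) (x - t)).hasFDerivAt.comp t h1
    have h3 : fderiv ℝ (fun t => g (x - t)) t
      = (fderiv ℝ g (x - t)).comp (-ContinuousLinearMap.id ℝ E3) := h2.fderiv
    rw [h3]
    simp
  have hKi : ∀ i : Fin 3, ContDiff ℝ ∞ fun t => K t i := fun i =>
    (EuclideanSpace.proj i : E3 →L[ℝ] ℝ).contDiff.comp hK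
  have hKic : ∀ i : Fin 3, HasCompactSupport fun t => K t i := fun i =>
    hKc.comp_left (g := fun v : E3 => v i) rfl
  have hKd : ∀ i t, fderiv ℝ (fun t => K t i) t (e i) = fderiv ℝ K t (e i) i := by
    intro i t
    have h := ((EuclideanSpace.proj i : E3 →L[ℝ] ℝ).hasFDerivAt).comp t
      (hK.differentiable (by simp) t).hasFDerivAt
    have h' : fderiv ℝ (fun t => K t i) t = _ := h.fderiv
    rw [h']
    rfl
  have hcd : ∀ i, Continuous fun t => fderiv ℝ (fun t => g (x - t)) t (e i) := fun i =>
    continuous_fderiv_apply hh (e i)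
  have hi1 : ∀ i : Fin 3, Integrable fun t => fderiv ℝ (fun t => K t i) t (e i) * g (x - t) :=
    fun i => ((continuous_fderiv_apply (hKi i) (e i)).mul
      hh.continuous).integrable_of_hasCompactSupport
      (hasCompactSupport_fderiv_apply (hKic i) (e i)).mul_right
  have hi2 : ∀ i : Fin 3, Integrable fun t => K t i * fderiv ℝ (fun t => g (x - t)) t (e i) :=
    fun i => ((hKi i).continuous.mul (hcd i)).integrable_of_hasCompactSupport (hKic i).mul_right
  have hparts : ∀ i : Fin 3, ∫ t, fderiv ℝ (fun t => K t i) t (e i) * g (x - t)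
      = ∫ t, - (K t i * fderiv ℝ (fun t => g (x - t)) t (e i)) := by
    intro i
    have h := integral_mul_fderiv_eq_neg_fderiv_mul_of_integrable (μ := volume) (𝕜 := ℝ)
      (f := fun t => K t i) (g := fun t => g (x - t)) (v := e i) (hi1 i) (hi2 i)
      (((hKi i).continuous.mul hh.continuous).integrable_of_hasCompactSupport (hKic i).mul_right)
      (fun t _ => (hKi i).differentiable (by simp) t)
      (fun t _ => hh.differentiable (by simp) t)
    rw [integral_neg, h, neg_neg]
  have hL : ∀ t, tr (fderiv ℝ K t) * g (x - t)
      = ∑ i, fderiv ℝ (fun t => K t i) t (e i) * g (x - t) := by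
    intro t
    rw [tr, Finset.sum_mul]
    simp only [hKd]
  have hR : ∀ t, fderiv ℝ g (x - t) (K t)
      = ∑ i, - (K t i * fderiv ℝ (fun t => g (x - t)) t (e i)) := by
    intro t
    conv_lhs => rw [eq_sum_smul_e (K t), map_sum]
    simp [hhd]
  simp only [hL, hR]
  rw [integral_finsetSum _ fun i _ => hi1 i, integral_finsetSum (f := fun i t => - (K t i * fderiv ℝ (fun t => g (x - t)) t (e i))) _
      fun i _ => (hi2 i).neg]
  exact Finset.sum_congr rfl fun i _ => hparts i

/-- Morrey's bound. The function is the sum of a mollification and of the convolution of its gradient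
with `divKernel`, which lies in the dual of `L^s`. -/
theorem exists_enorm_le_of_three_lt {s : ℝ} (hs : 3 < s) :
    ∃ K : ℝ≥0∞, K ≠ ⊤ ∧ ∀ g : E3 → ℝ, ContDiff ℝ ∞ g → HasCompactSupport g → ∀ x,
      ‖g x‖ₑ ≤ K * (eLpNorm g (ENNReal.ofReal s) volume
        + eLpNorm (fderiv ℝ g) (ENNReal.ofReal s) volume) := by
  obtain ⟨σ, Θ, hσ, hΘ, hσc, hΘc, -, -, hσ0, hσ1, hdiv⟩ :=
    exists_cone_kernel (norm_e 0) one_pos one_pos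
  have hsq := Real.HolderConjugate.conjExponent (show 1 < s by linarith)
  set q := s.conjExponent with hq
  have hq32 : q < 3 / 2 := by
    rw [hq, Real.conjExponent, div_lt_iff₀ (by linarith)]
    linarith
  obtain ⟨B, hB, hKB⟩ := exists_eLpNorm_divKernel_le hΘ hΘc hsq.symm.lt.le hq32
  set A := eLpNorm σ (ENNReal.ofReal q) volume with hA
  have hAtop : A ≠ ⊤ := (hσ.continuous.memLp_of_hasCompactSupport hσc).eLpNorm_ne_top
  obtain ⟨R, hR0, hR⟩ := exists_bound_of_hasCompactSupport hσc
  refine ⟨A + B, by finiteness, fun g hg hgc x => ?_⟩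
  obtain ⟨L, hL⟩ := hg.lipschitzWith_of_hasCompactSupport hgc (by simp)
  have hgl : LocallyIntegrable g volume := hg.continuous.locallyIntegrable
  have hlim : Filter.Tendsto (fun N => (dil N σ ⋆[lsmul ℝ ℝ, volume] g) x) Filter.atTop
      (nhds (g x)) := by
    rw [tendsto_iff_norm_sub_tendsto_zero]
    have h0 := (tendsto_div_two_pow R).const_mul (L : ℝ)
    rw [mul_zero] at h0
    exact squeeze_zero (fun _ => norm_nonneg _)
      (fun N => abs_dil_convolution_sub_le hσ hσc hσ0 hσ1 hR hL N x) h0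
  refine le_of_tendsto hlim.enorm (Filter.Eventually.of_forall fun N => ?_)
  have hK := contDiff_divKernel hΘ N
  have hKc := hasCompactSupport_divKernel hΘc N
  have heq : (dil N σ ⋆[lsmul ℝ ℝ, volume] g) x
      = (σ ⋆[lsmul ℝ ℝ, volume] g) x + ∫ t, fderiv ℝ g (x - t) (divKernel N Θ t) := by
    rw [← integral_tr_fderiv_mul hK hKc hg]
    simp only [tr_fderiv_divKernel hΘ hdiv]
    have h1 : ConvolutionExistsAt (dil N σ) g x (lsmul ℝ ℝ) volume :=
      (hasCompactSupport_dil hσc N).convolutionExists_left _ (contDiff_dil hσ N).continuous hgl x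
    have h2 : ConvolutionExistsAt σ g x (lsmul ℝ ℝ) volume :=
      hσc.convolutionExists_left _ hσ.continuous hgl x
    rw [convolution_def, convolution_def, ← sub_eq_iff_eq_add', ← integral_sub h1 h2]
    refine integral_congr_ae (Filter.Eventually.of_forall fun t => ?_)
    simp [sub_mul]
  rw [heq]
  refine (enorm_add_le _ _).trans ?_
  have hc := enorm_convolution_le hsq hσ.continuous hg.continuous x
  have := hsq.symm.ennrealOfReal
  have hd := enorm_integral_bilin_le (μ := (volume : Measure E3)) (p := ENNReal.ofReal q)
    (q := ENNReal.ofReal s) (f := divKernel N Θ) (g := fun t => fderiv ℝ g (x - t))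
    hK.continuous.aestronglyMeasurable
    ((hg.continuous_fderiv (by simp)).comp (by fun_prop : Continuous fun t => x - t)).aestronglyMeasurable
    (fun (a : E3) (b : E3 →L[ℝ] ℝ) => b a) (c := 1) (fun a b => by
      rw [NNReal.coe_one, one_mul, mul_comm]; exact b.le_opNorm a)
  have h2 : eLpNorm (fun t => fderiv ℝ g (x - t)) (ENNReal.ofReal s) volume
      = eLpNorm (fderiv ℝ g) (ENNReal.ofReal s) volume :=
    eLpNorm_comp_measurePreserving (hg.continuous_fderiv (by simp)).aestronglyMeasurable
      (Measure.measurePreserving_sub_left volume x)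
  rw [h2, ENNReal.coe_one, one_mul] at hd
  calc _ ≤ A * eLpNorm g (ENNReal.ofReal s) volume
        + B * eLpNorm (fderiv ℝ g) (ENNReal.ofReal s) volume := by
        refine add_le_add hc (hd.trans ?_)
        gcongr
        exact hKB N
    _ ≤ _ := by
        rw [mul_add]
        gcongr
        · exact le_self_add
        · exact le_add_self

theorem exists_eLpNorm_top_le {C : Set E3} (hCm : MeasurableSet C)
    (hCb : Bornology.IsBounded C) {s : ℝ} (hs : 3 < s) :
    ∃ K : ℝ≥0∞, K ≠ ⊤ ∧ ∀ φ : E3 → E3, IsTest C φ →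
      eLpNorm φ ⊤ volume ≤ K * eLpNorm (fderiv ℝ φ) (ENNReal.ofReal s) volume := by
  obtain ⟨K, hK, hsup⟩ := exists_enorm_le_of_three_lt hs
  obtain ⟨K', hK', hpoin⟩ := exists_poincare hCm hCb (s := s) (by linarith)
  refine ⟨3 * (K * (K' + 1)), by finiteness, fun φ hφ => ?_⟩
  have hcomp : ∀ j : Fin 3, ∀ x, ‖φ x j‖ₑ
      ≤ K * (K' + 1) * eLpNorm (fderiv ℝ φ) (ENNReal.ofReal s) volume := by
    intro j x
    have hc : ContDiff ℝ ∞ fun t => φ t j :=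
      (EuclideanSpace.proj j : E3 →L[ℝ] ℝ).contDiff.comp hφ.1
    have hcc : HasCompactSupport fun t => φ t j :=
      hφ.2.1.comp_left (g := fun v : E3 => v j) rfl
    refine (hsup _ hc hcc x).trans ?_
    rw [mul_assoc, add_mul, one_mul]
    gcongr
    · refine le_trans (eLpNorm_mono fun t => ?_) (hpoin φ hφ)
      exact PiLp.norm_apply_le _ _
    · refine eLpNorm_mono fun t => ?_
      have h := ((EuclideanSpace.proj j : E3 →L[ℝ] ℝ).hasFDerivAt).comp t
        (hφ.1.differentiable (by simp) t).hasFDerivAt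
      have h' : fderiv ℝ (fun t => φ t j) t = _ := h.fderiv
      rw [h']
      refine ContinuousLinearMap.opNorm_le_bound _ (norm_nonneg _) fun v => ?_
      exact (PiLp.norm_apply_le _ _).trans ((fderiv ℝ φ t).le_opNorm v)
  rw [eLpNorm_exponent_top]
  refine eLpNormEssSup_le_of_ae_enorm_bound (Filter.Eventually.of_forall fun x => ?_)
  have h1 : ‖φ x‖ₑ ≤ ∑ j, ‖φ x j‖ₑ := by
    have h := norm_le_sum_abs (φ x)
    rw [← ofReal_norm]
    refine (ENNReal.ofReal_le_ofReal h).trans_eq ?_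
    rw [ENNReal.ofReal_sum_of_nonneg fun _ _ => abs_nonneg _]
    simp only [Real.enorm_eq_ofReal_abs]
  refine h1.trans ((Finset.sum_le_sum fun j _ => hcomp j x).trans_eq ?_)
  simp [mul_assoc]

/-! ### Exponents and limits -/

/-- The Sobolev exponent `r` belonging to the integrability exponent `s` of the velocity gradient
makes the trilinear form `∫ ρ v ⊗ u : ∇φ` meaningful: `1/γ + 2/r + 1/s ≤ 1`. -/
theorem IsVelocityExponent.exists_sobolev {γ s : ℝ} (hγ : 1 < γ) (h : IsVelocityExponent γ s)
    {C : Set E3} (hCm : MeasurableSet C) (hCb : Bornology.IsBounded C) :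
    2 ≤ s ∧ ∃ r : ℝ≥0∞, 1 ≤ r ∧ (ENNReal.ofReal γ)⁻¹ + r⁻¹ + r⁻¹ + (ENNReal.ofReal s)⁻¹ ≤ 1 ∧
      ∃ K : ℝ≥0∞, K ≠ ⊤ ∧ ∀ φ : E3 → E3, IsTest C φ →
        eLpNorm φ r volume ≤ K * eLpNorm (fderiv ℝ φ) (ENNReal.ofReal s) volume := by
  have hγ0 : 0 < γ := by linarith
  -- the two regimes: `W^{1,s}` embeds into `L^{3s/(3-s)}` or into `L^∞`
  have hlow : 2 ≤ s → s < 3 → γ⁻¹ + 3 * s⁻¹ ≤ 5 / 3 → 2 ≤ s ∧ ∃ r : ℝ≥0∞, 1 ≤ r ∧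
      (ENNReal.ofReal γ)⁻¹ + r⁻¹ + r⁻¹ + (ENNReal.ofReal s)⁻¹ ≤ 1 ∧
      ∃ K : ℝ≥0∞, K ≠ ⊤ ∧ ∀ φ : E3 → E3, IsTest C φ →
        eLpNorm φ r volume ≤ K * eLpNorm (fderiv ℝ φ) (ENNReal.ofReal s) volume := by
    intro hs2 hs3 hγs
    have hs0 : 0 < s := by linarith
    have h3s : 0 < 3 - s := by linarith
    have hinv : (3 * s / (3 - s))⁻¹ = s⁻¹ - 3⁻¹ := by field_simp
    refine ⟨hs2, ENNReal.ofReal (3 * s / (3 - s)), ?_, ?_, ?_⟩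
    · rw [← ENNReal.ofReal_one]
      refine ENNReal.ofReal_le_ofReal ?_
      rw [le_div_iff₀ h3s]; linarith
    · have hr0 : 0 < 3 * s / (3 - s) := by positivity
      have hp : 0 ≤ (3 * s / (3 - s))⁻¹ := by positivity
      rw [← ENNReal.ofReal_inv_of_pos hγ0, ← ENNReal.ofReal_inv_of_pos hr0,
        ← ENNReal.ofReal_inv_of_pos hs0, ← ENNReal.ofReal_add (by positivity) hp,
        ← ENNReal.ofReal_add (by positivity) hp, ← ENNReal.ofReal_add (by positivity) (by positivity),
        ← ENNReal.ofReal_one]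
      refine ENNReal.ofReal_le_ofReal ?_
      rw [hinv]
      linarith
    · exact exists_eLpNorm_le_of_lt_three hCm hCb (by linarith) hs3 (by positivity) hinv.ge le_rfl
  have hhigh : 3 < s → γ⁻¹ + s⁻¹ ≤ 1 → 2 ≤ s ∧ ∃ r : ℝ≥0∞, 1 ≤ r ∧
      (ENNReal.ofReal γ)⁻¹ + r⁻¹ + r⁻¹ + (ENNReal.ofReal s)⁻¹ ≤ 1 ∧
      ∃ K : ℝ≥0∞, K ≠ ⊤ ∧ ∀ φ : E3 → E3, IsTest C φ →
        eLpNorm φ r volume ≤ K * eLpNorm (fderiv ℝ φ) (ENNReal.ofReal s) volume := by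
    intro hs3 hγs
    have hs0 : 0 < s := by linarith
    refine ⟨by linarith, ⊤, le_top, ?_, exists_eLpNorm_top_le hCm hCb hs3⟩
    rw [ENNReal.inv_top, add_zero, add_zero, ← ENNReal.ofReal_inv_of_pos hγ0,
      ← ENNReal.ofReal_inv_of_pos hs0, ← ENNReal.ofReal_add (by positivity) (by positivity),
      ← ENNReal.ofReal_one]
    exact ENNReal.ofReal_le_ofReal hγs
  rcases h with ⟨h6, rfl⟩ | ⟨h1, h2, rfl⟩ | ⟨rfl, h3⟩ | ⟨h1, rfl⟩
  · have h3 : 0 < 3 + γ := by linarith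
    refine hlow ?_ ?_ ?_
    · rw [le_div_iff₀ h3]; linarith
    · rw [div_lt_iff₀ h3]; linarith
    · have : γ⁻¹ ≤ 6⁻¹ := by gcongr
      have hi : (3 * γ / (3 + γ))⁻¹ = γ⁻¹ + 3⁻¹ := by field_simp
      rw [hi]
      linarith
  · have h3 : 0 < 5 * γ - 3 := by linarith
    refine hlow ?_ ?_ ?_
    · rw [le_div_iff₀ h3]; linarith
    · rw [div_lt_iff₀ h3]; linarith
    · have hi : (9 * γ / (5 * γ - 3))⁻¹ = 5 / 9 - 3⁻¹ * γ⁻¹ := by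
        rw [inv_div]
        field_simp
        ring
      rw [hi]
      linarith
  · refine hhigh h3 ?_
    have : s⁻¹ ≤ 3⁻¹ := by gcongr
    norm_num at this ⊢
    linarith
  · have h3 : 0 < γ - 1 := by linarith
    refine hhigh ?_ ?_
    · rw [lt_div_iff₀ h3]; linarith
    · have hi : (γ / (γ - 1))⁻¹ = 1 - γ⁻¹ := by field_simp
      rw [hi]
      linarith

/-- A sequence converging in `W^{1,s}` to `w` converges to `w` in `L^r` if the Sobolev inequality
holds for its differences. No Sobolev inequality for `w` itself is needed. -/
theorem tendsto_eLpNorm_of_le_of_tendsto {φ : ℕ → E3 → E3} {w : E3 → E3}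
    {G : E3 → E3 →L[ℝ] E3} {s : ℝ} (hs : 1 ≤ s) {r : ℝ≥0∞} {K : ℝ≥0∞} (hK : K ≠ ⊤)
    (hφ : ∀ n, ContDiff ℝ ∞ (φ n))
    (hw : AEStronglyMeasurable w volume) (hG : AEStronglyMeasurable G volume)
    (hsob : ∀ n m, eLpNorm (φ n - φ m) r volume
      ≤ K * eLpNorm (fderiv ℝ (φ n - φ m)) (ENNReal.ofReal s) volume)
    (h1 : Filter.Tendsto (fun n => eLpNorm (φ n - w) (ENNReal.ofReal s) volume) Filter.atTop
      (nhds 0))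
    (h2 : Filter.Tendsto (fun n => eLpNorm (fderiv ℝ (φ n) - G) (ENNReal.ofReal s) volume)
      Filter.atTop (nhds 0)) :
    Filter.Tendsto (fun n => eLpNorm (φ n - w) r volume) Filter.atTop (nhds 0) := by
  have hc : ∀ n, AEStronglyMeasurable (φ n) volume := fun n => (hφ n).continuous.aestronglyMeasurable
  have hcd : ∀ n, AEStronglyMeasurable (fderiv ℝ (φ n)) volume := fun n =>
    ((hφ n).continuous_fderiv (by simp)).aestronglyMeasurable
  obtain ⟨ns, hns, hae⟩ := (tendstoInMeasure_of_tendsto_eLpNorm (by simp; linarith)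
    hc hw h1).exists_seq_tendsto_ae
  have hbd : ∀ n, eLpNorm (φ n - w) r volume
      ≤ K * eLpNorm (fderiv ℝ (φ n) - G) (ENNReal.ofReal s) volume := by
    intro n
    have hlim : ∀ᵐ x ∂(volume : Measure E3),
        Filter.Tendsto (fun k => (φ n - φ (ns k)) x) Filter.atTop (nhds ((φ n - w) x)) := by
      filter_upwards [hae] with x hx
      exact tendsto_const_nhds.sub hx
    refine (Lp.eLpNorm_lim_le_liminf_eLpNorm (fun k => (hc n).sub (hc (ns k))) _ hlim).trans ?_
    have hstep : ∀ k, eLpNorm (φ n - φ (ns k)) r volume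
        ≤ K * (eLpNorm (fderiv ℝ (φ n) - G) (ENNReal.ofReal s) volume
          + eLpNorm (fderiv ℝ (φ (ns k)) - G) (ENNReal.ofReal s) volume) := by
      intro k
      refine (hsob n (ns k)).trans ?_
      gcongr
      have hfd : fderiv ℝ (φ n - φ (ns k))
          = (fderiv ℝ (φ n) - G) - (fderiv ℝ (φ (ns k)) - G) := by
        ext1 x
        rw [fderiv_sub ((hφ n).differentiable (by simp) x)
          ((hφ (ns k)).differentiable (by simp) x)]
        simp
      rw [hfd]
      exact eLpNorm_sub_le ((hcd n).sub hG) ((hcd (ns k)).sub hG) (by simpa using hs)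
    have hT : Filter.Tendsto (fun k => K * (eLpNorm (fderiv ℝ (φ n) - G) (ENNReal.ofReal s) volume
          + eLpNorm (fderiv ℝ (φ (ns k)) - G) (ENNReal.ofReal s) volume)) Filter.atTop
        (nhds (K * (eLpNorm (fderiv ℝ (φ n) - G) (ENNReal.ofReal s) volume + 0))) :=
      ENNReal.Tendsto.const_mul ((h2.comp hns.tendsto_atTop).const_add _) (Or.inr hK)
    rw [add_zero] at hT
    rw [← hT.liminf_eq]
    exact Filter.liminf_le_liminf (Filter.Eventually.of_forall hstep)
  have hT := ENNReal.Tendsto.const_mul h2 (Or.inr hK)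
  rw [mul_zero] at hT
  exact tendsto_of_tendsto_of_tendsto_of_le_of_le tendsto_const_nhds hT (fun _ => zero_le) hbd

section Pairing

variable {α E F : Type*} [MeasurableSpace α] {μ : Measure α} [NormedAddCommGroup E]
  [NormedSpace ℝ E] [NormedAddCommGroup F] [NormedSpace ℝ F] {p q : ℝ≥0∞}

theorem integrable_bilin [ENNReal.HolderConjugate p q] (b : E →L[ℝ] F →L[ℝ] ℝ) {f : α → E}
    {g : α → F} (hf : MemLp f p μ) (hg : MemLp g q μ) : Integrable (fun x => b (f x) (g x)) μ := by
  rw [← memLp_one_iff_integrable]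
  exact MemLp.of_bilin (fun x y => b x y) ‖b‖₊ hf hg (b.aestronglyMeasurable_comp₂ hf.1 hg.1)
    (Filter.Eventually.of_forall fun x => b.le_opNorm₂ _ _)

theorem enorm_integral_clm_le [ENNReal.HolderConjugate p q] (b : E →L[ℝ] F →L[ℝ] ℝ) {f : α → E}
    {g : α → F} (hf : AEStronglyMeasurable f μ) (hg : AEStronglyMeasurable g μ) :
    ‖∫ x, b (f x) (g x) ∂μ‖ₑ ≤ ‖b‖ₑ * eLpNorm f p μ * eLpNorm g q μ :=
  enorm_integral_bilin_le hf hg (fun x y => b x y) (c := ‖b‖₊) fun x y => b.le_opNorm₂ x y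

/-- A bilinear pairing is continuous from `L^p × L^q` into the reals. -/
theorem tendsto_integral_bilin [ENNReal.HolderConjugate p q] (b : E →L[ℝ] F →L[ℝ] ℝ)
    {f : ℕ → α → E} {f' : α → E} {g : ℕ → α → F} {g' : α → F} (hf : ∀ n, MemLp (f n) p μ)
    (hf' : MemLp f' p μ) (hg : ∀ n, MemLp (g n) q μ) (hg' : MemLp g' q μ)
    (hfl : Filter.Tendsto (fun n => eLpNorm (f n - f') p μ) Filter.atTop (nhds 0))
    (hgl : Filter.Tendsto (fun n => eLpNorm (g n - g') q μ) Filter.atTop (nhds 0)) :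
    Filter.Tendsto (fun n => ∫ x, b (f n x) (g n x) ∂μ) Filter.atTop
      (nhds (∫ x, b (f' x) (g' x) ∂μ)) := by
  have hq1 : 1 ≤ q := ENNReal.HolderConjugate.one_le q p
  rw [tendsto_iff_edist_tendsto_0]
  set B := ‖b‖ₑ with hB
  have hbound : ∀ n, edist (∫ x, b (f n x) (g n x) ∂μ) (∫ x, b (f' x) (g' x) ∂μ)
      ≤ B * eLpNorm (f n - f') p μ * (eLpNorm (g n - g') q μ + eLpNorm g' q μ)
        + B * eLpNorm f' p μ * eLpNorm (g n - g') q μ := by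
    intro n
    have heq : (∫ x, b (f n x) (g n x) ∂μ) - ∫ x, b (f' x) (g' x) ∂μ
        = (∫ x, b ((f n - f') x) (g n x) ∂μ) + ∫ x, b (f' x) ((g n - g') x) ∂μ := by
      rw [← integral_sub (integrable_bilin b (hf n) (hg n)) (integrable_bilin b hf' hg'),
        ← integral_add (integrable_bilin b ((hf n).sub hf') (hg n))
          (integrable_bilin b hf' ((hg n).sub hg'))]
      refine integral_congr_ae (Filter.Eventually.of_forall fun x => ?_)
      simp
    rw [edist_eq_enorm_sub, heq]
    refine (enorm_add_le _ _).trans (add_le_add ?_ ?_)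
    · refine (enorm_integral_clm_le (p := p) (q := q) b ((hf n).sub hf').1 (hg n).1).trans ?_
      gcongr
      have h := eLpNorm_add_le ((hg n).sub hg').1 hg'.1 hq1
      rwa [sub_add_cancel] at h
    · exact enorm_integral_clm_le (p := p) (q := q) b hf'.1 ((hg n).sub hg').1
  have hBt : B ≠ ⊤ := enorm_ne_top
  have h0 : Filter.Tendsto (fun n => B * eLpNorm (f n - f') p μ
        * (eLpNorm (g n - g') q μ + eLpNorm g' q μ)
        + B * eLpNorm f' p μ * eLpNorm (g n - g') q μ) Filter.atTop
      (nhds (B * 0 * (0 + eLpNorm g' q μ) + B * eLpNorm f' p μ * 0)) := by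
    refine Filter.Tendsto.add ?_ ?_
    · refine ENNReal.Tendsto.mul (ENNReal.Tendsto.const_mul hfl (Or.inr hBt)) (Or.inr ?_)
        (hgl.add_const _) (Or.inr (by simp))
      rw [zero_add]
      exact hg'.eLpNorm_ne_top
    · exact ENNReal.Tendsto.const_mul hgl (Or.inr (ENNReal.mul_ne_top hBt hf'.eLpNorm_ne_top))
  rw [mul_zero, zero_mul, mul_zero, add_zero] at h0
  exact tendsto_of_tendsto_of_tendsto_of_le_of_le tendsto_const_nhds h0 (fun _ => zero_le) hbound

end Pairing

set_option maxSynthPendingDepth 3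

/-! ### Tensor algebra -/

/-- The double contraction as a continuous bilinear form. -/
def contractL : (E3 →L[ℝ] E3) →L[ℝ] (E3 →L[ℝ] E3) →L[ℝ] ℝ :=
  ∑ j, ∑ i, (ContinuousLinearMap.mul ℝ ℝ).bilinearComp (entryL j i) (entryL j i)

@[simp] theorem contractL_apply (A B : E3 →L[ℝ] E3) : contractL A B = contract A B := by
  simp [contractL, contract]

/-- The bilinear form `(p, A) ↦ p tr A`. -/
def mulTrL : ℝ →L[ℝ] (E3 →L[ℝ] E3) →L[ℝ] ℝ :=
  (ContinuousLinearMap.mul ℝ ℝ).bilinearComp (ContinuousLinearMap.id ℝ ℝ) trL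

@[simp] theorem mulTrL_apply (p : ℝ) (A : E3 →L[ℝ] E3) : mulTrL p A = p * tr A := by
  simp [mulTrL]

/-- The tensor `x ↦ ⟪v, x⟫ u`. -/
def rankOne (v u : E3) : E3 →L[ℝ] E3 := (innerSL ℝ v).smulRight u

theorem norm_rankOne (v u : E3) : ‖rankOne v u‖ = ‖v‖ * ‖u‖ := by
  rw [rankOne, ContinuousLinearMap.norm_smulRight_apply, innerSL_apply_norm]

theorem inner_e (v : E3) (i : Fin 3) : ⟪v, e i⟫ = v i := by
  simp [e, EuclideanSpace.inner_single_right]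

theorem inner_eq_sum (x y : E3) : ⟪x, y⟫ = ∑ i, x i * y i := by
  simp [PiLp.inner_apply, mul_comm]

theorem contract_rankOne (v u : E3) (A : E3 →L[ℝ] E3) : contract (rankOne v u) A = ⟪u, A v⟫ := by
  have h : ∀ i j, rankOne v u (e j) i = v j * u i := fun i j => by simp [rankOne, inner_e]
  conv_rhs => rw [eq_sum_smul_e v]
  simp only [contract, h, map_sum, map_smul, inner_sum, inner_smul_right, inner_eq_sum,
    Finset.mul_sum]
  exact Finset.sum_congr rfl fun j _ => Finset.sum_congr rfl fun i _ => by ring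

theorem inner_cross_self (a b : E3) : ⟪cross a b, b⟫ = 0 := by
  simp [cross, inner_eq_sum, Fin.sum_univ_three, crossProduct]
  ring

theorem inner_cross_cross (a x y : E3) : ⟪cross a x, cross a y⟫ = - ⟪cross a (cross a x), y⟫ := by
  simp [cross, inner_eq_sum, Fin.sum_univ_three, crossProduct]
  ring

theorem cross_add (a x y : E3) : cross a (x + y) = cross a x + cross a y := by
  simp only [← crossTensor_apply, map_add]

theorem adjoint_apply_e (A : E3 →L[ℝ] E3) (i j : Fin 3) :
    ContinuousLinearMap.adjoint A (e j) i = A (e i) j := by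
  rw [← inner_e, ContinuousLinearMap.adjoint_inner_left, real_inner_comm, inner_e]

theorem e_apply (i j : Fin 3) : e i j = if j = i then 1 else 0 := by
  simp [e]

theorem stress_apply_e (mu lam : ℝ) (A : E3 →L[ℝ] E3) (i j : Fin 3) :
    stress mu lam A (e j) i = mu * (A (e j) i + A (e i) j)
      + (lam - 2 / 3 * mu) * tr A * (if i = j then 1 else 0) := by
  simp [stress, adjoint_apply_e, e_apply]
  ring

theorem clm_ext_e {A B : E3 →L[ℝ] E3} (h : ∀ i j, A (e j) i = B (e j) i) : A = B := by
  ext1 x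
  rw [eq_sum_smul_e x, map_sum, map_sum]
  refine Finset.sum_congr rfl fun j _ => ?_
  rw [map_smul, map_smul]
  congr 1
  ext i
  exact h i j

/-- A rigid rotation carries no viscous stress. -/
theorem stress_sub_crossTensor (mu lam : ℝ) (A : E3 →L[ℝ] E3) (a : E3) :
    stress mu lam (A - crossTensor a) = stress mu lam A := by
  refine clm_ext_e fun i j => ?_
  have hskew : ∀ i j : Fin 3, crossTensor a (e j) i + crossTensor a (e i) j = 0 := by
    intro i j
    fin_cases i <;> fin_cases j <;> simp [crossTensor_apply, cross, crossProduct, e]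
  have htr : tr (A - crossTensor a) = tr A := by
    rw [← trL_apply, map_sub, trL_apply, trL_apply, sub_eq_self, tr]
    refine Finset.sum_eq_zero fun i _ => ?_
    linarith [hskew i i]
  rw [stress_apply_e, stress_apply_e, htr]
  simp only [_root_.sub_apply, PiLp.sub_apply]
  linear_combination (-mu) * hskew i j

/-- The trace-free part of `A + Aᵀ`, in components. -/
def devSym (i j : Fin 3) (A : E3 →L[ℝ] E3) : ℝ :=
  A (e j) i + A (e i) j - 2 / 3 * tr A * (if i = j then 1 else 0)

theorem contract_stress_self (mu lam : ℝ) (A : E3 →L[ℝ] E3) :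
    contract (stress mu lam A) A
      = mu / 2 * ∑ j, ∑ i, devSym i j A ^ 2 + lam * tr A ^ 2 := by
  simp only [contract, stress_apply_e, devSym, tr, Fin.sum_univ_three]
  simp
  ring

/-- The pointwise identity behind Korn's inequality; for the gradient of a compactly supported field,
the integral of the second sum equals that of `(div w)²`. -/
theorem sum_devSym_mul (A : E3 →L[ℝ] E3) :
    ∑ j, ∑ i, devSym i j A * A (e j) i = (∑ j, ∑ i, A (e j) i ^ 2)
      + (∑ j, ∑ i, A (e j) i * A (e i) j) - 2 / 3 * tr A ^ 2 := by
  simp only [devSym, tr, Fin.sum_univ_three]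
  simp
  ring

theorem continuous_stress (mu lam : ℝ) : Continuous (stress mu lam) := by
  have h1 : Continuous fun A : E3 →L[ℝ] E3 => tr A := by
    simp only [← trL_apply]
    exact trL.continuous
  have h2 : Continuous fun A : E3 →L[ℝ] E3 => ContinuousLinearMap.adjoint A :=
    ContinuousLinearMap.adjoint.continuous
  unfold stress
  exact (Continuous.fun_const_smul (continuous_id.add h2) mu).add ((continuous_const.mul h1).smul continuous_const)

theorem norm_stress_le (mu lam : ℝ) :
    ∃ c : ℝ, 0 ≤ c ∧ ∀ A : E3 →L[ℝ] E3, ‖stress mu lam A‖ ≤ c * ‖A‖ := by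
  refine ⟨|mu| * 2 + |lam - 2 / 3 * mu| * ‖trL‖ * ‖ContinuousLinearMap.id ℝ E3‖, by positivity,
    fun A => ?_⟩
  refine (norm_add_le _ _).trans ?_
  rw [norm_smul, norm_smul, norm_mul, ← trL_apply, add_mul, Real.norm_eq_abs, Real.norm_eq_abs]
  have h1 : ‖A + ContinuousLinearMap.adjoint A‖ ≤ 2 * ‖A‖ := by
    refine (norm_add_le _ _).trans_eq ?_
    rw [LinearIsometryEquiv.norm_map]
    ring
  have h2 := trL.le_opNorm A
  calc _ ≤ |mu| * (2 * ‖A‖) + |lam - 2 / 3 * mu| * (‖trL‖ * ‖A‖) * ‖ContinuousLinearMap.id ℝ E3‖ := by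
        gcongr
    _ = _ := by ring

theorem memLp_stress {μ : Measure E3} {p : ℝ≥0∞} {G : E3 → E3 →L[ℝ] E3} (hG : MemLp G p μ)
    (mu lam : ℝ) : MemLp (fun x => stress mu lam (G x)) p μ := by
  obtain ⟨c, -, hc⟩ := norm_stress_le mu lam
  exact hG.of_le_mul ((continuous_stress mu lam).comp_aestronglyMeasurable hG.1)
    (Filter.Eventually.of_forall fun x => hc (G x))

/-! ### The momentum equation in the limit -/

section Momentum

variable {C : Set E3} {s q : ℝ} {L : E3 → E3 →L[ℝ] E3} {l : E3 → E3} {p : E3 → ℝ}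

theorem IsTest.memLp {F : Type*} [NormedAddCommGroup F] [NormedSpace ℝ F] {φ : E3 → F}
    (hφ : IsTest C φ) (r : ℝ≥0∞) (μ : Measure E3) [IsFiniteMeasureOnCompacts μ] : MemLp φ r μ :=
  hφ.1.continuous.memLp_of_hasCompactSupport hφ.2.1

theorem IsTest.memLp_fderiv {F : Type*} [NormedAddCommGroup F] [NormedSpace ℝ F]
    {φ : E3 → F} (hφ : IsTest C φ) (r : ℝ≥0∞) (μ : Measure E3) [IsFiniteMeasureOnCompacts μ] :
    MemLp (fderiv ℝ φ) r μ :=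
  (hφ.1.continuous_fderiv (by simp)).memLp_of_hasCompactSupport (hφ.2.1.fderiv ℝ)

/-- A pressure balanced by forces in `L^q` lies in `L^q`. -/
theorem memLp_pressure (hC : IsOpen C) (hCb : Bornology.IsBounded C)
    (hcone : ∀ x ∈ closure C, HasConeAt C x) (hs : 2 ≤ s) (hsq : s.HolderConjugate q)
    (hL : MemLp L (ENNReal.ofReal q) (volume.restrict C))
    (hl : MemLp l (ENNReal.ofReal q) (volume.restrict C))
    (hp : IntegrableOn p C) (hp0 : ∀ᵐ x ∂(volume.restrict C), 0 ≤ p x)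
    (hmom : ∀ φ : E3 → E3, IsTest C φ → (∫ x in C, contract (L x) (fderiv ℝ φ x))
      + (∫ x in C, ⟪l x, φ x⟫) - ∫ x in C, p x * tr (fderiv ℝ φ x) = 0) :
    MemLp p (ENNReal.ofReal q) (volume.restrict C) := by
  have := hsq.symm.ennrealOfReal
  obtain ⟨K, hK, hpoin⟩ := exists_poincare hC.measurableSet hCb hs
  refine memLp_of_enorm_integral_mul_tr_le hC hCb hcone hs hsq hp hp0
    (M := ‖contractL‖ₑ * eLpNorm L (ENNReal.ofReal q) (volume.restrict C)
      + ‖innerSL ℝ (E := E3)‖ₑ * eLpNorm l (ENNReal.ofReal q) (volume.restrict C) * K) ?_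
    fun φ hφ => ?_
  · have h1 := hL.eLpNorm_ne_top
    have h2 := hl.eLpNorm_ne_top
    exact ENNReal.add_ne_top.2 ⟨ENNReal.mul_ne_top enorm_ne_top h1,
      ENNReal.mul_ne_top (ENNReal.mul_ne_top enorm_ne_top h2) hK⟩
  · have h1 := enorm_integral_clm_le (p := ENNReal.ofReal q) (q := ENNReal.ofReal s)
      contractL hL.1 (hφ.memLp_fderiv (ENNReal.ofReal s) (volume.restrict C)).1
    have h2 := enorm_integral_clm_le (p := ENNReal.ofReal q) (q := ENNReal.ofReal s)
      (innerSL ℝ (E := E3)) hl.1 (hφ.memLp (ENNReal.ofReal s) (volume.restrict C)).1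
    simp only [contractL_apply] at h1
    rw [← sub_eq_zero.1 (hmom φ hφ)]
    refine (enorm_add_le _ _).trans ?_
    rw [add_mul]
    refine add_le_add (h1.trans ?_) (h2.trans ?_)
    · gcongr
      exact Measure.restrict_le_self
    · rw [mul_assoc _ K]
      gcongr
      refine le_trans ?_ (hpoin φ hφ)
      gcongr
      exact Measure.restrict_le_self

theorem tendsto_eLpNorm_restrict {F : Type*} [NormedAddCommGroup F] {f : ℕ → E3 → F} {r : ℝ≥0∞}
    (h : Filter.Tendsto (fun n => eLpNorm (f n) r volume) Filter.atTop (nhds 0)) :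
    Filter.Tendsto (fun n => eLpNorm (f n) r (volume.restrict C)) Filter.atTop (nhds 0) :=
  tendsto_of_tendsto_of_tendsto_of_le_of_le tendsto_const_nhds h (fun _ => zero_le)
    fun _ => eLpNorm_mono_measure _ Measure.restrict_le_self

end Momentum

/-! ### The convective term -/

theorem aestronglyMeasurable_rankOne {μ : Measure E3} {v w : E3 → E3}
    (hv : AEStronglyMeasurable v μ) (hw : AEStronglyMeasurable w μ) :
    AEStronglyMeasurable (fun x => rankOne (v x) (w x)) μ :=
  aestronglyMeasurable_smulRight ((innerSL ℝ).continuous.comp_aestronglyMeasurable hv) hw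

theorem smul_rankOne (c : ℝ) (v w : E3) : c • rankOne v w = rankOne (c • v) w := by
  ext1 x
  simp [rankOne, smul_smul]

theorem rankOne_sub (v w w' : E3) : rankOne v (w - w') = rankOne v w - rankOne v w' := by
  ext1 x
  simp [rankOne, smul_sub]

/-- Hölder's inequality for `ρ v ⊗ w` with three factors on a space of finite measure. -/
theorem exists_eLpNorm_smul_rankOne_le {μ : Measure E3} [IsFiniteMeasure μ] {a r q : ℝ≥0∞}
    (hq : q ≠ 0) (h : a⁻¹ + r⁻¹ + r⁻¹ ≤ q⁻¹) {ρ : E3 → ℝ} {v : E3 → E3} (hρ : MemLp ρ a μ)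
    (hv : MemLp v r μ) :
    ∃ K : ℝ≥0∞, K ≠ ⊤ ∧ ∀ w : E3 → E3, AEStronglyMeasurable w μ →
      eLpNorm (fun x => ρ x • rankOne (v x) (w x)) q μ ≤ K * eLpNorm w r μ := by
  have h1 : ENNReal.HolderTriple a r (a⁻¹ + r⁻¹)⁻¹ := ⟨(inv_inv _).symm⟩
  set m := (a⁻¹ + r⁻¹)⁻¹ with hm
  have h2 : ENNReal.HolderTriple m r (m⁻¹ + r⁻¹)⁻¹ := ⟨(inv_inv _).symm⟩
  set m' := (m⁻¹ + r⁻¹)⁻¹ with hm'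
  have hqm : q ≤ m' := by
    rw [← ENNReal.inv_le_inv, hm', inv_inv, hm, inv_inv]
    exact h
  have hρv : MemLp (fun x => ρ x • v x) m μ := hv.smul hρ
  have hexp : 0 ≤ 1 / q.toReal - 1 / m'.toReal := by
    rw [one_div, one_div, ← ENNReal.toReal_inv, ← ENNReal.toReal_inv, sub_nonneg]
    exact ENNReal.toReal_mono (by simpa using hq) (ENNReal.inv_le_inv.2 hqm)
  refine ⟨eLpNorm (fun x => ρ x • v x) m μ * μ univ ^ (1 / q.toReal - 1 / m'.toReal),
    ENNReal.mul_ne_top hρv.eLpNorm_ne_top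
      (ENNReal.rpow_ne_top_of_nonneg hexp (measure_ne_top μ univ)), fun w hw => ?_⟩
  simp only [smul_rankOne]
  refine (eLpNorm_le_eLpNorm_mul_rpow_measure_univ hqm
    (aestronglyMeasurable_rankOne hρv.1 hw)).trans ?_
  rw [mul_assoc, mul_comm (μ univ ^ _), ← mul_assoc]
  gcongr
  have h3 := eLpNorm_le_eLpNorm_mul_eLpNorm'_of_norm (r := m') (p := m) (q := r) hρv.1 hw rankOne 1
    (Filter.Eventually.of_forall fun x => by rw [norm_rankOne, NNReal.coe_one, one_mul])
  rwa [ENNReal.coe_one, one_mul] at h3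

section Bounded

variable {C : Set E3} {a r : ℝ≥0∞} {s q : ℝ} {ρ : E3 → ℝ} {v w : E3 → E3}

theorem _root_.Real.HolderConjugate.add_inv_le (hsq : s.HolderConjugate q) {x : ℝ≥0∞}
    (h : x + (ENNReal.ofReal s)⁻¹ ≤ 1) : x ≤ (ENNReal.ofReal q)⁻¹ := by
  rw [← hsq.symm.inv_add_inv_ennreal] at h
  exact ENNReal.le_of_add_le_add_right (by simpa using hsq.pos) h

theorem integrableOn_contract (hsq : s.HolderConjugate q) {L A : E3 → E3 →L[ℝ] E3}
    (hL : MemLp L (ENNReal.ofReal q) (volume.restrict C))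
    (hA : MemLp A (ENNReal.ofReal s) (volume.restrict C)) :
    IntegrableOn (fun x => contract (L x) (A x)) C := by
  have := hsq.symm.ennrealOfReal
  have h := integrable_bilin (p := ENNReal.ofReal q) (q := ENNReal.ofReal s) contractL hL hA
  simp only [contractL_apply] at h
  exact h

theorem integrableOn_inner (hsq : s.HolderConjugate q)
    (hv : MemLp v (ENNReal.ofReal q) (volume.restrict C))
    (hw : MemLp w (ENNReal.ofReal s) (volume.restrict C)) :
    IntegrableOn (fun x => ⟪v x, w x⟫) C := by
  have := hsq.symm.ennrealOfReal
  exact integrable_bilin (p := ENNReal.ofReal q) (q := ENNReal.ofReal s) (innerSL ℝ (E := E3)) hv hw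

theorem integrableOn_mul_tr (hsq : s.HolderConjugate q) {p : E3 → ℝ} {A : E3 → E3 →L[ℝ] E3}
    (hp : MemLp p (ENNReal.ofReal q) (volume.restrict C))
    (hA : MemLp A (ENNReal.ofReal s) (volume.restrict C)) :
    IntegrableOn (fun x => p x * tr (A x)) C := by
  have := hsq.symm.ennrealOfReal
  have h := integrable_bilin (p := ENNReal.ofReal q) (q := ENNReal.ofReal s) mulTrL hp hA
  simp only [mulTrL_apply] at h
  exact h

theorem isFiniteMeasure_restrict (hCb : Bornology.IsBounded C) :
    IsFiniteMeasure (volume.restrict C) := ⟨by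
  rw [Measure.restrict_apply_univ]; exact hCb.measure_lt_top⟩

theorem memLp_smul_rankOne (hCb : Bornology.IsBounded C) (hsq : s.HolderConjugate q)
    (hexp : a⁻¹ + r⁻¹ + r⁻¹ + (ENNReal.ofReal s)⁻¹ ≤ 1) (hρ : MemLp ρ a (volume.restrict C))
    (hv : MemLp v r (volume.restrict C)) (hw : MemLp w r (volume.restrict C)) :
    MemLp (fun x => ρ x • rankOne (v x) (w x)) (ENNReal.ofReal q) (volume.restrict C) := by
  have := isFiniteMeasure_restrict hCb
  obtain ⟨K, hK, hbound⟩ := exists_eLpNorm_smul_rankOne_le (q := ENNReal.ofReal q)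
    (by simpa using hsq.symm.pos) (hsq.add_inv_le hexp) hρ hv
  exact ⟨hρ.1.smul (aestronglyMeasurable_rankOne hv.1 hw.1),
    (hbound w hw.1).trans_lt (ENNReal.mul_lt_top (lt_top_iff_ne_top.2 hK) hw.2)⟩

theorem memLp_smul_cross (hCb : Bornology.IsBounded C) (hsq : s.HolderConjugate q)
    (hexp : a⁻¹ + r⁻¹ + r⁻¹ + (ENNReal.ofReal s)⁻¹ ≤ 1) (hρ : MemLp ρ a (volume.restrict C))
    (hw : MemLp w r (volume.restrict C)) (om : E3) :
    MemLp (fun x => ρ x • cross om (w x)) (ENNReal.ofReal q) (volume.restrict C) := by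
  have := isFiniteMeasure_restrict hCb
  refine (memLp_smul_rankOne hCb hsq hexp hρ hw (memLp_const (e 0))).of_le_mul
    (c := ‖crossTensor om‖)
    (hρ.1.smul ((crossTensor om).continuous.comp_aestronglyMeasurable hw.1))
    (Filter.Eventually.of_forall fun x => ?_)
  rw [norm_smul, norm_smul, norm_rankOne, norm_e, mul_one, mul_left_comm]
  gcongr
  exact (crossTensor om).le_opNorm (w x)

end Bounded

/-- The velocity of a rigid motion. -/
def rigidVel (om ξ x : E3) : E3 := cross om x + ξ

theorem contDiff_rigidVel (om ξ : E3) : ContDiff ℝ ∞ (rigidVel om ξ) :=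
  (crossTensor om).contDiff.add contDiff_const

theorem fderiv_rigidVel (om ξ x : E3) : fderiv ℝ (rigidVel om ξ) x = crossTensor om := by
  have h : HasFDerivAt (rigidVel om ξ) (crossTensor om) x :=
    (crossTensor om).hasFDerivAt.add_const ξ
  exact h.fderiv

theorem memLp_rigidVel {C : Set E3} (hC : MeasurableSet C) (hCb : Bornology.IsBounded C)
    (om ξ : E3) (r : ℝ≥0∞) : MemLp (rigidVel om ξ) r (volume.restrict C) := by
  have := isFiniteMeasure_restrict hCb
  obtain ⟨c, hc⟩ := hCb.isCompact_closure.exists_bound_of_continuousOn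
    (contDiff_rigidVel om ξ).continuous.continuousOn
  refine MemLp.of_bound (contDiff_rigidVel om ξ).continuous.aestronglyMeasurable c ?_
  filter_upwards [ae_restrict_mem hC] with x hx
  exact hc x (subset_closure hx)

/-- The test fields `φ n` of `C` approximate the field `w` with gradient `G`, in the norm of
`W^{1,s}` as well as in the Lebesgue space `L^r`. -/
structure Approximates (C : Set E3) (s : ℝ) (r : ℝ≥0∞) (φ : ℕ → E3 → E3) (w : E3 → E3)
    (G : E3 → E3 →L[ℝ] E3) : Prop where
  isTest : ∀ n, IsTest C (φ n)
  memLp : MemLp w (ENNReal.ofReal s) volume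
  memLp_grad : MemLp G (ENNReal.ofReal s) volume
  memLp_sobolev : MemLp w r volume
  tendsto : Filter.Tendsto (fun n => eLpNorm (φ n - w) (ENNReal.ofReal s) volume) Filter.atTop
    (nhds 0)
  tendsto_grad : Filter.Tendsto (fun n => eLpNorm (fderiv ℝ (φ n) - G) (ENNReal.ofReal s) volume)
    Filter.atTop (nhds 0)
  tendsto_sobolev : Filter.Tendsto (fun n => eLpNorm (φ n - w) r volume) Filter.atTop (nhds 0)

theorem exists_approximates {C : Set E3} (hC : IsOpen C) (hCb : Bornology.IsBounded C)
    (hcone : ∀ x ∈ closure C, HasConeAt C x) {s : ℝ} (hs : 1 ≤ s) {r : ℝ≥0∞}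
    {K : ℝ≥0∞} (hK : K ≠ ⊤)
    (hsob : ∀ φ : E3 → E3, IsTest C φ →
        eLpNorm φ r volume ≤ K * eLpNorm (fderiv ℝ φ) (ENNReal.ofReal s) volume)
    {w : E3 → E3} {G : E3 → E3 →L[ℝ] E3} (hG : HasGlobalGradient w G)
    (hw0 : ∀ x ∉ C, w x = 0) (hG0 : ∀ x ∉ C, G x = 0)
    (hws : MemLp w (ENNReal.ofReal s) volume) (hGs : MemLp G (ENNReal.ofReal s) volume) :
    ∃ φ, Approximates C s r φ w G := by
  obtain ⟨φ, hφ, h1, h2⟩ := exists_isTest_tendsto hC hCb hcone hs hG hw0 hG0 hws hGs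
  have hneg : ∀ n, IsTest C (-φ n) := fun n =>
    ⟨(hφ n).1.neg, (hφ n).2.1.neg, by rw [tsupport_neg]; exact (hφ n).2.2⟩
  have h3 : Filter.Tendsto (fun n => eLpNorm (φ n - w) r volume) Filter.atTop (nhds 0) :=
    tendsto_eLpNorm_of_le_of_tendsto hs hK (fun n => (hφ n).1) hws.1 hGs.1
      (fun n m => by
        rw [sub_eq_add_neg]
        exact hsob _ ((hφ n).add (hneg m))) h1 h2
  have h4 : MemLp w r volume := by
    obtain ⟨n, hn⟩ := (h3.eventually (gt_mem_nhds ENNReal.zero_lt_top)).exists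
    have h5 : MemLp (φ n - w) r volume := ⟨((hφ n).memLp r volume).1.sub hws.1, hn⟩
    have h6 := ((hφ n).memLp r volume).sub h5
    rwa [sub_sub_cancel] at h6
  exact ⟨φ, hφ, hws, hGs, h4, h1, h2, h3⟩

namespace Approximates

variable {C : Set E3} {s q : ℝ} {r : ℝ≥0∞} {φ : ℕ → E3 → E3} {w : E3 → E3}
  {G : E3 → E3 →L[ℝ] E3}

theorem tendsto_integral_inner (h : Approximates C s r φ w G) (hsq : s.HolderConjugate q)
    {l : E3 → E3} (hl : MemLp l (ENNReal.ofReal q) (volume.restrict C)) :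
    Filter.Tendsto (fun n => ∫ x in C, ⟪l x, φ n x⟫) Filter.atTop
      (nhds (∫ x in C, ⟪l x, w x⟫)) := by
  have := hsq.symm.ennrealOfReal
  exact tendsto_integral_bilin (p := ENNReal.ofReal q) (q := ENNReal.ofReal s)
    (innerSL ℝ (E := E3)) (f := fun _ => l) (fun _ => hl) hl
    (fun n => (h.isTest n).memLp _ _) (h.memLp.restrict C) (by simp)
    (tendsto_eLpNorm_restrict h.tendsto)

theorem tendsto_integral_contract (h : Approximates C s r φ w G) (hsq : s.HolderConjugate q)
    {L : ℕ → E3 → E3 →L[ℝ] E3} {L' : E3 → E3 →L[ℝ] E3}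
    (hL : ∀ n, MemLp (L n) (ENNReal.ofReal q) (volume.restrict C))
    (hL' : MemLp L' (ENNReal.ofReal q) (volume.restrict C))
    (hlim : Filter.Tendsto (fun n => eLpNorm (L n - L') (ENNReal.ofReal q) (volume.restrict C))
      Filter.atTop (nhds 0)) :
    Filter.Tendsto (fun n => ∫ x in C, contract (L n x) (fderiv ℝ (φ n) x)) Filter.atTop
      (nhds (∫ x in C, contract (L' x) (G x))) := by
  have := hsq.symm.ennrealOfReal
  have h1 := tendsto_integral_bilin (p := ENNReal.ofReal q) (q := ENNReal.ofReal s)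
    contractL hL hL' (fun n => (h.isTest n).memLp_fderiv _ _) (h.memLp_grad.restrict C) hlim
    (tendsto_eLpNorm_restrict h.tendsto_grad)
  simpa only [contractL_apply] using h1

theorem tendsto_integral_mul_tr (h : Approximates C s r φ w G) (hsq : s.HolderConjugate q)
    {p : E3 → ℝ} (hp : MemLp p (ENNReal.ofReal q) (volume.restrict C)) :
    Filter.Tendsto (fun n => ∫ x in C, p x * tr (fderiv ℝ (φ n) x)) Filter.atTop
      (nhds (∫ x in C, p x * tr (G x))) := by
  have := hsq.symm.ennrealOfReal
  have h1 := tendsto_integral_bilin (p := ENNReal.ofReal q) (q := ENNReal.ofReal s)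
    mulTrL (f := fun _ => p) (fun _ => hp) hp (fun n => (h.isTest n).memLp_fderiv _ _)
    (h.memLp_grad.restrict C) (by simp) (tendsto_eLpNorm_restrict h.tendsto_grad)
  simpa only [mulTrL_apply] using h1

/-- The solution is an admissible test field in its own momentum equation. -/
theorem integral_momentum_eq_zero (h : Approximates C s r φ w G) (hsq : s.HolderConjugate q)
    {L : E3 → E3 →L[ℝ] E3} {l : E3 → E3} {p : E3 → ℝ}
    (hL : MemLp L (ENNReal.ofReal q) (volume.restrict C))
    (hl : MemLp l (ENNReal.ofReal q) (volume.restrict C))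
    (hp : MemLp p (ENNReal.ofReal q) (volume.restrict C))
    (hmom : ∀ φ : E3 → E3, IsTest C φ → (∫ x in C, contract (L x) (fderiv ℝ φ x))
      + (∫ x in C, ⟪l x, φ x⟫) - ∫ x in C, p x * tr (fderiv ℝ φ x) = 0) :
    (∫ x in C, contract (L x) (G x)) + (∫ x in C, ⟪l x, w x⟫) - ∫ x in C, p x * tr (G x) = 0 := by
  have h1 := ((h.tendsto_integral_contract hsq (L := fun _ => L) (fun _ => hL) hL (by simp)).add
    (h.tendsto_integral_inner hsq hl)).sub (h.tendsto_integral_mul_tr hsq hp)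
  simp only [hmom _ (h.isTest _)] at h1
  exact tendsto_nhds_unique h1 tendsto_const_nhds

/-- Testing the continuity equation with `|w|² / 2 + U · w`, where `U` is a rigid motion: the
convective term does no work. -/
theorem integral_convective_eq_zero (h : Approximates C s r φ w G) (hC : IsOpen C)
    (hCb : Bornology.IsBounded C) (hsq : s.HolderConjugate q) {a : ℝ≥0∞}
    (hexp : a⁻¹ + r⁻¹ + r⁻¹ + (ENNReal.ofReal s)⁻¹ ≤ 1) {ρ : E3 → ℝ}
    (hρ : MemLp ρ a (volume.restrict C)) (om ξ : E3)
    (hcont : ∀ ψ : E3 → ℝ, IsTest C ψ → ∫ x in C, ρ x * fderiv ℝ ψ x (w x) = 0) :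
    ∫ x in C, ρ x * ⟪w x + rigidVel om ξ x, G x (w x)⟫ = 0 := by
  have := isFiniteMeasure_restrict hCb
  set U := rigidVel om ξ with hU
  have hUr : MemLp U r (volume.restrict C) := memLp_rigidVel hC.measurableSet hCb om ξ r
  have hwr : MemLp w r (volume.restrict C) := h.memLp_sobolev.restrict C
  obtain ⟨K, hK, hbound⟩ := exists_eLpNorm_smul_rankOne_le (q := ENNReal.ofReal q)
    (by simpa using hsq.symm.pos) (hsq.add_inv_le hexp) hρ hwr
  have hTm : ∀ f : E3 → E3, MemLp f r (volume.restrict C) →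
      MemLp (fun x => ρ x • rankOne (w x) (f x)) (ENNReal.ofReal q) (volume.restrict C) :=
    fun f hf => memLp_smul_rankOne hCb hsq hexp hρ hwr hf
  have hφr : ∀ n, MemLp (φ n) r (volume.restrict C) := fun n => (h.isTest n).memLp _ _
  have hl : MemLp (fun x => ρ x • cross om (w x)) (ENNReal.ofReal q) (volume.restrict C) :=
    memLp_smul_cross hCb hsq hexp hρ hwr om
  have hTlim : Filter.Tendsto (fun n => eLpNorm ((fun x => ρ x • rankOne (w x) ((φ n + U) x))
      - fun x => ρ x • rankOne (w x) ((w + U) x)) (ENNReal.ofReal q) (volume.restrict C))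
      Filter.atTop (nhds 0) := by
    have h0 := ENNReal.Tendsto.const_mul (tendsto_eLpNorm_restrict (C := C) h.tendsto_sobolev)
      (Or.inr hK)
    rw [mul_zero] at h0
    refine tendsto_of_tendsto_of_tendsto_of_le_of_le tendsto_const_nhds h0 (fun _ => zero_le)
      fun n => ?_
    have heq : ((fun x => ρ x • rankOne (w x) ((φ n + U) x))
        - fun x => ρ x • rankOne (w x) ((w + U) x))
        = fun x => ρ x • rankOne (w x) ((φ n - w) x) := by
      ext1 x
      rw [Pi.sub_apply, ← smul_sub, ← rankOne_sub]
      simp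
    simp only [heq]
    exact hbound _ ((hφr n).1.sub hwr.1)
  have hlim := (h.tendsto_integral_contract hsq
    (L := fun n x => ρ x • rankOne (w x) ((φ n + U) x))
    (L' := fun x => ρ x • rankOne (w x) ((w + U) x))
    (fun n => hTm _ ((hφr n).add hUr)) (hTm _ (hwr.add hUr)) hTlim).add
    (h.tendsto_integral_inner hsq hl)
  have := hsq.symm.ennrealOfReal
  have hn : ∀ n, (∫ x in C, contract (ρ x • rankOne (w x) ((φ n + U) x)) (fderiv ℝ (φ n) x))
      + ∫ x in C, ⟪ρ x • cross om (w x), φ n x⟫ = 0 := by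
    intro n
    have hφ := h.isTest n
    set ψ : E3 → ℝ := fun x => ⟪(1 / 2 : ℝ) • φ n x + U x, φ n x⟫ with hψ
    have hfc : ContDiff ℝ ∞ fun x => (1 / 2 : ℝ) • φ n x + U x :=
      ContDiff.add (f := fun x => (1 / 2 : ℝ) • φ n x) (hφ.1.const_smul _) (contDiff_rigidVel om ξ)
    have hψs : Function.support ψ ⊆ Function.support (φ n) := fun x hx h0 => hx (by
      simp only [hψ, h0, inner_zero_right])
    have hψt : IsTest C ψ := ⟨hfc.inner ℝ hφ.1, hφ.2.1.mono hψs,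
      (closure_mono hψs).trans hφ.2.2⟩
    have hfd : ∀ x v, fderiv ℝ ψ x v
        = ⟪(φ n + U) x, fderiv ℝ (φ n) x v⟫ + ⟪cross om v, φ n x⟫ := by
      intro x v
      have hd1 : HasFDerivAt (fun x => (1 / 2 : ℝ) • φ n x + U x)
          ((1 / 2 : ℝ) • fderiv ℝ (φ n) x + crossTensor om) x := by
        refine HasFDerivAt.fun_add ?_ ?_
        · exact (hφ.1.differentiable (by simp) x).hasFDerivAt.fun_const_smul _
        · rw [← fderiv_rigidVel om ξ x]
          exact ((contDiff_rigidVel om ξ).differentiable (by simp) x).hasFDerivAt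
      rw [hψ, fderiv_inner_apply ℝ hd1.differentiableAt (hφ.1.differentiable (by simp) x),
        hd1.fderiv]
      simp only [_root_.add_apply, _root_.smul_apply, Pi.add_apply, inner_add_left,
        inner_smul_left, crossTensor_apply]
      rw [real_inner_comm (φ n x) (fderiv ℝ (φ n) x v)]
      simp
      ring
    have h1 := hcont ψ hψt
    have hi1 := integrableOn_contract hsq (hTm _ ((hφr n).add hUr))
      (hφ.memLp_fderiv (ENNReal.ofReal s) (volume.restrict C))
    have hi2 : IntegrableOn (fun x => ⟪ρ x • cross om (w x), φ n x⟫) C :=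
      integrable_bilin (p := ENNReal.ofReal q) (q := ENNReal.ofReal s) (innerSL ℝ (E := E3))
        hl (hφ.memLp (ENNReal.ofReal s) (volume.restrict C))
    rw [← integral_add hi1 hi2, ← h1]
    refine integral_congr_ae (Filter.Eventually.of_forall fun x => ?_)
    simp only [hfd, smul_rankOne, contract_rankOne, map_smul, inner_smul_left, inner_smul_right]
    simp
    ring
  simp only [hn] at hlim
  have h2 := tendsto_nhds_unique hlim tendsto_const_nhds
  simpa [smul_rankOne, contract_rankOne, inner_smul_left, inner_smul_right,
    inner_cross_self] using h2

end Approximates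

/-! ### The energy identity -/

theorem isRenormalizer_id : IsRenormalizer id := by
  have hd : ∀ t : ℝ, 0 ≤ t → derivIci id t = 1 := fun t ht =>
    derivWithin_id _ _ (uniqueDiffOn_Ici 0 t ht)
  refine ⟨contDiffOn_id, rfl, ⟨1, fun t ht => (hd t ht).ge⟩, 1, 0, 0, one_pos, one_pos, by norm_num,
    fun t ht _ => ?_, fun t ht => ?_⟩
  · rw [hd t ht.le]; simp
  · rw [hd t (by linarith)]; simp

theorem derivIci_rpow {γ : ℝ} (hγ : 1 < γ) {t : ℝ} (ht : 0 ≤ t) :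
    derivIci (fun t => t ^ γ) t = γ * t ^ (γ - 1) :=
  (Real.hasDerivAt_rpow_const (Or.inr hγ.le)).hasDerivWithinAt.derivWithin
    (uniqueDiffOn_Ici 0 t ht)

theorem isRenormalizer_rpow {γ : ℝ} (hγ : 1 < γ) : IsRenormalizer fun t => t ^ γ := by
  refine ⟨(Real.contDiff_rpow_const_of_le (by simpa using hγ.le)).contDiffOn,
    Real.zero_rpow (by linarith), ⟨0, fun t ht => ?_⟩, γ, 0, γ - 1, by linarith, one_pos,
    by linarith, fun t ht ht1 => ?_, fun t ht => ?_⟩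
  · rw [derivIci_rpow hγ ht]; positivity
  · rw [derivIci_rpow hγ ht.le, abs_of_nonneg (by positivity), neg_zero, Real.rpow_zero]
    gcongr
    exact Real.rpow_le_one ht.le ht1 (by linarith)
  · have ht0 : 0 ≤ t := by linarith
    rw [derivIci_rpow hγ ht0, abs_of_nonneg (by positivity)]

section Renormalized

variable {C : Set E3} {ρ : E3 → ℝ} {u : E3 → E3} {G : E3 → E3 →L[ℝ] E3} {om ξ : E3}

/-- The continuity equation holds up to the boundary: test functions need not vanish there. -/
theorem RenormalizedContinuity.integral_eq_zero (h : RenormalizedContinuity C ρ u G om ξ)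
    (hρ0 : ∀ᵐ x ∂(volume.restrict C), 0 ≤ ρ x)
    (hi : IntegrableOn (fun x => ρ x • relVel u om ξ x) C) {ψ : E3 → ℝ} (hψ : IsTest univ ψ) :
    ∫ x in C, ρ x * fderiv ℝ ψ x (relVel u om ξ x) = 0 := by
  have h0 : ∀ᵐ x ∂(volume.restrict C), (ρ x * derivIci id (ρ x) - id (ρ x)) = 0 := by
    filter_upwards [hρ0] with x hx
    have : derivIci id (ρ x) = 1 := derivWithin_id _ _ (uniqueDiffOn_Ici 0 _ hx)
    rw [this, id, mul_one, sub_self]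
  have h1 := h id isRenormalizer_id hi
    ((integrable_zero _ _ _).congr (h0.mono fun x hx => by simp only [hx, zero_mul]; rfl)) ψ hψ
  have h2 : ∫ x in C, (ρ x * derivIci id (ρ x) - id (ρ x)) * tr (relGrad G om x) * ψ x = 0 :=
    integral_eq_zero_of_ae (h0.mono fun x hx => by simp only [hx, zero_mul]; rfl)
  rw [h2, add_zero, neg_eq_zero] at h1
  exact h1

/-- The pressure does no work: this is the renormalized continuity equation for `b(t) = t^γ`,
tested with a function that is constant on the domain. -/
theorem RenormalizedContinuity.integral_rpow_mul_tr_eq_zero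
    (h : RenormalizedContinuity C ρ u G om ξ) (hC : IsOpen C) (hCb : Bornology.IsBounded C)
    {γ : ℝ} (hγ : 1 < γ)
    (hρ0 : ∀ᵐ x ∂(volume.restrict C), 0 ≤ ρ x)
    (hi : IntegrableOn (fun x => ρ x ^ γ • relVel u om ξ x) C)
    (hi' : IntegrableOn (fun x => ρ x ^ γ * tr (relGrad G om x)) C) :
    ∫ x in C, ρ x ^ γ * tr (relGrad G om x) = 0 := by
  obtain ⟨χ, hχ, hχ1⟩ := exists_cutoff hCb.isCompact_closure isOpen_univ (subset_univ (closure C))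
  have h0 : ∀ᵐ x ∂(volume.restrict C),
      ρ x * derivIci (fun t => t ^ γ) (ρ x) - ρ x ^ γ = (γ - 1) * ρ x ^ γ := by
    filter_upwards [hρ0] with x hx
    rw [derivIci_rpow hγ hx]
    have : ρ x ^ γ = ρ x * ρ x ^ (γ - 1) := by
      rw [← Real.rpow_one_add' hx (by linarith)]
      congr 1; ring
    rw [this]
    ring
  have h1 := h (fun t => t ^ γ) (isRenormalizer_rpow hγ) hi
    ((hi'.const_mul (γ - 1)).congr (h0.mono fun x hx => by simp only [hx]; ring)) χ hχ
  have h2 : ∫ x in C, ρ x ^ γ * fderiv ℝ χ x (relVel u om ξ x) = 0 := by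
    rw [setIntegral_congr_fun (g := fun _ => (0 : ℝ)) hC.measurableSet fun x hx => ?_,
      integral_zero]
    have h3 : χ =ᶠ[nhds x] fun _ => (1 : ℝ) := by
      filter_upwards [hC.mem_nhds hx] with y hy using hχ1 y (subset_closure hy)
    simp [h3.fderiv_eq]
  have h3 : ∫ x in C, (ρ x * derivIci (fun t => t ^ γ) (ρ x) - ρ x ^ γ) * tr (relGrad G om x) * χ x
      = (γ - 1) * ∫ x in C, ρ x ^ γ * tr (relGrad G om x) := by
    rw [← integral_const_mul]
    refine integral_congr_ae ?_
    filter_upwards [h0, ae_restrict_mem hC.measurableSet] with x hx hxC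
    rw [hx, hχ1 x (subset_closure hxC), mul_one, mul_assoc]
  rw [h2, neg_zero, zero_add, h3] at h1
  exact (mul_eq_zero.1 h1).resolve_left (by linarith)

/-- The Coriolis force does no work: `om × (om × x + ξ)` is a gradient. -/
theorem RenormalizedContinuity.integral_cross_eq_zero (h : RenormalizedContinuity C ρ u G om ξ)
    (hC : IsOpen C) (hCb : Bornology.IsBounded C)
    (hρ0 : ∀ᵐ x ∂(volume.restrict C), 0 ≤ ρ x)
    (hi : IntegrableOn (fun x => ρ x • relVel u om ξ x) C) :
    ∫ x in C, ρ x * ⟪cross om (rigidVel om ξ x), relVel u om ξ x⟫ = 0 := by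
  obtain ⟨χ, hχ, hχ1⟩ := exists_cutoff hCb.isCompact_closure isOpen_univ (subset_univ (closure C))
  set η : E3 → ℝ := fun x => ⟪cross om ξ, x⟫ - 1 / 2 * ⟪crossTensor om x, crossTensor om x⟫ with hη
  have hηc : ContDiff ℝ ∞ η :=
    (contDiff_const.inner ℝ contDiff_id).sub (contDiff_const.mul
      ((crossTensor om).contDiff.inner ℝ (crossTensor om).contDiff))
  have hψ : IsTest univ fun x => χ x * η x :=
    ⟨hχ.1.mul hηc, hχ.2.1.mul_right, subset_univ _⟩
  have h1 := h.integral_eq_zero hρ0 hi hψ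
  rw [← h1]
  refine setIntegral_congr_fun hC.measurableSet fun x hx => ?_
  have h3 : (fun x => χ x * η x) =ᶠ[nhds x] η := by
    filter_upwards [hC.mem_nhds hx] with y hy
    rw [hχ1 y (subset_closure hy), one_mul]
  have hd : ∀ v, fderiv ℝ η x v = ⟪cross om ξ, v⟫ - ⟪crossTensor om x, crossTensor om v⟫ := by
    intro v
    have hA : DifferentiableAt ℝ (fun x => crossTensor om x) x := (crossTensor om).differentiableAt
    have h4 : DifferentiableAt ℝ (fun x : E3 => ⟪cross om ξ, x⟫) x :=
      (differentiableAt_const _).inner ℝ differentiableAt_id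
    have h5 : DifferentiableAt ℝ (fun x : E3 => ⟪crossTensor om x, crossTensor om x⟫) x :=
      hA.inner ℝ hA
    rw [hη, fderiv_fun_sub h4 (h5.const_mul _), fderiv_const_mul h5]
    have h6 := fderiv_inner_apply ℝ (differentiableAt_const (cross om ξ))
      (differentiableAt_id (𝕜 := ℝ) (x := x)) v
    have h7 := fderiv_inner_apply ℝ hA hA v
    simp only [id] at h6
    simp only [_root_.sub_apply, _root_.smul_apply, h6, h7]
    rw [(crossTensor om).fderiv]
    simp [real_inner_comm]
    ring
  simp only [h3.fderiv_eq, hd, crossTensor_apply, inner_cross_cross, rigidVel, cross_add,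
    inner_add_left]
  ring

end Renormalized

/-- Passage from the absolute to the relative velocity. -/
theorem HasWeakGradient.sub_rigidVel {S : Set E3} {u : E3 → E3}
    {G : E3 → E3 →L[ℝ] E3} (h : HasWeakGradient S u G) (om ξ : E3) :
    HasWeakGradient S (relVel u om ξ) (relGrad G om) := by
  have hrel : relVel u om ξ = fun x => u x - rigidVel om ξ x := by
    ext1 x
    rw [relVel, rigidVel]
    abel
  have hUc := (contDiff_rigidVel om ξ).continuous
  refine ⟨?_, ?_, fun φ hφ v => ?_⟩
  · rw [hrel]
    exact h.1.sub (hUc.locallyIntegrable.locallyIntegrableOn S)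
  · exact h.2.1.sub (continuous_const.locallyIntegrable.locallyIntegrableOn S)
  · have hloc : ∀ {F : Type} [NormedAddCommGroup F] [NormedSpace ℝ F] {f : E3 → ℝ} {w : E3 → F},
        LocallyIntegrableOn w S volume → Continuous f → HasCompactSupport f → tsupport f ⊆ S →
        IntegrableOn (fun x => f x • w x) S := by
      intro F _ _ f w hw hf hfc hfs
      have h1 := (hw.integrableOn_compact_subset hfs hfc.isCompact).continuousOn_smul
        hf.continuousOn hfc.isCompact
      refine Integrable.integrableOn ((integrableOn_iff_integrable_of_support_subset ?_).1 h1)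
      exact (Function.support_smul_subset_left f w).trans (subset_tsupport f)
    have hd := continuous_fderiv_apply hφ.1 v
    have hdc := hasCompactSupport_fderiv_apply hφ.2.1 v
    have hds : tsupport (fun x => fderiv ℝ φ x v) ⊆ S :=
      (closure_minimal (fun x hx => by
        by_contra h
        exact hx (by simp only [fderiv_eq_zero_of_notMem_tsupport h, _root_.zero_apply]))
        (isClosed_tsupport φ)).trans hφ.2.2
    have hset : ∀ f : E3 → E3, (∀ x, x ∉ tsupport φ → f x = 0) → ∫ x in S, f x = ∫ x, f x :=
      fun f hf => setIntegral_eq_integral_of_forall_compl_eq_zero fun x hx =>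
        hf x fun h => hx (hφ.2.2 h)
    have hUl : LocallyIntegrable (rigidVel om ξ) (volume : Measure E3) := hUc.locallyIntegrable
    have hcl : LocallyIntegrable (fun _ : E3 => cross om v) (volume : Measure E3) :=
      continuous_const.locallyIntegrable
    have hparts : ∫ x in S, fderiv ℝ φ x v • rigidVel om ξ x
        = -∫ x in S, φ x • cross om v := by
      rw [hset _ fun x hx => by rw [fderiv_eq_zero_of_notMem_tsupport hx]; simp,
        hset _ fun x hx => by rw [image_eq_zero_of_notMem_tsupport hx, zero_smul]]
      have hUd : ∀ x, fderiv ℝ (rigidVel om ξ) x v = cross om v := fun x => by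
        rw [fderiv_rigidVel, crossTensor_apply]
      have := integral_smul_fderiv_eq_neg_fderiv_smul_of_integrable (f := φ)
        (g := rigidVel om ξ) (v := v) (μ := volume)
        (integrable_smul_of_hasCompactSupport hUl hd hdc)
        (by simpa only [hUd] using
          integrable_smul_of_hasCompactSupport hcl hφ.1.continuous hφ.2.1)
        (integrable_smul_of_hasCompactSupport hUl hφ.1.continuous hφ.2.1)
        (fun x _ => hφ.1.differentiable (by simp) x)
        (fun x _ => (contDiff_rigidVel om ξ).differentiable (by simp) x)
      simp only [hUd] at this
      rw [this, neg_neg]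
    have h1 := h.2.2 φ hφ v
    have hφG : IntegrableOn (fun x => φ x • G x v) S :=
      (hloc h.2.1 hφ.1.continuous hφ.2.1 hφ.2.2).apply_continuousLinearMap v
    rw [hrel]
    simp only [relGrad, smul_sub, _root_.sub_apply, crossTensor_apply]
    rw [integral_sub (hloc h.1 hd hdc hds) (hloc (hUl.locallyIntegrableOn S) hd hdc hds),
      integral_sub hφG (hloc (hcl.locallyIntegrableOn S) hφ.1.continuous hφ.2.1 hφ.2.2),
      h1, hparts]
    abel

theorem le_of_holderConjugate {s q : ℝ} (hsq : s.HolderConjugate q) (hs : 2 ≤ s) :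
    q ≤ s := by
  have h1 := hsq.inv_add_inv_eq_one
  have h2 : s⁻¹ ≤ 2⁻¹ := inv_anti₀ two_pos hs
  exact (inv_le_inv₀ hsq.pos hsq.symm.pos).1 (by linarith)

/-- The energy identity: testing the momentum equation with the relative velocity, only the
viscous dissipation survives. -/
theorem Approximates.integral_dissipation_eq_zero {C : Set E3} (hC : IsOpen C)
    (hCb : Bornology.IsBounded C) (hcone : ∀ x ∈ closure C, HasConeAt C x)
    {mu lam a γ s q : ℝ} (ha : 0 < a) (hγ : 1 < γ) (hs : 2 ≤ s) (hsq : s.HolderConjugate q)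
    {r : ℝ≥0∞} (hexp : (ENNReal.ofReal γ)⁻¹ + r⁻¹ + r⁻¹ + (ENNReal.ofReal s)⁻¹ ≤ 1)
    {ρ : E3 → ℝ} {u : E3 → E3} {G : E3 → E3 →L[ℝ] E3} {om ξ : E3} {φ : ℕ → E3 → E3}
    (h : Approximates C s r φ (C.indicator (relVel u om ξ)) (C.indicator (relGrad G om)))
    (hρ : MemLp ρ (ENNReal.ofReal γ) (volume.restrict C))
    (hρ0 : ∀ᵐ x ∂(volume.restrict C), 0 ≤ ρ x)
    (hmom : WeakMomentum C mu lam a γ ρ u G om ξ) (hcont : WeakContinuity C ρ u om ξ)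
    (hren : RenormalizedContinuity C ρ u G om ξ) :
    ∫ x in C, contract (stress mu lam (relGrad G om x)) (relGrad G om x) = 0 := by
  have := isFiniteMeasure_restrict hCb
  have hCm := hC.measurableSet
  set w := C.indicator (relVel u om ξ) with hw
  set A := C.indicator (relGrad G om) with hA
  set U := rigidVel om ξ with hU
  have hwC : ∀ x ∈ C, w x = relVel u om ξ x := fun x hx => indicator_of_mem hx _
  have hAC : ∀ x ∈ C, A x = relGrad G om x := fun x hx => indicator_of_mem hx _
  have huC : ∀ x, relVel u om ξ x + U x = u x := fun x => by
    rw [hU, relVel, rigidVel]; abel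
  have hwr : MemLp w r (volume.restrict C) := h.memLp_sobolev.restrict C
  have hUr : MemLp U r (volume.restrict C) := memLp_rigidVel hCm hCb om ξ r
  have hsA : MemLp (fun x => stress mu lam (A x)) (ENNReal.ofReal q) (volume.restrict C) :=
    (memLp_stress (h.memLp_grad.restrict C) mu lam).mono_exponent 
      (ENNReal.ofReal_le_ofReal (le_of_holderConjugate hsq hs))
  set T : E3 → E3 →L[ℝ] E3 := fun x => ρ x • rankOne (w x) ((w + U) x) with hT
  have hTm : MemLp T (ENNReal.ofReal q) (volume.restrict C) :=
    memLp_smul_rankOne hCb hsq hexp hρ hwr (hwr.add hUr)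
  set l : E3 → E3 := fun x => ρ x • cross om ((w + U) x) with hl
  have hlm : MemLp l (ENNReal.ofReal q) (volume.restrict C) :=
    memLp_smul_cross hCb hsq hexp hρ (hwr.add hUr) om
  have hLm : MemLp (fun x => stress mu lam (A x) - T x) (ENNReal.ofReal q) (volume.restrict C) :=
    hsA.sub hTm
  set p : E3 → ℝ := fun x => pressure a γ (ρ x) with hp
  have hργ : IntegrableOn (fun x => ρ x ^ γ) C := by
    have h1 := hρ.integrable_norm_rpow (by simpa using (by linarith : 0 < γ)) (by simp)
    rw [ENNReal.toReal_ofReal (by linarith)] at h1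
    refine h1.congr ?_
    filter_upwards [hρ0] with x hx
    rw [Real.norm_of_nonneg hx]
  have hpi : IntegrableOn p C := hργ.const_mul a
  have hp0 : ∀ᵐ x ∂(volume.restrict C), 0 ≤ p x := by
    filter_upwards [hρ0] with x hx
    exact mul_nonneg ha.le (Real.rpow_nonneg hx γ)
  have hcontract : ∀ (x : E3) (B : E3 →L[ℝ] E3), contract (stress mu lam (A x) - T x) B
      = contract (stress mu lam (A x)) B - ρ x * ⟪(w + U) x, B (w x)⟫ := by
    intro x B
    have h1 : contract (T x) B = ρ x * ⟪(w + U) x, B (w x)⟫ := by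
      simp only [hT, smul_rankOne, contract_rankOne, map_smul, inner_smul_right]
    rw [← h1, ← contractL_apply, map_sub, _root_.sub_apply, contractL_apply, contractL_apply]
  have hmom' : ∀ φ : E3 → E3, IsTest C φ →
      (∫ x in C, contract (stress mu lam (A x) - T x) (fderiv ℝ φ x))
        + (∫ x in C, ⟪l x, φ x⟫) - ∫ x in C, p x * tr (fderiv ℝ φ x) = 0 := by
    intro φ hφ
    have hφs := hφ.memLp_fderiv (ENNReal.ofReal s) (volume.restrict C)
    have hi1 := integrableOn_contract hsq hsA hφs
    have hi2 := integrableOn_contract hsq hTm hφs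
    have hi3 := integrableOn_inner hsq hlm (hφ.memLp (ENNReal.ofReal s) (volume.restrict C))
    have hi4 : IntegrableOn (fun x => p x * tr (fderiv ℝ φ x)) C := by
      have hc : Continuous fun x => tr (fderiv ℝ φ x) := by
        simp only [← trL_apply]
        exact trL.continuous.comp (hφ.1.continuous_fderiv (by simp))
      have hcs : HasCompactSupport fun x => tr (fderiv ℝ φ x) :=
        (hφ.2.1.fderiv ℝ).comp_left (g := tr) (by rw [← trL_apply, map_zero])
      obtain ⟨c, hc'⟩ := hc.bounded_above_of_compact_support hcs
      exact hpi.mul_bdd hc.aestronglyMeasurable (Filter.Eventually.of_forall hc')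
    have hi0 : IntegrableOn (fun x => contract (stress mu lam (A x) - T x) (fderiv ℝ φ x)) C :=
      integrableOn_contract hsq hLm hφs
    have hi5 : IntegrableOn (fun x => contract (stress mu lam (A x) - T x) (fderiv ℝ φ x)
        + ⟪l x, φ x⟫) C := hi0.add hi3
    rw [← integral_add hi0 hi3, ← integral_sub hi5 hi4]
    have h1 := hmom φ hφ
    have h2 : ∀ x ∈ C, contract (stress mu lam (G x)) (fderiv ℝ φ x)
        = contract (stress mu lam (A x)) (fderiv ℝ φ x) := fun x hx => by
      rw [hAC x hx, relGrad, stress_sub_crossTensor]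
    rw [setIntegral_congr_fun hCm h2] at h1
    have h3 : ∀ x ∈ C, -(ρ x * ⟪u x, fderiv ℝ φ x (relVel u om ξ x)⟫)
        + ρ x * ⟪cross om (u x), φ x⟫ - pressure a γ (ρ x) * tr (fderiv ℝ φ x)
        = (contract (stress mu lam (A x) - T x) (fderiv ℝ φ x) + ⟪l x, φ x⟫
          - p x * tr (fderiv ℝ φ x)) - contract (stress mu lam (A x)) (fderiv ℝ φ x) := by
      intro x hx
      rw [hcontract]
      simp only [hl, hp, Pi.add_apply, hwC x hx, huC, inner_smul_left]
      simp
      ring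
    have hi6 : IntegrableOn (fun x => contract (stress mu lam (A x) - T x) (fderiv ℝ φ x)
        + ⟪l x, φ x⟫ - p x * tr (fderiv ℝ φ x)) C := hi5.sub hi4
    rw [setIntegral_congr_fun hCm h3, integral_sub hi6 hi1] at h1
    linarith
  have hpq : MemLp p (ENNReal.ofReal q) (volume.restrict C) :=
    memLp_pressure hC hCb hcone hs hsq hLm hlm hpi hp0 hmom'
  have henergy := h.integral_momentum_eq_zero hsq hLm hlm hpq hmom'
  -- the pressure does no work
  have hργq : MemLp (fun x => ρ x ^ γ) (ENNReal.ofReal q) (volume.restrict C) := by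
    have h1 := hpq.const_mul a⁻¹
    simpa only [hp, pressure, inv_mul_cancel_left₀ ha.ne'] using h1
  have hws := h.memLp.restrict C
  have hpv : IntegrableOn (fun x => ρ x ^ γ • relVel u om ξ x) C := by
    have := hsq.symm.ennrealOfReal
    have h1 : Integrable ((fun x => ρ x ^ γ) • w) (volume.restrict C) :=
      memLp_one_iff_integrable.1 (hws.smul hργq)
    refine h1.congr ?_
    filter_upwards [ae_restrict_mem hCm] with x hx
    simp only [Pi.smul_apply', hwC x hx]
  have hpA : IntegrableOn (fun x => ρ x ^ γ * tr (relGrad G om x)) C :=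
    (integrableOn_mul_tr hsq hργq (h.memLp_grad.restrict C)).congr_fun
      (fun x hx => by simp only [hAC x hx]) hCm
  have hpw : ∫ x in C, p x * tr (A x) = 0 := by
    have h1 := hren.integral_rpow_mul_tr_eq_zero hC hCb hγ hρ0 hpv hpA
    rw [setIntegral_congr_fun (g := fun x => a * (ρ x ^ γ * tr (relGrad G om x))) hCm fun x hx => ?_,
      integral_const_mul, h1, mul_zero]
    simp only [hp, pressure, hAC x hx, mul_assoc]
  -- the convective term does no work
  have hconv : ∫ x in C, ρ x * ⟪(w + U) x, A x (w x)⟫ = 0 := by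
    refine h.integral_convective_eq_zero hC hCb hsq hexp hρ om ξ fun ψ hψ => ?_
    rw [← hcont ψ hψ]
    exact setIntegral_congr_fun hCm fun x hx => by simp only [hwC x hx]
  -- the Coriolis force does no work
  have hρv : IntegrableOn (fun x => ρ x • relVel u om ξ x) C := by
    have hq1 : 1 ≤ ENNReal.ofReal q := by simpa using hsq.symm.lt.le
    have h1 := (memLp_smul_rankOne hCb hsq hexp hρ hwr (memLp_const (e 0))).integrable hq1
    have h2 : AEStronglyMeasurable (fun x => ρ x • w x) (volume.restrict C) := hρ.1.smul hwr.1
    refine (h1.mono h2 (Filter.Eventually.of_forall fun x => ?_)).congr ?_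
    · rw [norm_smul, norm_smul, norm_rankOne, norm_e, mul_one]
    · filter_upwards [ae_restrict_mem hCm] with x hx
      rw [hwC x hx]
  have hcor : ∫ x in C, ⟪l x, w x⟫ = 0 := by
    rw [← hren.integral_cross_eq_zero hC hCb hρ0 hρv]
    refine setIntegral_congr_fun hCm fun x hx => ?_
    simp only [hl, Pi.add_apply, cross_add, inner_smul_left, inner_add_left, inner_cross_self,
      zero_add, hwC x hx, hU]
    simp
  rw [hcor, hpw, add_zero, sub_zero] at henergy
  have hAs := h.memLp_grad.restrict C
  have hi1 := integrableOn_contract hsq hsA hAs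
  have hi2 := integrableOn_contract hsq hTm hAs
  simp only [hT, smul_rankOne, contract_rankOne, map_smul, inner_smul_right] at hi2
  simp only [hcontract] at henergy
  rw [integral_sub hi1 hi2, hconv, sub_zero] at henergy
  rw [← henergy]
  exact setIntegral_congr_fun hCm fun x hx => by simp only [hAC x hx]

/-! ### Korn's inequality -/

/-- Integrating by parts twice interchanges the two directions of derivation. -/
theorem integral_fderiv_mul_fderiv_comm {f g : E3 → ℝ} (hf : ContDiff ℝ ∞ f)
    (hf' : HasCompactSupport f) (hg : ContDiff ℝ ∞ g) (a b : E3) :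
    ∫ x, fderiv ℝ f x a * fderiv ℝ g x b = ∫ x, fderiv ℝ f x b * fderiv ℝ g x a := by
  have hgd : ∀ b, ContDiff ℝ ∞ fun x => fderiv ℝ g x b := fun b =>
    (hg.fderiv_right (m := ∞) (by simp)).clm_apply contDiff_const
  have hgg : ∀ x a b, fderiv ℝ (fun x => fderiv ℝ g x b) x a = fderiv ℝ (fderiv ℝ g) x a b := by
    intro x a b
    rw [fderiv_clm_apply ((hg.fderiv_right (m := ∞) (by simp)).differentiable (by simp) x)
      (differentiableAt_const b)]
    simp
  have hsymm : ∀ x, fderiv ℝ (fderiv ℝ g) x a b = fderiv ℝ (fderiv ℝ g) x b a := fun x =>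
    ((hg.of_le (m := 2) (WithTop.coe_le_coe.2 le_top)).contDiffAt.isSymmSndFDerivAt (by simp)).eq a b
  have hfi : ∀ {k : E3 → ℝ}, Continuous k → Integrable fun x => f x * k x := fun hk =>
    (hf.continuous.mul hk).integrable_of_hasCompactSupport hf'.mul_right
  have hfi' : ∀ {k : E3 → ℝ} (a : E3), Continuous k → Integrable fun x => fderiv ℝ f x a * k x :=
    fun a hk => ((continuous_fderiv_apply hf a).mul hk).integrable_of_hasCompactSupport
      (hasCompactSupport_fderiv_apply hf' a).mul_right
  have hparts : ∀ a b, ∫ x, fderiv ℝ f x a * fderiv ℝ g x b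
      = -∫ x, f x * fderiv ℝ (fderiv ℝ g) x a b := by
    intro a b
    have hc := continuous_fderiv_apply (hgd b) a
    have h := integral_mul_fderiv_eq_neg_fderiv_mul_of_integrable (μ := volume) (f := f)
      (g := fun x => fderiv ℝ g x b) (v := a) (hfi' a (hgd b).continuous) (hfi hc)
      (hfi (hgd b).continuous) (fun x _ => hf.differentiable (by simp) x)
      (fun x _ => (hgd b).differentiable (by simp) x)
    simp only [hgg] at h
    rw [h, neg_neg]
  rw [hparts, hparts]
  simp only [hsymm]

/-- There are no compactly supported conformal Killing fields: integrating the identity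
`sum_devSym_mul` yields `∫ |∇W|² + 1/3 ∫ (div W)² = 0`. -/
theorem eq_zero_of_devSym_fderiv_eq_zero {W : E3 → E3} (hW : ContDiff ℝ ∞ W)
    (hWc : HasCompactSupport W) (h : ∀ i j x, devSym i j (fderiv ℝ W x) = 0) : W = 0 := by
  have hWi : ∀ i, ContDiff ℝ ∞ fun x => W x i := fun i => contDiff_euclidean.1 hW i
  have hWic : ∀ i, HasCompactSupport fun x => W x i := fun i =>
    hWc.comp_left (g := fun y : E3 => y i) rfl
  have hfd : ∀ i x v, fderiv ℝ (fun x => W x i) x v = fderiv ℝ W x v i := by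
    intro i x v
    have h1 := (EuclideanSpace.proj (𝕜 := ℝ) i).hasFDerivAt.comp x
      (hW.differentiable (by simp) x).hasFDerivAt
    have h2 : fderiv ℝ (fun x => W x i) x = _ := h1.fderiv
    rw [h2]
    rfl
  set A := fun x => fderiv ℝ W x with hA
  have hAc : ∀ i j, Continuous fun x => A x (e j) i := fun i j => by
    simpa only [hfd] using continuous_fderiv_apply (hWi i) (e j)
  have hAs : ∀ i j, HasCompactSupport fun x => A x (e j) i := fun i j => by
    simpa only [hfd] using hasCompactSupport_fderiv_apply (hWic i) (e j)
  have hint : ∀ i j k l, Integrable fun x => A x (e j) i * A x (e l) k := fun i j k l =>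
    ((hAc i j).mul (hAc k l)).integrable_of_hasCompactSupport (hAs i j).mul_right
  have hswap : ∫ x, ∑ j, ∑ i, A x (e j) i * A x (e i) j = ∫ x, tr (A x) ^ 2 := by
    have h1 : ∀ x, tr (A x) ^ 2 = ∑ j, ∑ i, A x (e i) i * A x (e j) j := fun x => by
      rw [tr, sq, Finset.sum_mul_sum, Finset.sum_comm]
    simp only [h1]
    rw [integral_finsetSum _ fun j _ => integrable_finsetSum _ fun i _ => hint i j j i,
      integral_finsetSum _ fun j _ => integrable_finsetSum _ fun i _ => hint i i j j]
    refine Finset.sum_congr rfl fun j _ => ?_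
    rw [integral_finsetSum _ fun i _ => hint i j j i, integral_finsetSum _ fun i _ => hint i i j j]
    refine Finset.sum_congr rfl fun i _ => ?_
    have := integral_fderiv_mul_fderiv_comm (hWi i) (hWic i) (hWi j) (e j) (e i)
    simpa only [hfd] using this
  have hNi : Integrable fun x => ∑ j, ∑ i, A x (e j) i ^ 2 := by
    simp only [sq]
    exact integrable_finsetSum _ fun j _ => integrable_finsetSum _ fun i _ => hint i j i j
  have hXi : Integrable fun x => ∑ j, ∑ i, A x (e j) i * A x (e i) j :=
    integrable_finsetSum _ fun j _ => integrable_finsetSum _ fun i _ => hint i j j i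
  have hpt : ∀ x, ∑ j, ∑ i, A x (e j) i ^ 2
      = 2 / 3 * tr (A x) ^ 2 - ∑ j, ∑ i, A x (e j) i * A x (e i) j := by
    intro x
    have h1 := sum_devSym_mul (A x)
    simp only [hA, h, zero_mul, Finset.sum_const_zero] at h1
    linarith
  have htri : Integrable fun x => 2 / 3 * tr (A x) ^ 2 := by
    refine (hNi.add hXi).congr (Filter.Eventually.of_forall fun x => ?_)
    simp only [Pi.add_apply, hpt x, sub_add_cancel]
  have hN0 : ∀ x, 0 ≤ ∑ j, ∑ i, A x (e j) i ^ 2 := fun x =>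
    Finset.sum_nonneg fun _ _ => Finset.sum_nonneg fun _ _ => sq_nonneg _
  have hN : ∫ x, ∑ j, ∑ i, A x (e j) i ^ 2 = 0 := by
    refine le_antisymm ?_ (integral_nonneg hN0)
    simp only [hpt]
    rw [integral_sub htri hXi, hswap, integral_const_mul]
    have : 0 ≤ ∫ x, tr (A x) ^ 2 := integral_nonneg fun x => sq_nonneg _
    linarith
  have hNc : Continuous fun x => ∑ j, ∑ i, A x (e j) i ^ 2 :=
    continuous_finsetSum _ fun j _ => continuous_finsetSum _ fun i _ => (hAc i j).pow 2
  have hN' : (fun x => ∑ j, ∑ i, A x (e j) i ^ 2) = fun _ => 0 :=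
    (hNc.ae_eq_iff_eq volume continuous_const).1
      ((integral_eq_zero_iff_of_nonneg hN0 hNi).1 hN)
  have hA0 : ∀ x, fderiv ℝ W x = 0 := by
    intro x
    have h1 := congrFun hN' x
    refine clm_ext_e fun i j => ?_
    have h2 := (Finset.sum_eq_zero_iff_of_nonneg fun _ _ =>
      Finset.sum_nonneg fun _ _ => sq_nonneg _).1 h1 j (Finset.mem_univ _)
    have h3 := (Finset.sum_eq_zero_iff_of_nonneg fun _ _ => sq_nonneg _).1 h2 i (Finset.mem_univ _)
    simpa using h3
  obtain ⟨y, hy⟩ := (ne_univ_iff_exists_notMem _).1 hWc.isCompact.ne_univ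
  ext1 x
  rw [is_const_of_fderiv_eq_zero (hW.differentiable (by simp)) hA0 x y,
    image_eq_zero_of_notMem_tsupport hy, Pi.zero_apply]

/-- `devSym` as a continuous linear form. -/
def devSymL (i j : Fin 3) : (E3 →L[ℝ] E3) →L[ℝ] ℝ :=
  entryL i j + entryL j i - (2 / 3 * if i = j then 1 else 0 : ℝ) • trL

theorem devSymL_apply (i j : Fin 3) (A : E3 →L[ℝ] E3) : devSymL i j A = devSym i j A := by
  rw [devSymL, _root_.sub_apply, _root_.add_apply, _root_.smul_apply, entryL_apply, entryL_apply,
    trL_apply, devSym, smul_eq_mul]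
  ring

/-- A Sobolev field of compact support is zero if its deviatoric symmetric gradient vanishes:
mollify, and pass to the limit. -/
theorem HasGlobalGradient.ae_eq_zero {w : E3 → E3} {G : E3 → E3 →L[ℝ] E3}
    (h : HasGlobalGradient w G) (hwc : HasCompactSupport w) {s : ℝ} (hs : 1 ≤ s)
    (hws : MemLp w (ENNReal.ofReal s) volume) (hG : ∀ i j, ∀ᵐ x, devSym i j (G x) = 0) :
    ∀ᵐ x, w x = 0 := by
  obtain ⟨σ, hσ, hσc, hσ0, hσ1⟩ := exists_mollifier
  have hlim := tendsto_eLpNorm_dil_convolution_sub hσ hσc hσ0 hσ1 hs hws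
  have hW : ∀ n, (dil n σ ⋆[lsmul ℝ ℝ, volume] w) = 0 := by
    intro n
    have hd := contDiff_dil hσ n
    have hdc := hasCompactSupport_dil hσc n
    refine eq_zero_of_devSym_fderiv_eq_zero (hdc.contDiff_convolution_left _ hd h.1)
      (hdc.convolution _ hwc) fun i j x => ?_
    rw [h.fderiv_convolution hd hdc, ← devSymL_apply, convolution_def]
    have hi : Integrable (fun t => (lsmul ℝ ℝ (dil n σ t)) (G (x - t))) volume :=
      hdc.convolutionExists_left (lsmul ℝ ℝ) hd.continuous h.2.1 x
    rw [← ContinuousLinearMap.integral_comp_comm _ hi]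
    refine integral_eq_zero_of_ae ?_
    have hG' := (Measure.measurePreserving_sub_left volume x).quasiMeasurePreserving.ae (hG i j)
    filter_upwards [hG'] with t ht
    rw [ContinuousLinearMap.lsmul_apply, map_smul, devSymL_apply, ht, smul_zero, Pi.zero_apply]
  simp only [hW, zero_sub, eLpNorm_neg] at hlim
  have h0 := tendsto_nhds_unique tendsto_const_nhds hlim
  rw [eLpNorm_eq_zero_iff hws.1 (by simpa using by linarith)] at h0
  exact h0

/-- A Sobolev field on the cavity whose viscous dissipation integrates to zero has no deviatoric
symmetric gradient. -/
theorem ae_devSym_eq_zero {C : Set E3} {mu lam s q : ℝ} (hmu : 0 < mu)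
    (hlam : 0 ≤ lam) (hsq : s.HolderConjugate q) (hs : 2 ≤ s) (hCb : Bornology.IsBounded C)
    {A : E3 → E3 →L[ℝ] E3} (hA : MemLp A (ENNReal.ofReal s) (volume.restrict C))
    (h : ∫ x in C, contract (stress mu lam (A x)) (A x) = 0) :
    ∀ᵐ x ∂(volume.restrict C), ∀ i j, devSym i j (A x) = 0 := by
  have := isFiniteMeasure_restrict hCb
  have hi := integrableOn_contract hsq
    ((memLp_stress hA mu lam).mono_exponent
      (ENNReal.ofReal_le_ofReal (le_of_holderConjugate hsq hs))) hA
  have h0 : ∀ x, 0 ≤ contract (stress mu lam (A x)) (A x) := fun x => by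
    rw [contract_stress_self]
    have : 0 ≤ ∑ j, ∑ i, devSym i j (A x) ^ 2 :=
      Finset.sum_nonneg fun _ _ => Finset.sum_nonneg fun _ _ => sq_nonneg _
    positivity
  filter_upwards [(integral_eq_zero_iff_of_nonneg h0 hi).1 h] with x hx i j
  rw [Pi.zero_apply, contract_stress_self] at hx
  have h1 : 0 ≤ ∑ j, ∑ i, devSym i j (A x) ^ 2 :=
    Finset.sum_nonneg fun _ _ => Finset.sum_nonneg fun _ _ => sq_nonneg _
  have h2 : ∑ j, ∑ i, devSym i j (A x) ^ 2 = 0 := by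
    have h3 : 0 ≤ lam * tr (A x) ^ 2 := by positivity
    have h4 : 0 < mu / 2 := by positivity
    nlinarith
  have h3 := (Finset.sum_eq_zero_iff_of_nonneg fun _ _ =>
    Finset.sum_nonneg fun _ _ => sq_nonneg _).1 h2 j (Finset.mem_univ _)
  have h4 := (Finset.sum_eq_zero_iff_of_nonneg fun _ _ => sq_nonneg _).1 h3 i (Finset.mem_univ _)
  simpa using h4

/-- The relative velocity of a renormalized weak solution vanishes. -/
theorem IsRenormalizedWeakSolution.relVel_ae_eq_zero {P : CavityBody} {mu lam a γ : ℝ}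
    (hmu : 0 < mu) (hlam : 0 ≤ lam) (ha : 0 < a) (hγ : 1 < γ)
    {ρ : E3 → ℝ} {u : E3 → E3} {om ξ : E3}
    (h : IsRenormalizedWeakSolution P mu lam a γ ρ u om ξ) :
    ∀ᵐ x ∂(volume.restrict P.cavity), relVel u om ξ x = 0 := by
  obtain ⟨hρ, hρ0, hrigid, -, -, s, G, hexp, ⟨hG, hus, hGs⟩, hmom, hcont, hren⟩ := h
  have hC := P.isOpen_cavity
  have hCm := hC.measurableSet
  have hCb := P.isBounded_cavity
  have hCS : P.cavity ⊆ P.system := subset_closure.trans P.closure_cavity_subset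
  have hcone : ∀ x ∈ closure P.cavity, HasConeAt P.cavity x := fun x hx =>
    P.lipschitz_cavity.hasConeAt hC hx
  obtain ⟨hs, r, -, hr, K, hK, hsob⟩ := hexp.exists_sobolev hγ hCm hCb
  have hsq := Real.HolderConjugate.conjExponent (show 1 < s by linarith)
  have := isFiniteMeasure_restrict hCb
  have hv0 : ∀ᵐ x, x ∈ P.system \ P.cavity → relVel u om ξ x = 0 := by
    have h1 := (ae_restrict_iff' (P.isOpen_system.measurableSet.diff hCm)).1 hrigid
    filter_upwards [h1] with x hx hxB
    rw [relVel, hx hxB]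
    abel
  have hglob := (hG.sub_rigidVel om ξ).hasGlobalGradient_indicator P.isOpen_system
    hC hCb P.closure_cavity_subset (P.lipschitz_cavity.volume_frontier hC) hv0
  have hvs : MemLp (relVel u om ξ) (ENNReal.ofReal s) (volume.restrict P.cavity) := by
    have h1 := (hus.mono_measure (Measure.restrict_mono hCS le_rfl)).sub
      (memLp_rigidVel hCm hCb om ξ (ENNReal.ofReal s))
    have h2 : relVel u om ξ = u - rigidVel om ξ := by
      ext1 x
      rw [relVel, Pi.sub_apply, rigidVel]
      abel
    rwa [h2]
  have hAs : MemLp (relGrad G om) (ENNReal.ofReal s) (volume.restrict P.cavity) :=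
    (hGs.mono_measure (Measure.restrict_mono hCS le_rfl)).sub (memLp_const _)
  have hws := (memLp_indicator_iff_restrict hCm).2 hvs
  obtain ⟨φ, hφ⟩ := exists_approximates hC hCb hcone (by linarith : 1 ≤ s) hK hsob hglob
    (fun x hx => indicator_of_notMem hx _) (fun x hx => indicator_of_notMem hx _) hws
    ((memLp_indicator_iff_restrict hCm).2 hAs)
  have hdev := ae_devSym_eq_zero hmu hlam hsq hs hCb hAs
    (hφ.integral_dissipation_eq_zero hC hCb hcone ha hγ hs hsq hr hρ hρ0 hmom hcont hren)
  rw [ae_restrict_iff' hCm] at hdev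
  have hw0 := hglob.ae_eq_zero
    (HasCompactSupport.intro hCb.isCompact_closure fun x hx =>
      indicator_of_notMem (fun h => hx (subset_closure h)) _) (by linarith : 1 ≤ s) hws
    fun i j => by
      filter_upwards [hdev] with x hx
      by_cases hxC : x ∈ P.cavity
      · rw [indicator_of_mem hxC]
        exact hx hxC i j
      · rw [indicator_of_notMem hxC]
        simp [← devSymL_apply]
  rw [ae_restrict_iff' hCm]
  filter_upwards [hw0] with x hx hxC
  rwa [indicator_of_mem hxC] at hx

end BodyFluid

end

theorem lemma1 (P : BodyFluid.CavityBody) (mu lam a γ : ℝ)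
    (hmu : 0 < mu) (hlam : 0 ≤ lam) (ha : 0 < a) (hγ : 1 < γ)
    (ρ : BodyFluid.E3 → ℝ) (u : BodyFluid.E3 → BodyFluid.E3) (om ξ : BodyFluid.E3)
    (h : BodyFluid.IsRenormalizedWeakSolution P mu lam a γ ρ u om ξ) :
    ∀ᵐ x ∂(MeasureTheory.volume.restrict P.cavity), BodyFluid.relVel u om ξ x = 0 := by
  exact h.relVel_ae_eq_zero hmu hlam ha hγ
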